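/- Let $P$ be a polygonal billiard table, i.e. the closed region in the Euclidean plane bounded by a simple closed polygon with finitely many edges (straight angles are allowed as vertices), and let the alphabet $\mathcal A$ be the set of edges of $P$. A billiard trajectory is nonsingular if it never meets a vertex. Let $\mathsf B(P)\subset\mathcal A^{\mathbb Z}$ be the set of sequences of edges hit by nonsingular bi-infinite billiard trajectories in $P$ (with every choice of base point, so that the set is shift invariant), let $\mathcal L$ be the set of finite subwords of the sequences in $\mathsf B(P)$, and let $\mathsf B_+(P)\subset\mathcal A^{\mathbb N}$ be the set of sequences of edges hit by forward billiard trajectories that start at any point of $P$ and meet no vertex after the start (an edge containing the starting point is not recorded). Closures are taken in the product topologies, with $\mathcal A$ discrete. A sequence $(E_i)_{i\ge 1}$ in $\mathcal A$ is *grazing* if it extends to some $(E_i)_{i\in\mathbb Z}\in\overline{\mathsf B(P)}$ for which there are edges $F,G$ with $\{E_0,E_1\}\cap\{F,G\}=\emptyset$, $(F,E_0,E_{-1},E_{-2},\dots)\in\overline{\mathsf B_+(P)}$ and $(G,E_1,E_2,\dots)\in\overline{\mathsf B_+(P)}$; otherwise it is *non-grazing*. It is *aperiodic* if there is no $p\ge1$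 with $E_{i+p}=E_i$ for all $i\ge1$. Then for any edges $A$, $B$ of $P$: $A$ and $B$ share a vertex at which the interior angle of $P$ is $\pi/2$ if and only if there is an aperiodic non-grazing sequence $(E_i)_{i\ge1}$ of edges such that $$E_n\cdots E_1\,A\,B\,E_1\cdots E_n\in\mathcal L\quad\text{for all } n\in\mathbb N.$$ -/

import Mathlib

open Set Filter Topology

noncomputable section

namespace Billiard

/-- The Euclidean plane. -/
abbrev Plane : Type := EuclideanSpace ℝ (Fin 2)

variable {n : ℕ}

/-- A simple closed polygon: consecutive edges meet exactly in their common vertex, and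
non-consecutive edges are disjoint.  Edge `i` is the segment from vertex `i` to vertex
`finRotate n i` (the next one in cyclic order).  Straight angles are permitted. -/
structure IsSimple (P : Polygon Plane n) : Prop where
  three_le : 3 ≤ n
  nondegenerate : P.HasNondegenerateEdges
  consecutive : ∀ i : Fin n,
    P.edgeSet ℝ i ∩ P.edgeSet ℝ (finRotate n i) = {P (finRotate n i)}
  nonconsecutive : ∀ i j : Fin n, i ≠ j → j ≠ finRotate n i → i ≠ finRotate n j →
    Disjoint (P.edgeSet ℝ i) (P.edgeSet ℝ j)

/-- The open region enclosed by the polygon: the points of the bounded components of the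
complement of the boundary. -/
def inside (P : Polygon Plane n) : Set Plane :=
  {x | x ∉ P.boundary ℝ ∧ Bornology.IsBounded (connectedComponentIn (P.boundary ℝ)ᶜ x)}

/-- The billiard table: the closed region bounded by the polygon. -/
def table (P : Polygon Plane n) : Set Plane := inside P ∪ P.boundary ℝ

/-- The relative interior of edge `i`. -/
def openEdge (P : Polygon Plane n) (i : Fin n) : Set Plane :=
  openSegment ℝ (P i) (P (finRotate n i))

/-- Optical reflection of a velocity in the line spanned by edge `i`. -/
def reflectIn (P : Polygon Plane n) (i : Fin n) (v : Plane) : Plane :=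
  (Submodule.span ℝ {P (finRotate n i) - P i}).reflection v

/-- Interior angle of the table at vertex `i`: the unsigned angle between the two edges at that
vertex if the (convex) sector between them is where the table lies near the vertex, and the
complementary angle to `2 * π` otherwise. -/
def interiorAngle (P : Polygon Plane n) (i : Fin n) : ℝ :=
  open scoped Classical in
  if ∀ᶠ t : ℝ in 𝓝[>] 0,
      AffineMap.lineMap (P i) (midpoint ℝ (P ((finRotate n).symm i)) (P (finRotate n i))) t
        ∈ inside P
  then EuclideanGeometry.angle (P ((finRotate n).symm i)) (P i) (P (finRotate n i))
  else 2 * Real.pi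
    - EuclideanGeometry.angle (P ((finRotate n).symm i)) (P i) (P (finRotate n i))

/-- Edges `A` and `B` share a vertex, at which the interior angle of the table is `θ`. -/
def MeetAtAngle (P : Polygon Plane n) (A B : Fin n) (θ : ℝ) : Prop :=
  (B = finRotate n A ∧ interiorAngle P B = θ) ∨ (A = finRotate n B ∧ interiorAngle P A = θ)

/-- One free flight followed by one bounce: the particle at position `s.1` moving with velocity
`s.2` flies through the open interior of the table until it hits the relative interior of edge `i`
at `s'.1`, and leaves it with the reflected velocity `s'.2`. -/
def Bounce (P : Polygon Plane n) (i : Fin n) (s s' : Plane × Plane) : Prop :=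
  (∃ t : ℝ, 0 < t ∧ s'.1 = s.1 + t • s.2) ∧
  openSegment ℝ s.1 s'.1 ⊆ inside P ∧
  s'.1 ∈ openEdge P i ∧
  s'.2 = reflectIn P i s.2

/-- The bounce spectrum: bounce sequences of nonsingular bi-infinite (unit speed) trajectories;
`s k` is the position and outgoing velocity at the bounce number `k`.  The choice of the base
point of a trajectory only shifts the indices. -/
def bounceSpectrum (P : Polygon Plane n) : Set (ℤ → Fin n) :=
  {e | ∃ s : ℤ → Plane × Plane, ∀ k : ℤ, ‖(s k).2‖ = 1 ∧ Bounce P (e (k + 1)) (s k) (s (k + 1))}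

/-- The forward bounce spectrum: bounce sequences of nonsingular forward (unit speed)
trajectories starting at an arbitrary point of the table. An edge containing the starting
point is not recorded. -/
def forwardBounceSpectrum (P : Polygon Plane n) : Set (ℕ → Fin n) :=
  {e | ∃ s : ℕ → Plane × Plane, (s 0).1 ∈ table P ∧
    ∀ k : ℕ, ‖(s k).2‖ = 1 ∧ Bounce P (e k) (s k) (s (k + 1))}

/-- The bounce language: finite subwords of sequences in the bounce spectrum. -/
def bounceLanguage (P : Polygon Plane n) : Set (List (Fin n)) :=
  {w | ∃ e ∈ bounceSpectrum P, ∃ m : ℤ, ∀ (j : ℕ) (hj : j < w.length), w[j] = e (m + j)}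

/-- The sequence `a, E 0, E 1, …`. -/
def prepend {α : Type*} (a : α) (E : ℕ → α) : ℕ → α
  | 0 => a
  | k + 1 => E k

/-- `E` (whose terms `E 0, E 1, …` are the `E₁, E₂, …` of the usual notation) is a grazing
sequence: it is the forward tail of a bi-infinite sequence `s` associated with an ideal
trajectory that is grazed by some pair `{F, G}`.  Closures are taken in the product topology. -/
def IsGrazing (P : Polygon Plane n) (E : ℕ → Fin n) : Prop :=
  ∃ s ∈ closure (bounceSpectrum P), (∀ k : ℕ, s (k + 1) = E k) ∧
    ∃ F G : Fin n, ({s 0, s 1} : Set (Fin n)) ∩ {F, G} = ∅ ∧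
      prepend F (fun k : ℕ => s (-(k : ℤ))) ∈ closure (forwardBounceSpectrum P) ∧
      prepend G (fun k : ℕ => s ((k : ℤ) + 1)) ∈ closure (forwardBounceSpectrum P)

/-- A one-sided sequence is aperiodic if it has no positive period. -/
def IsAperiodic {α : Type*} (E : ℕ → α) : Prop :=
  ∀ p : ℕ, 0 < p → ¬ Function.Periodic E p

/-- The word `Eₙ ⋯ E₁ A B E₁ ⋯ Eₙ`, where `E₁ = E 0, E₂ = E 1, …`. -/
def retroWord {α : Type*} (A B : α) (E : ℕ → α) (m : ℕ) : List α :=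
  ((List.range m).map E).reverse ++ [A, B] ++ (List.range m).map E

end Billiard

end

/-! At a right-angled corner the two reflections compose to minus the identity: a trajectory
arriving near the vertex in direction `-u` hits both edges and leaves in direction `u`. If the ray
from the vertex in direction `u` has code `E`, the trajectories close to it read `⋯ E₁ A B E₁ ⋯`.
The theorem says that this phenomenon characterises the right angle, once periodic and grazing codes
are excluded.

Both directions rest on a rigidity statement, `limit_line_eq`: trajectories that follow an aperiodic
code for longer and longer times converge to one line. In the unfolded plane, trajectories with a
common code are lines through common gates. Their lengths grow linearly in the number of bounces
(`exists_length_bound`, which needs the bound on bounces at a corner in `corner_bound`), so their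
directions converge to each other (`exists_parallel_bound`). If the limit lines were parallel but
distinct, every line strictly between them would follow the code forever, and the code of such a
strip is periodic (`exists_periodic_of_strip`).

For the last point, follow the strip through its bounces and choose a limit position that carries a
strip of the largest possible width. If the directions of the strip were not eventually equal to the
limit direction, the strip would slowly drift across the limit strip and widen it for a long time,
against maximality (`exists_wide_of_drift`). This excludes one sense of rotation, and passing to the
next bounce excludes the other. With equal directions, two of the strips overlap, so a state recurs,
and determinism in both directions of time gives a period.

From a corner to a code: all but countably many directions `u` at the corner avoid vertices and have
an aperiodic code. By rigidity, any trajectory that follows `E` for long starts near the corner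
(`CornerRay.exists_near`), so its past is forced to be the retro-reflected one. A grazing pair `{F,
G}` would then have `F = E₁`, which it must not contain.

From a code to a corner: let trajectories through longer and longer words converge, and let `w` be
the limit velocity from `A` to `B`. Rigidity, applied forward from `B` and backward from `A`, shows
that both ends leave in one direction `u` along one line. Hence `w` goes to `u` under the reflection
in `B` and to `-u` under that in `A`, which makes the edges orthogonal. If they meet, a segment
between them cuts a triangle off the table and the interior angle is right. If they are disjoint,
then `w = u` or `w = -u`: the limit line runs along one of the edges and hits the other
perpendicularly, and this makes `E` grazing (`RetroLimit.isGrazing`).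

The planar input is that a convex quadrilateral spanned by two segments that run inside the table
between the same edges lies inside the table (`QuadData.subset_inside`). -/

noncomputable section

namespace Billiard

variable {n : ℕ} {P : Polygon Plane n}

/-! ### The plane -/

/-- The determinant of two vectors of the plane. -/
def cross (a b : Plane) : ℝ := a 0 * b 1 - a 1 * b 0

lemma cross_add_left (a b c : Plane) : cross (a + b) c = cross a c + cross b c := by
  simp [cross]; ring

lemma cross_add_right (a b c : Plane) : cross a (b + c) = cross a b + cross a c := by
  simp [cross]; ring

lemma cross_sub_left (a b c : Plane) : cross (a - b) c = cross a c - cross b c := by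
  simp [cross]; ring

lemma cross_sub_right (a b c : Plane) : cross a (b - c) = cross a b - cross a c := by
  simp [cross]; ring

lemma cross_smul_left (t : ℝ) (a b : Plane) : cross (t • a) b = t * cross a b := by
  simp [cross]; ring

lemma cross_smul_right (t : ℝ) (a b : Plane) : cross a (t • b) = t * cross a b := by
  simp [cross]; ring

@[simp] lemma cross_self (a : Plane) : cross a a = 0 := by
  simp [cross]; ring

lemma cross_neg_left (a b : Plane) : cross (-a) b = -cross a b := by
  simp [cross]; ring

lemma cross_neg_right (a b : Plane) : cross a (-b) = -cross a b := by
  simp [cross]; ring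

lemma cross_comm (a b : Plane) : cross a b = -cross b a := by
  simp [cross]; ring

lemma inner_eq (a b : Plane) : inner ℝ a b = a 0 * b 0 + a 1 * b 1 := by
  simp [PiLp.inner_apply, Fin.sum_univ_two]; ring

lemma norm_sq_eq (a : Plane) : ‖a‖ ^ 2 = a 0 ^ 2 + a 1 ^ 2 := by
  simp [EuclideanSpace.norm_sq_eq, Fin.sum_univ_two]

lemma plane_ext {a b : Plane} (h0 : a 0 = b 0) (h1 : a 1 = b 1) : a = b := by
  ext i; fin_cases i <;> simp [h0, h1]

lemma cross_sq_add_inner_sq (a b : Plane) :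
    cross a b ^ 2 + inner ℝ a b ^ 2 = ‖a‖ ^ 2 * ‖b‖ ^ 2 := by
  rw [norm_sq_eq, norm_sq_eq, inner_eq, cross]; ring

lemma abs_cross_le (a b : Plane) : |cross a b| ≤ ‖a‖ * ‖b‖ := by
  have h := cross_sq_add_inner_sq a b
  apply abs_le_of_sq_le_sq _ (by positivity)
  nlinarith [sq_nonneg (inner ℝ a b)]

lemma continuous_cross : Continuous fun x : Plane × Plane => cross x.1 x.2 := by
  unfold cross; fun_prop

lemma Continuous.cross {X : Type*} [TopologicalSpace X] {f g : X → Plane}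
    (hf : Continuous f) (hg : Continuous g) : Continuous fun x => cross (f x) (g x) :=
  continuous_cross.comp (hf.prodMk hg)

lemma tendsto_cross {X : Type*} {l : Filter X} {f g : X → Plane} {a b : Plane}
    (hf : Tendsto f l (𝓝 a)) (hg : Tendsto g l (𝓝 b)) :
    Tendsto (fun x => cross (f x) (g x)) l (𝓝 (cross a b)) :=
  (continuous_cross.tendsto (a, b)).comp (hf.prodMk_nhds hg)

/-- Cramer's rule, the linear relation among three vectors of the plane; it serves whenever a vector
is expressed through two others. -/
lemma cross_smul_eq (u a b : Plane) : cross u b • a = cross a b • u + cross u a • b := by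
  apply plane_ext <;> simp [cross] <;> ring

lemma eq_smul_of_cross_eq_zero {u a : Plane} (hu : ‖u‖ = 1) (h : cross u a = 0) :
    a = (inner ℝ u a) • u := by
  have h1 : u 0 ^ 2 + u 1 ^ 2 = 1 := by rw [← norm_sq_eq, hu]; norm_num
  have h2 : u 0 * a 1 - u 1 * a 0 = 0 := h
  apply plane_ext
  · simp only [inner_eq, PiLp.smul_apply, smul_eq_mul]; linear_combination -a 0 * h1 - u 1 * h2
  · simp only [inner_eq, PiLp.smul_apply, smul_eq_mul]; linear_combination -a 1 * h1 + u 0 * h2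

/-! ### Simple polygons -/

lemma edgeSet_eq (P : Polygon Plane n) (i : Fin n) :
    P.edgeSet ℝ i = segment ℝ (P i) (P (finRotate n i)) := by
  rw [Polygon.edgeSet, affineSegment_eq_segment]

lemma openEdge_subset (P : Polygon Plane n) (i : Fin n) : openEdge P i ⊆ P.edgeSet ℝ i := by
  rw [edgeSet_eq]; exact openSegment_subset_segment ..

lemma edgeSet_subset_boundary (P : Polygon Plane n) (i : Fin n) :
    P.edgeSet ℝ i ⊆ P.boundary ℝ := subset_iUnion (fun i => P.edgeSet ℝ i) i

lemma isCompact_segment (a b : Plane) : IsCompact (segment ℝ a b) := by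
  rw [segment_eq_image_lineMap]
  exact isCompact_Icc.image AffineMap.lineMap_continuous

lemma isCompact_edgeSet (P : Polygon Plane n) (i : Fin n) : IsCompact (P.edgeSet ℝ i) := by
  rw [edgeSet_eq]; exact isCompact_segment ..

lemma isCompact_boundary (P : Polygon Plane n) : IsCompact (P.boundary ℝ) :=
  isCompact_iUnion fun i => isCompact_edgeSet P i

lemma isOpen_compl_boundary (P : Polygon Plane n) : IsOpen (P.boundary ℝ)ᶜ :=
  (isCompact_boundary P).isClosed.isOpen_compl

lemma notMem_inside_of_mem_edgeSet {x : Plane} {i : Fin n} (hx : x ∈ P.edgeSet ℝ i) :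
    x ∉ inside P := fun h => h.1 (edgeSet_subset_boundary P i hx)

lemma notMem_inside_of_mem_openEdge {x : Plane} {i : Fin n} (hx : x ∈ openEdge P i) :
    x ∉ inside P := notMem_inside_of_mem_edgeSet (openEdge_subset P i hx)

/-- `inside` is a union of components of the complement of the boundary, so one inside point decides
for a whole connected set. All statements that something lies inside the table are obtained in this
way. -/
lemma subset_inside {U : Set Plane} (hU : IsPreconnected U) (hd : Disjoint U (P.boundary ℝ))
    (h : (U ∩ inside P).Nonempty) : U ⊆ inside P := by
  obtain ⟨x, hxU, hx⟩ := h
  have hsub : U ⊆ (P.boundary ℝ)ᶜ := fun y hy hyb => disjoint_left.1 hd hy hyb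
  intro y hy
  refine ⟨hsub hy, ?_⟩
  have : y ∈ connectedComponentIn (P.boundary ℝ)ᶜ x := hU.subset_connectedComponentIn hxU hsub hy
  rw [← connectedComponentIn_eq this]
  exact hx.2

lemma isOpen_inside (P : Polygon Plane n) : IsOpen (inside P) := by
  rw [isOpen_iff_forall_mem_open]
  intro x hx
  refine ⟨connectedComponentIn (P.boundary ℝ)ᶜ x, ?_, (isOpen_compl_boundary P).connectedComponentIn,
    mem_connectedComponentIn hx.1⟩
  exact subset_inside isPreconnected_connectedComponentIn
    (disjoint_left.2 fun y hy hyb => connectedComponentIn_subset _ _ hy hyb)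
    ⟨x, mem_connectedComponentIn hx.1, hx⟩

lemma IsSimple.ne_rotate (hP : IsSimple P) (i : Fin n) : finRotate n i ≠ i := by
  intro h
  exact hP.nondegenerate i (by rw [h])

lemma left_notMem_openSegment {a b : Plane} (h : a ≠ b) : a ∉ openSegment ℝ a b := by
  rw [left_mem_openSegment_iff]; exact h

lemma right_notMem_openSegment {a b : Plane} (h : a ≠ b) : b ∉ openSegment ℝ a b := by
  rw [right_mem_openSegment_iff]; exact h

/-- The endpoints of an edge lie on it. -/
lemma left_mem_edgeSet (P : Polygon Plane n) (i : Fin n) : P i ∈ P.edgeSet ℝ i := by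
  rw [edgeSet_eq]; exact left_mem_segment ..

lemma right_mem_edgeSet (P : Polygon Plane n) (i : Fin n) :
    P (finRotate n i) ∈ P.edgeSet ℝ i := by
  rw [edgeSet_eq]; exact right_mem_segment ..

lemma IsSimple.eq_vertex (hP : IsSimple P) {i j : Fin n} (hij : i ≠ j) {x : Plane}
    (hi : x ∈ P.edgeSet ℝ i) (hj : x ∈ P.edgeSet ℝ j) :
    (j = finRotate n i ∧ x = P j) ∨ (i = finRotate n j ∧ x = P i) := by
  by_cases h1 : j = finRotate n i
  · left; refine ⟨h1, ?_⟩
    have := hP.consecutive i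
    rw [← h1] at this
    have h2 : x ∈ ({P j} : Set Plane) := this ▸ ⟨hi, hj⟩
    simpa using h2
  by_cases h2 : i = finRotate n j
  · right; refine ⟨h2, ?_⟩
    have := hP.consecutive j
    rw [← h2] at this
    have h2 : x ∈ ({P i} : Set Plane) := this ▸ ⟨hj, hi⟩
    simpa using h2
  exact absurd hj (disjoint_left.1 (hP.nonconsecutive i j hij h1 h2) hi)

lemma IsSimple.notMem_edgeSet (hP : IsSimple P) {i j : Fin n} (hij : i ≠ j) {x : Plane}
    (hi : x ∈ openEdge P i) : x ∉ P.edgeSet ℝ j := by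
  intro hj
  have hne := hP.nondegenerate i
  rcases hP.eq_vertex hij (openEdge_subset P i hi) hj with ⟨h, rfl⟩ | ⟨h, rfl⟩
  · subst h
    exact right_notMem_openSegment hne hi
  · exact left_notMem_openSegment hne hi

lemma IsSimple.eq_of_mem (hP : IsSimple P) {i j : Fin n} {x : Plane}
    (hi : x ∈ openEdge P i) (hj : x ∈ P.edgeSet ℝ j) : i = j := by
  by_contra h
  exact hP.notMem_edgeSet h hi hj

lemma IsSimple.vertex_injective (hP : IsSimple P) : Function.Injective P.vertices := by
  intro i j hij
  by_contra hne
  have hi := left_mem_edgeSet P i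
  have hj := left_mem_edgeSet P j
  have key : ∀ i j : Fin n, P i = P j → j = finRotate n i → False := by
    rintro i j h rfl
    exact hP.nondegenerate i h
  rcases hP.eq_vertex hne hi (by rw [hij]; exact hj) with ⟨h, -⟩ | ⟨h, -⟩
  · exact key i j hij h
  · exact key j i hij.symm h

/-- At most two edges pass through a point. -/
lemma IsSimple.eq_or_eq_of_mem (hP : IsSimple P) {i j k : Fin n} (hij : i ≠ j) {x : Plane}
    (hi : x ∈ P.edgeSet ℝ i) (hj : x ∈ P.edgeSet ℝ j) (hk : x ∈ P.edgeSet ℝ k) :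
    k = i ∨ k = j := by
  have inj := hP.vertex_injective
  have key : ∀ i j : Fin n, j = finRotate n i → x = P j → x ∈ P.edgeSet ℝ i →
      x ∈ P.edgeSet ℝ j → k = i ∨ k = j := by
    intro i j h hx hi hj
    by_contra! hc
    rcases hP.eq_vertex hc.1 hk hi with ⟨h1, h2⟩ | ⟨h1, h2⟩
    · have := inj (hx.symm.trans h2)
      exact hP.ne_rotate i (by rw [← h, this])
    · have := inj (hx.symm.trans h2)
      exact hc.2 this.symm
  rcases hP.eq_vertex hij hi hj with ⟨h1, h2⟩ | ⟨h1, h2⟩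
  · exact key i j h1 h2 hi hj
  · exact (key j i h1 h2 hj hi).symm

lemma mem_openEdge_or_vertex {x : Plane} {i : Fin n} (hx : x ∈ P.edgeSet ℝ i) :
    x ∈ openEdge P i ∨ ∃ j, x = P j := by
  rw [edgeSet_eq, ← insert_endpoints_openSegment] at hx
  rcases hx with h | h | h
  · exact .inr ⟨_, h⟩
  · exact .inr ⟨_, h⟩
  · exact .inl h

/-- A set of edges that contains an edge and is closed under passing to the next edge contains
all the edges. -/
lemma forall_of_rotate {p : Fin n → Prop} (h : ∀ i, p i → p (finRotate n i)) {i : Fin n}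
    (hi : p i) (j : Fin n) : p j := by
  rcases n with _ | m
  · exact i.elim0
  have key : ∀ k : ℕ, p (i + (Fin.ofNat (m+1) k)) := by
    intro k
    induction k with
    | zero => simpa using hi
    | succ k ih =>
      have h2 := h _ ih
      rw [finRotate_apply, add_assoc] at h2
      convert h2 using 2
      ext; simp [Fin.val_add]
  have := key (j - i : Fin (m+1)).val
  rwa [show i + Fin.ofNat (m+1) (j - i : Fin (m+1)).val = j by
    simp] at this

/-- A region bounded by parts of edges and by curves avoiding the boundary is free of boundary
points. -/
lemma disjoint_boundary_of_frontier {U : Set Plane} (hU : IsOpen U)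
    (h : ∀ j, Disjoint (P.edgeSet ℝ j) U ∨ Disjoint (P.edgeSet ℝ j) (closure U \ U))
    (h0 : ∃ j, Disjoint (P.edgeSet ℝ j) U) : Disjoint U (P.boundary ℝ) := by
  rw [disjoint_right]
  intro x hx hxU
  obtain ⟨i, hi⟩ := mem_iUnion.1 hx
  obtain ⟨j, hj⟩ := h0
  -- An edge that meets `U` cannot cross its frontier, so by connectedness it lies in `U`. Its
  -- endpoint hands the property to the next edge, and so around the polygon to the edge `j` that
  -- avoids `U`.
  have hsub : ∀ i, (P.edgeSet ℝ i ∩ U).Nonempty → P.edgeSet ℝ i ⊆ U := by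
    intro i hi
    have hfr := (h i).resolve_left (by rwa [not_disjoint_iff_nonempty_inter])
    have hconn : IsPreconnected (P.edgeSet ℝ i) := by
      rw [edgeSet_eq]; exact (convex_segment _ _).isPreconnected
    refine hconn.subset_left_of_subset_union hU isClosed_closure.isOpen_compl
      (disjoint_left.2 fun y hy hy' => hy' (subset_closure hy)) (fun y hy => ?_) hi
    by_cases hyU : y ∈ U
    · exact .inl hyU
    · exact .inr fun hyc => disjoint_left.1 hfr hy ⟨hyc, hyU⟩
  have := forall_of_rotate (p := fun i => (P.edgeSet ℝ i ∩ U).Nonempty)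
    (fun i hi => ⟨P (finRotate n i), left_mem_edgeSet P _, hsub i hi (right_mem_edgeSet P i)⟩)
    ⟨x, hi, hxU⟩ j
  exact this.ne_empty (disjoint_iff_inter_eq_empty.1 hj)

/-! ### Visibility between edges -/

/-- The open segment from `p` on edge `a` to `q` on edge `b` runs inside the table. -/
structure Vis (P : Polygon Plane n) (a b : Fin n) (p q : Plane) : Prop where
  left : p ∈ openEdge P a
  right : q ∈ openEdge P b
  sub : openSegment ℝ p q ⊆ inside P

lemma Vis.symm {a b : Fin n} {p q : Plane} (h : Vis P a b p q) : Vis P b a q p :=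
  ⟨h.right, h.left, by rw [openSegment_symm]; exact h.sub⟩

lemma openSegment_nonempty' (p q : Plane) : (openSegment ℝ p q).Nonempty :=
  ⟨midpoint ℝ p q, midpoint_mem_openSegment p q⟩

lemma convex_openEdge (P : Polygon Plane n) (i : Fin n) : Convex ℝ (openEdge P i) :=
  convex_openSegment _ _

lemma Vis.edge_ne {a b : Fin n} {p q : Plane} (h : Vis P a b p q) : a ≠ b := by
  rintro rfl
  obtain ⟨x, hx⟩ := openSegment_nonempty' p q
  exact notMem_inside_of_mem_openEdge ((convex_openEdge P a).openSegment_subset h.left h.right hx)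
    (h.sub hx)

lemma cross_eq_zero_of_mem_segment {a b x y z : Plane} (hx : x ∈ segment ℝ a b)
    (hy : y ∈ segment ℝ a b) (hz : z ∈ segment ℝ a b) : cross (y - x) (z - x) = 0 := by
  rw [segment_eq_image'] at hx hy hz
  obtain ⟨r, -, rfl⟩ := hx
  obtain ⟨s, -, rfl⟩ := hy
  obtain ⟨t, -, rfl⟩ := hz
  simp [cross]; ring

lemma cross_edge {a : Fin n} {x y z : Plane} (hx : x ∈ P.edgeSet ℝ a) (hy : y ∈ P.edgeSet ℝ a)
    (hz : z ∈ P.edgeSet ℝ a) : cross (y - x) (z - x) = 0 := by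
  rw [edgeSet_eq] at hx hy hz
  exact cross_eq_zero_of_mem_segment hx hy hz

lemma eq_smul_of_cross_eq_zero' {u a b : Plane} (h : cross u a = 0) (hb : cross u b ≠ 0) :
    a = (cross a b / cross u b) • u := by
  have := cross_smul_eq u a b
  rw [h, zero_smul, add_zero] at this
  rw [div_eq_inv_mul, mul_smul, ← this, smul_smul, inv_mul_cancel₀ hb, one_smul]

lemma cross_add_smul_self (v p : Plane) (t : ℝ) : cross v (p + t • v) = cross v p := by
  rw [cross_add_right, cross_smul_right, cross_self, mul_zero, add_zero]

lemma exists_convex_comb {A B τ : ℝ} (hA : A < τ) (hB : τ < B) :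
    ∃ μ : ℝ, 0 < μ ∧ μ < 1 ∧ (1 - μ) * A + μ * B = τ := by
  have h : B - A ≠ 0 := by linarith
  refine ⟨(τ - A) / (B - A), div_pos (by linarith) (by linarith),
    (div_lt_one (by linarith)).2 (by linarith), ?_⟩
  field_simp; ring

lemma add_smul_sub_mem_openSegment {p q : Plane} {s : ℝ} (h0 : 0 < s) (h1 : s < 1) :
    p + s • (q - p) ∈ openSegment ℝ p q := by
  rw [openSegment_eq_image']; exact ⟨s, ⟨h0, h1⟩, rfl⟩

lemma add_smul_sub_mem_segment {p q : Plane} {s : ℝ} (h0 : 0 ≤ s) (h1 : s ≤ 1) :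
    p + s • (q - p) ∈ segment ℝ p q := by
  rw [segment_eq_image']; exact ⟨s, ⟨h0, h1⟩, rfl⟩

/-- A segment inside the table is transverse to the edge at which it starts. -/
lemma cross_ne_zero_of_openSegment {a : Fin n} {p q : Plane} (hp : p ∈ openEdge P a)
    (hpq : openSegment ℝ p q ⊆ inside P) (ha : P a ≠ P (finRotate n a)) :
    cross (P (finRotate n a) - P a) (q - p) ≠ 0 := by
  intro h0
  set d := P (finRotate n a) - P a with hd
  have hd0 : d ≠ 0 := sub_ne_zero.2 ha.symm
  have hpos : 0 < d 0 ^ 2 + d 1 ^ 2 := by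
    rw [← norm_sq_eq]; have := norm_pos_iff.2 hd0; positivity
  obtain ⟨l, hl⟩ : ∃ l : ℝ, q - p = l • d := by
    let b : Plane := !₂[-d 1, d 0]
    have hb : cross d b ≠ 0 := by
      simp only [cross, b]; simp; nlinarith
    exact ⟨_, eq_smul_of_cross_eq_zero' h0 hb⟩
  rw [openEdge, openSegment_eq_image'] at hp
  obtain ⟨r, ⟨hr0, hr1⟩, rfl⟩ := hp
  -- A segment parallel to the edge would remain in the open edge for small parameters `s`, where
  -- there are no inside points.
  obtain ⟨s, hs0, hs1, hs2, hs3⟩ : ∃ s : ℝ, 0 < s ∧ s < 1 ∧ 0 < r + s * l ∧ r + s * l < 1 := by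
    have hc : Tendsto (fun s : ℝ => r + s * l) (𝓝[>] 0) (𝓝 r) := by
      have : Continuous fun s : ℝ => r + s * l := by fun_prop
      simpa using (this.tendsto 0).mono_left nhdsWithin_le_nhds
    have h1 := hc.eventually (Ioo_mem_nhds hr0 hr1)
    have h2 : ∀ᶠ s : ℝ in 𝓝[>] 0, s ∈ Ioo (0:ℝ) 1 := Ioo_mem_nhdsGT one_pos
    obtain ⟨s, h1, h2⟩ := (h1.and h2).exists
    exact ⟨s, h2.1, h2.2, h1.1, h1.2⟩
  have h1 := hpq (add_smul_sub_mem_openSegment hs0 hs1)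
  refine notMem_inside_of_mem_openEdge (i := a) ?_ h1
  rw [hl, openEdge, openSegment_eq_image']
  refine ⟨r + s * l, ⟨hs2, hs3⟩, ?_⟩
  simp only [← hd]
  module

lemma Vis.cross_ne_zero {a b : Fin n} {p q : Plane} (h : Vis P a b p q)
    (ha : P a ≠ P (finRotate n a)) : cross (P (finRotate n a) - P a) (q - p) ≠ 0 :=
  cross_ne_zero_of_openSegment h.left h.sub ha

/-! ### Quadrilaterals between two visible segments -/

/-- The quadrilateral cut out by two lines through `p₁`, `p₂` with directions `v₁`, `v₂` and by
the lines through `p₁, p₂` and through `q₁, q₂`; the factor `σ` determines the orientation. -/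
def quad (σ : ℝ) (p₁ q₁ v₁ p₂ q₂ v₂ : Plane) : Set Plane :=
  {z | 0 < σ * cross v₁ (z - p₁) ∧ σ * cross v₂ (z - p₂) < 0 ∧
    σ * cross (p₂ - p₁) (z - p₁) < 0 ∧ 0 < σ * cross (q₂ - q₁) (z - q₁)}

lemma continuous_cross_sub (σ : ℝ) (u p : Plane) : Continuous fun z => σ * cross u (z - p) := by
  unfold cross; fun_prop

lemma isOpen_quad (σ : ℝ) (p₁ q₁ v₁ p₂ q₂ v₂ : Plane) : IsOpen (quad σ p₁ q₁ v₁ p₂ q₂ v₂) := by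
  have h := fun u p => continuous_cross_sub σ u p
  exact (isOpen_lt continuous_const (h _ _)).inter ((isOpen_lt (h _ _) continuous_const).inter
    ((isOpen_lt (h _ _) continuous_const).inter (isOpen_lt continuous_const (h _ _))))

lemma closure_quad_subset (σ : ℝ) (p₁ q₁ v₁ p₂ q₂ v₂ : Plane) :
    closure (quad σ p₁ q₁ v₁ p₂ q₂ v₂) ⊆ {z | 0 ≤ σ * cross v₁ (z - p₁) ∧
      σ * cross v₂ (z - p₂) ≤ 0 ∧ σ * cross (p₂ - p₁) (z - p₁) ≤ 0 ∧
      0 ≤ σ * cross (q₂ - q₁) (z - q₁)} := by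
  have h := fun u p => continuous_cross_sub σ u p
  refine closure_minimal (fun z hz => ⟨hz.1.le, hz.2.1.le, hz.2.2.1.le, hz.2.2.2.le⟩) ?_
  exact (isClosed_le continuous_const (h _ _)).inter ((isClosed_le (h _ _) continuous_const).inter
    ((isClosed_le (h _ _) continuous_const).inter (isClosed_le continuous_const (h _ _))))

lemma cross_sub_comb (u p x y : Plane) (s : ℝ) :
    cross u (x + s • (y - x) - p) = (1 - s) * cross u (x - p) + s * cross u (y - p) := by
  simp [cross]; ring

/-- Made for segments whose endpoints lie on the sides: along the segment a weak inequality becomes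
strict as soon as it is strict at one endpoint. -/
lemma quad_comb {σ : ℝ} {p₁ q₁ v₁ p₂ q₂ v₂ x y : Plane} {s : ℝ} (h0 : 0 < s) (h1 : s < 1)
    (h : 0 ≤ σ * cross v₁ (x - p₁) ∧ 0 ≤ σ * cross v₁ (y - p₁) ∧
      0 < σ * cross v₁ (x - p₁) + σ * cross v₁ (y - p₁))
    (h' : σ * cross v₂ (x - p₂) ≤ 0 ∧ σ * cross v₂ (y - p₂) ≤ 0 ∧
      σ * cross v₂ (x - p₂) + σ * cross v₂ (y - p₂) < 0)
    (h'' : σ * cross (p₂ - p₁) (x - p₁) ≤ 0 ∧ σ * cross (p₂ - p₁) (y - p₁) ≤ 0 ∧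
      σ * cross (p₂ - p₁) (x - p₁) + σ * cross (p₂ - p₁) (y - p₁) < 0)
    (h''' : 0 ≤ σ * cross (q₂ - q₁) (x - q₁) ∧ 0 ≤ σ * cross (q₂ - q₁) (y - q₁) ∧
      0 < σ * cross (q₂ - q₁) (x - q₁) + σ * cross (q₂ - q₁) (y - q₁)) :
    x + s • (y - x) ∈ quad σ p₁ q₁ v₁ p₂ q₂ v₂ := by
  have key : ∀ A B : ℝ, 0 ≤ A ∧ 0 ≤ B ∧ 0 < A + B → 0 < (1 - s) * A + s * B := by
    rintro A B ⟨hA, hB, hAB⟩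
    rcases hA.eq_or_lt with rfl | hA
    · have : 0 < B := by linarith
      nlinarith [mul_pos h0 this]
    · nlinarith [mul_pos (sub_pos.2 h1) hA, mul_nonneg h0.le hB]
  simp only [quad, mem_ofPred_eq, cross_sub_comb]
  refine ⟨?_, ?_, ?_, ?_⟩
  · linarith [key _ _ h]
  · linarith [key (-(σ * cross v₂ (x - p₂))) (-(σ * cross v₂ (y - p₂)))
      ⟨by linarith [h'.1], by linarith [h'.2.1], by linarith [h'.2.2]⟩]
  · linarith [key (-(σ * cross (p₂ - p₁) (x - p₁))) (-(σ * cross (p₂ - p₁) (y - p₁)))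
      ⟨by linarith [h''.1], by linarith [h''.2.1], by linarith [h''.2.2]⟩]
  · linarith [key _ _ h''']

lemma convex_quad (σ : ℝ) (p₁ q₁ v₁ p₂ q₂ v₂ : Plane) : Convex ℝ (quad σ p₁ q₁ v₁ p₂ q₂ v₂) := by
  rw [convex_iff_openSegment_subset]
  intro x hx y hy z hz
  rw [openSegment_eq_image'] at hz
  obtain ⟨s, ⟨h0, h1⟩, rfl⟩ := hz
  obtain ⟨a, b, c, d⟩ := hx
  obtain ⟨a', b', c', d'⟩ := hy
  exact quad_comb h0 h1 ⟨a.le, a'.le, by linarith⟩ ⟨b.le, b'.le, by linarith⟩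
    ⟨c.le, c'.le, by linarith⟩ ⟨d.le, d'.le, by linarith⟩

/-- Two visible segments between the same edges bounding a convex quadrilateral. -/
structure QuadData (P : Polygon Plane n) (σ : ℝ) (a b : Fin n) (p₁ q₁ v₁ p₂ q₂ v₂ : Plane)
    (t₁ t₂ : ℝ) : Prop where
  vis₁ : Vis P a b p₁ q₁
  vis₂ : Vis P a b p₂ q₂
  pos₁ : 0 < t₁
  pos₂ : 0 < t₂
  eq₁ : q₁ = p₁ + t₁ • v₁
  eq₂ : q₂ = p₂ + t₂ • v₂
  conv₁ : 0 < σ * cross v₁ (p₂ - p₁)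
  conv₂ : 0 < σ * cross v₁ (q₂ - q₁)
  conv₃ : 0 < σ * cross v₂ (p₂ - p₁)
  conv₄ : 0 < σ * cross v₂ (q₂ - q₁)

section
variable {σ : ℝ} {a b : Fin n} {p₁ q₁ v₁ p₂ q₂ v₂ : Plane} {t₁ t₂ : ℝ}

lemma ne_zero_of_mul_pos {σ c : ℝ} (h : 0 < σ * c) : c ≠ 0 := by
  rintro rfl; simp at h

lemma div_nonneg_of_mul {σ A B : ℝ} (hA : 0 ≤ σ * A) (hB : 0 < σ * B) : 0 ≤ A / B := by
  have hσ : σ ≠ 0 := by rintro rfl; simp at hB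
  rw [← mul_div_mul_left A B hσ]; positivity

lemma div_pos_of_mul {σ A B : ℝ} (hA : 0 < σ * A) (hB : 0 < σ * B) : 0 < A / B := by
  have hσ : σ ≠ 0 := by rintro rfl; simp at hB
  rw [← mul_div_mul_left A B hσ]; positivity

/-- A frontier point satisfies the four weak inequalities, one of them with equality. The equality
puts it on the line of a side, and the inequalities of the two adjacent sides confine it to the side
itself. -/
lemma QuadData.frontier_subset (h : QuadData P σ a b p₁ q₁ v₁ p₂ q₂ v₂ t₁ t₂) :
    closure (quad σ p₁ q₁ v₁ p₂ q₂ v₂) \ quad σ p₁ q₁ v₁ p₂ q₂ v₂ ⊆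
      segment ℝ p₁ q₁ ∪ segment ℝ p₂ q₂ ∪ segment ℝ p₁ p₂ ∪ segment ℝ q₁ q₂ := by
  obtain ⟨-, -, ht₁, ht₂, e₁, e₂, c₁, c₂, c₃, c₄⟩ := h
  rintro z ⟨hz, hzU⟩
  obtain ⟨h1, h2, h3, h4⟩ := closure_quad_subset _ _ _ _ _ _ _ hz
  have hσ : σ ≠ 0 := by rintro rfl; simp at c₁
  have n₁ := ne_zero_of_mul_pos c₁
  have n₂ := ne_zero_of_mul_pos c₂
  have n₃ := ne_zero_of_mul_pos c₃
  have n₄ := ne_zero_of_mul_pos c₄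
  by_cases e1 : σ * cross v₁ (z - p₁) = 0
  · have e1 : cross v₁ (z - p₁) = 0 := by simpa [hσ] using e1
    have hz' := eq_smul_of_cross_eq_zero' e1 n₁
    set l := cross (z - p₁) (p₂ - p₁) / cross v₁ (p₂ - p₁) with hl
    have l0 : 0 ≤ l := div_nonneg_of_mul (by rw [cross_comm]; linarith) c₁
    have l1 : l ≤ t₁ := by
      have : z - q₁ = (l - t₁) • v₁ := by
        rw [sub_smul, ← hz', e₁]; abel
      rw [this, cross_smul_right, cross_comm] at h4
      by_contra! hlt
      nlinarith
    left; left; left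
    have : z = p₁ + (l / t₁) • (q₁ - p₁) := by
      rw [e₁, add_sub_cancel_left, smul_smul, div_mul_cancel₀ _ ht₁.ne', ← hz']; abel
    rw [this]
    exact add_smul_sub_mem_segment (by positivity) ((div_le_one ht₁).2 l1)
  by_cases e2 : σ * cross v₂ (z - p₂) = 0
  · have e2 : cross v₂ (z - p₂) = 0 := by simpa [hσ] using e2
    have hz' := eq_smul_of_cross_eq_zero' e2 n₃
    set l := cross (z - p₂) (p₂ - p₁) / cross v₂ (p₂ - p₁) with hl
    have l0 : 0 ≤ l := by
      refine div_nonneg_of_mul ?_ c₃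
      have : cross (p₂ - p₁) (z - p₁) = - cross (z - p₂) (p₂ - p₁) := by simp [cross]; ring
      rw [this] at h3; linarith
    have l1 : l ≤ t₂ := by
      have : cross (q₂ - q₁) (z - q₁) = - (cross (z - q₂) (q₂ - q₁)) := by simp [cross]; ring
      have h5 : z - q₂ = (l - t₂) • v₂ := by
        rw [sub_smul, ← hz', e₂]; abel
      rw [this, h5, cross_smul_left] at h4
      by_contra! hlt
      nlinarith
    left; left; right
    have : z = p₂ + (l / t₂) • (q₂ - p₂) := by
      rw [e₂, add_sub_cancel_left, smul_smul, div_mul_cancel₀ _ ht₂.ne', ← hz']; abel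
    rw [this]
    exact add_smul_sub_mem_segment (by positivity) ((div_le_one ht₂).2 l1)
  by_cases e3 : σ * cross (p₂ - p₁) (z - p₁) = 0
  · have e3 : cross (p₂ - p₁) (z - p₁) = 0 := by simpa [hσ] using e3
    have hz' := eq_smul_of_cross_eq_zero' (b := v₁) e3 (by rw [cross_comm]; simpa using n₁)
    set l := cross (z - p₁) v₁ / cross (p₂ - p₁) v₁ with hl
    have l0 : 0 ≤ l := by
      rw [hl, cross_comm, cross_comm (p₂ - p₁), neg_div_neg_eq]
      exact div_nonneg_of_mul h1 c₁
    have l1 : l ≤ 1 := by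
      have : z - p₂ = (l - 1) • (p₂ - p₁) := by
        rw [sub_smul, ← hz', one_smul]; abel
      rw [this, cross_smul_right] at h2
      by_contra! hlt
      nlinarith
    left; right
    have : z = p₁ + l • (p₂ - p₁) := by rw [← hz']; abel
    rw [this]
    exact add_smul_sub_mem_segment l0 l1
  by_cases e4 : σ * cross (q₂ - q₁) (z - q₁) = 0
  · have e4 : cross (q₂ - q₁) (z - q₁) = 0 := by simpa [hσ] using e4
    have hz' := eq_smul_of_cross_eq_zero' (b := v₁) e4 (by rw [cross_comm]; simpa using n₂)
    set l := cross (z - q₁) v₁ / cross (q₂ - q₁) v₁ with hl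
    have l0 : 0 ≤ l := by
      rw [hl, cross_comm, cross_comm (q₂ - q₁), neg_div_neg_eq]
      refine div_nonneg_of_mul ?_ c₂
      have : cross v₁ (z - q₁) = cross v₁ (z - p₁) := by
        rw [e₁]; simp [cross]; ring
      rw [this]; exact h1
    have l1 : l ≤ 1 := by
      have : cross v₂ (z - p₂) = cross v₂ (z - q₂) := by
        rw [e₂]; simp [cross]; ring
      have h5 : z - q₂ = (l - 1) • (q₂ - q₁) := by
        rw [sub_smul, ← hz', one_smul]; abel
      rw [this, h5, cross_smul_right] at h2
      by_contra! hlt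
      nlinarith
    right
    have : z = q₁ + l • (q₂ - q₁) := by rw [← hz']; abel
    rw [this]
    exact add_smul_sub_mem_segment l0 l1
  exact absurd ⟨lt_of_le_of_ne h1 (Ne.symm e1), lt_of_le_of_ne h2 e2, lt_of_le_of_ne h3 e3,
    lt_of_le_of_ne h4 (Ne.symm e4)⟩ hzU

lemma Vis.segment_notMem (hP : IsSimple P) {a b j : Fin n} {p q z : Plane} (h : Vis P a b p q)
    (ha : a ≠ j) (hb : b ≠ j) (hz : z ∈ segment ℝ p q) : z ∉ P.edgeSet ℝ j := by
  rw [← insert_endpoints_openSegment] at hz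
  rcases hz with rfl | rfl | hz
  · exact hP.notMem_edgeSet ha h.left
  · exact hP.notMem_edgeSet hb h.right
  · exact fun hj => notMem_inside_of_mem_edgeSet hj (h.sub hz)

/-- The quadrilateral spanned by two visible segments lies inside the table. -/
lemma QuadData.subset_inside (hP : IsSimple P)
    (h : QuadData P σ a b p₁ q₁ v₁ p₂ q₂ v₂ t₁ t₂) :
    quad σ p₁ q₁ v₁ p₂ q₂ v₂ ⊆ inside P := by
  have hfr := h.frontier_subset
  obtain ⟨w₁, w₂, ht₁, ht₂, e₁, e₂, c₁, c₂, c₃, c₄⟩ := h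
  have ha : Disjoint (P.edgeSet ℝ a) (quad σ p₁ q₁ v₁ p₂ q₂ v₂) := by
    rw [disjoint_left]
    rintro x hx ⟨-, -, h3, -⟩
    rw [cross_edge (openEdge_subset P a w₁.left) (openEdge_subset P a w₂.left) hx] at h3
    simp at h3
  have hb : Disjoint (P.edgeSet ℝ b) (quad σ p₁ q₁ v₁ p₂ q₂ v₂) := by
    rw [disjoint_left]
    rintro x hx ⟨-, -, -, h3⟩
    rw [cross_edge (openEdge_subset P b w₁.right) (openEdge_subset P b w₂.right) hx] at h3
    simp at h3
  -- The edges `a` and `b` lie on lines of sides, hence off the open quadrilateral. Any other edge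
  -- misses all four sides: two are visible segments and two lie in the open edges `a` and `b`.
  refine Billiard.subset_inside (convex_quad _ _ _ _ _ _ _).isPreconnected
    (disjoint_boundary_of_frontier (isOpen_quad _ _ _ _ _ _ _) (fun j => ?_) ⟨a, ha⟩) ?_
  · by_cases hja : a = j
    · left; rw [← hja]; exact ha
    by_cases hjb : b = j
    · left; rw [← hjb]; exact hb
    right
    rw [disjoint_left]
    intro z hz hzU
    rcases hfr hzU with ((hz' | hz') | hz') | hz'
    · exact w₁.segment_notMem hP hja hjb hz' hz
    · exact w₂.segment_notMem hP hja hjb hz' hz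
    · exact hP.notMem_edgeSet hja ((convex_openEdge P a).segment_subset w₁.left w₂.left hz') hz
    · exact hP.notMem_edgeSet hjb ((convex_openEdge P b).segment_subset w₁.right w₂.right hz') hz
  -- The midpoint of the first visible segment is inside; moved slightly towards the midpoint of the
  -- second, it is also in the quadrilateral.
  · set m₁ := p₁ + (1/2 : ℝ) • (q₁ - p₁) with hm₁
    set m₂ := p₂ + (1/2 : ℝ) • (q₂ - p₂) with hm₂
    have hin : m₁ ∈ inside P := w₁.sub (add_smul_sub_mem_openSegment (by norm_num) (by norm_num))
    have hc : Tendsto (fun s : ℝ => m₁ + s • (m₂ - m₁)) (𝓝[>] 0) (𝓝 m₁) := by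
      have : Continuous fun s : ℝ => m₁ + s • (m₂ - m₁) := by fun_prop
      simpa using (this.tendsto 0).mono_left nhdsWithin_le_nhds
    have h1 := hc.eventually ((isOpen_inside P).mem_nhds hin)
    have h2 : ∀ᶠ s : ℝ in 𝓝[>] 0, s ∈ Ioo (0:ℝ) 1 := Ioo_mem_nhdsGT one_pos
    obtain ⟨s, h1, h2⟩ := (h1.and h2).exists
    refine ⟨_, ?_, h1⟩
    have E1 : cross v₁ (m₁ - p₁) = 0 := by rw [hm₁, e₁]; simp [cross]; ring
    have E2 : cross v₁ (m₂ - p₁) = (1/2) * (cross v₁ (p₂ - p₁) + cross v₁ (q₂ - q₁)) := by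
      rw [hm₂, e₁]; simp [cross]; ring
    have E3 : cross v₂ (m₂ - p₂) = 0 := by rw [hm₂, e₂]; simp [cross]; ring
    have E4 : cross v₂ (m₁ - p₂) = -(1/2) * (cross v₂ (p₂ - p₁) + cross v₂ (q₂ - q₁)) := by
      rw [hm₁, e₂]; simp [cross]; ring
    have E5 : cross (p₂ - p₁) (m₁ - p₁) = - (t₁ / 2) * cross v₁ (p₂ - p₁) := by
      rw [hm₁, e₁]; simp [cross]; ring
    have E6 : cross (p₂ - p₁) (m₂ - p₁) = - (t₂ / 2) * cross v₂ (p₂ - p₁) := by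
      rw [hm₂, e₂]; simp [cross]; ring
    have E7 : cross (q₂ - q₁) (m₁ - q₁) = (t₁ / 2) * cross v₁ (q₂ - q₁) := by
      rw [hm₁, e₁]; simp [cross]; ring
    have E8 : cross (q₂ - q₁) (m₂ - q₁) = (t₂ / 2) * cross v₂ (q₂ - q₁) := by
      rw [hm₂, e₂, e₁]; simp [cross]; ring
    have k₁ := mul_pos ht₁ c₁
    have k₂ := mul_pos ht₁ c₂
    have k₃ := mul_pos ht₂ c₃
    have k₄ := mul_pos ht₂ c₄
    refine quad_comb h2.1 h2.2 ?_ ?_ ?_ ?_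
    · rw [E1, E2]; refine ⟨?_, ?_, ?_⟩ <;> linarith
    · rw [E3, E4]; refine ⟨?_, ?_, ?_⟩ <;> linarith
    · rw [E5, E6]; refine ⟨?_, ?_, ?_⟩ <;> linarith
    · rw [E7, E8]; refine ⟨?_, ?_, ?_⟩ <;> linarith

/-- A line that separates the two sides of a quadrilateral runs inside the table from edge
to edge. -/
lemma QuadData.between (hP : IsSimple P) (h : QuadData P σ a b p₁ q₁ v₁ p₂ q₂ v₂ t₁ t₂)
    {v : Plane} {τ : ℝ} (hp₁ : σ * cross v p₁ < τ) (hq₁ : σ * cross v q₁ < τ)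
    (hp₂ : τ < σ * cross v p₂) (hq₂ : τ < σ * cross v q₂) :
    ∃ (p q : Plane) (t : ℝ), 0 < t ∧ q = p + t • v ∧ Vis P a b p q ∧ σ * cross v p = τ := by
  have hU := h.subset_inside hP
  obtain ⟨w₁, w₂, ht₁, ht₂, e₁, e₂, c₁, c₂, c₃, c₄⟩ := h
  -- The linear function `σ * cross v ·` takes the value `τ` between `p₁` and `p₂`, and again
  -- between `q₁` and `q₂`; these two points span the required segment.
  obtain ⟨μ, hμ0, hμ1, hμ⟩ := exists_convex_comb hp₁ hp₂
  obtain ⟨ν, hν0, hν1, hν⟩ := exists_convex_comb hq₁ hq₂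
  set p := p₁ + μ • (p₂ - p₁) with hp
  set q := q₁ + ν • (q₂ - q₁) with hq
  have hpτ : σ * cross v p = τ := by
    rw [← hμ, hp]; simp [cross]; ring
  have hqτ : σ * cross v q = τ := by
    rw [← hν, hq]; simp [cross]; ring
  have hσ : σ ≠ 0 := by rintro rfl; simp at c₁
  have hpa : p ∈ openEdge P a := (convex_openEdge P a).openSegment_subset w₁.left w₂.left
    (add_smul_sub_mem_openSegment hμ0 hμ1)
  have hqb : q ∈ openEdge P b := (convex_openEdge P b).openSegment_subset w₁.right w₂.right
    (add_smul_sub_mem_openSegment hν0 hν1)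
  have h0 : cross v (q - p) = 0 := by
    rw [cross_sub_right]
    have : σ * (cross v q - cross v p) = 0 := by linarith
    simpa [hσ] using this
  have hd : 0 < σ * cross v (p₂ - p₁) := by rw [cross_sub_right]; linarith
  have hqp := eq_smul_of_cross_eq_zero' h0 (ne_zero_of_mul_pos hd)
  have hmul := mul_pos ht₁ c₁
  have hmul2 := mul_pos ht₁ c₂
  have hmul3 := mul_pos ht₂ c₃
  have hmul4 := mul_pos ht₂ c₄
  refine ⟨p, q, cross (q - p) (p₂ - p₁) / cross v (p₂ - p₁), ?_, ?_, ⟨hpa, hqb, ?_⟩, hpτ⟩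
  · refine div_pos_of_mul ?_ hd
    have : cross (q - p) (p₂ - p₁) =
        (1 - ν) * (t₁ * cross v₁ (p₂ - p₁)) + ν * (t₂ * cross v₂ (p₂ - p₁)) := by
      rw [hq, hp, e₁, e₂]; simp [cross]; ring
    rw [this]
    nlinarith [mul_pos (sub_pos.2 hν1) hmul, mul_pos hν0 hmul3]
  · rw [← hqp]; abel
  · intro z hz
    rw [openSegment_eq_image'] at hz
    obtain ⟨s, ⟨h0, h1⟩, rfl⟩ := hz
    apply hU
    have E1 : cross v₁ (p - p₁) = μ * cross v₁ (p₂ - p₁) := by rw [hp]; simp [cross]; ring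
    have E2 : cross v₁ (q - p₁) = ν * cross v₁ (q₂ - q₁) := by rw [hq, e₁]; simp [cross]; ring
    have E3 : cross v₂ (p - p₂) = -(1 - μ) * cross v₂ (p₂ - p₁) := by
      rw [hp]; simp [cross]; ring
    have E4 : cross v₂ (q - p₂) = -(1 - ν) * cross v₂ (q₂ - q₁) := by
      rw [hq, e₂]; simp [cross]; ring
    have E5 : cross (p₂ - p₁) (p - p₁) = 0 := by rw [hp]; simp [cross]; ring
    have E6 : cross (p₂ - p₁) (q - p₁) =
        -((1 - ν) * (t₁ * cross v₁ (p₂ - p₁)) + ν * (t₂ * cross v₂ (p₂ - p₁))) := by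
      rw [hq, e₁, e₂]; simp [cross]; ring
    have E7 : cross (q₂ - q₁) (p - q₁) =
        (1 - μ) * (t₁ * cross v₁ (q₂ - q₁)) + μ * (t₂ * cross v₂ (q₂ - q₁)) := by
      rw [hp, e₂, e₁]; simp [cross]; ring
    have E8 : cross (q₂ - q₁) (q - q₁) = 0 := by rw [hq]; simp [cross]; ring
    have a1 := mul_pos hμ0 c₁
    have a2 := mul_pos hν0 c₂
    have a3 := mul_pos (sub_pos.2 hμ1) c₃
    have a4 := mul_pos (sub_pos.2 hν1) c₄
    have a5 := mul_pos (sub_pos.2 hν1) hmul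
    have a6 := mul_pos hν0 hmul3
    have a7 := mul_pos (sub_pos.2 hμ1) hmul2
    have a8 := mul_pos hμ0 hmul4
    refine quad_comb h0 h1 ?_ ?_ ?_ ?_
    · rw [E1, E2]; refine ⟨?_, ?_, ?_⟩ <;> linarith
    · rw [E3, E4]; refine ⟨?_, ?_, ?_⟩ <;> linarith
    · rw [E5, E6]; refine ⟨?_, ?_, ?_⟩ <;> linarith
    · rw [E7, E8]; refine ⟨?_, ?_, ?_⟩ <;> linarith

/-- A segment that starts between two parallel visible segments and ends between their lines,
ends on the same edge. -/
lemma QuadData.edge_eq (hP : IsSimple P) {v : Plane}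
    (h : QuadData P σ a b p₁ q₁ v p₂ q₂ v t₁ t₂) {b' : Fin n} {p q v' : Plane} {t : ℝ}
    (hv : Vis P a b' p q) (ht : 0 < t) (hq : q = p + t • v')
    (hp₁ : σ * cross v p₁ < σ * cross v p) (hp₂ : σ * cross v p < σ * cross v p₂)
    (hq₁ : σ * cross v p₁ < σ * cross v q) (hq₂ : σ * cross v q < σ * cross v p₂)
    (hv' : 0 < σ * cross v' (p₂ - p₁)) : b' = b := by
  have hU := h.subset_inside hP
  obtain ⟨w₁, w₂, ht₁, ht₂, e₁, e₂, c₁, c₂, -, -⟩ := h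
  have hpa : cross (p₂ - p₁) (p - p₁) = 0 := cross_edge (openEdge_subset P a w₁.left)
    (openEdge_subset P a w₂.left) (openEdge_subset P a hv.left)
  -- If `q` were still on the near side of the line through `q₁` and `q₂`, it would be in the
  -- quadrilateral, hence inside, although it lies on an edge.
  have hqU : ¬ 0 < σ * cross (q₂ - q₁) (q - q₁) := by
    intro h4
    refine notMem_inside_of_mem_openEdge hv.right (hU ⟨?_, ?_, ?_, h4⟩)
    · rw [cross_sub_right]; linarith
    · rw [cross_sub_right]; linarith
    · have : cross (p₂ - p₁) (q - p₁) = cross (p₂ - p₁) (p - p₁) - t * cross v' (p₂ - p₁) := by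
        rw [hq]; simp [cross]; ring
      rw [this, hpa]
      linarith [mul_pos ht hv']
  have e2 : σ * cross v q₂ = σ * cross v p₂ := by rw [e₂, cross_add_smul_self]
  have e1 : σ * cross v q₁ = σ * cross v p₁ := by rw [e₁, cross_add_smul_self]
  have hpp := eq_smul_of_cross_eq_zero' (b := v) hpa (by
    rw [cross_comm]; simpa using ne_zero_of_mul_pos c₁)
  set μ := cross (p - p₁) v / cross (p₂ - p₁) v with hμ
  have hp : p = p₁ + μ • (p₂ - p₁) := by rw [← hpp]; abel
  have hcp : σ * cross v p = σ * cross v p₁ + μ * (σ * cross v (p₂ - p₁)) := by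
    rw [hp]; simp [cross]; ring
  have hμ0 : 0 < μ := by
    by_contra! hle
    nlinarith
  have hμ1 : μ < 1 := by
    by_contra! hle
    rw [cross_sub_right] at c₁ hcp
    nlinarith
  have hp4 : 0 < σ * cross (q₂ - q₁) (p - q₁) := by
    have : σ * cross (q₂ - q₁) (p - q₁) = (1 - μ) * (t₁ * (σ * cross v (q₂ - q₁))) +
        μ * (t₂ * (σ * cross v (q₂ - q₁))) := by
      rw [hp, e₁, e₂]; simp [cross]; ring
    rw [this]
    have := mul_pos (sub_pos.2 hμ1) (mul_pos ht₁ c₂)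
    have := mul_pos hμ0 (mul_pos ht₂ c₂)
    linarith
  set A := σ * cross (q₂ - q₁) (p - q₁)
  set B := σ * cross (q₂ - q₁) (q - q₁) with hB
  push Not at hqU
  -- The parameter at which the segment from `p` to `q` meets the line through `q₁` and `q₂`. The
  -- meeting point is on the open edge `b`, so it must be the endpoint `q`: interior points of the
  -- segment are inside the table.
  set s := A / (A - B) with hs
  have hs0 : 0 < s := div_pos hp4 (by linarith)
  have hs1 : s ≤ 1 := (div_le_one (by linarith)).2 (by linarith)
  have hσ : σ ≠ 0 := by rintro rfl; simp at c₁
  set z := p + s • (q - p) with hz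
  have hz0 : cross (q₂ - q₁) (z - q₁) = 0 := by
    have : σ * cross (q₂ - q₁) (z - q₁) = (1 - s) * A + s * B := by
      rw [hz, cross_sub_comb]; ring
    have h2 : (1 - s) * A + s * B = 0 := by
      have : A - B ≠ 0 := by linarith
      rw [hs]; field_simp; ring
    rw [h2] at this
    simpa [hσ] using this
  have hzz := eq_smul_of_cross_eq_zero' (b := v) hz0 (by
    rw [cross_comm]; simpa using ne_zero_of_mul_pos c₂)
  set l := cross (z - q₁) v / cross (q₂ - q₁) v with hl
  have hz' : z = q₁ + l • (q₂ - q₁) := by rw [← hzz]; abel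
  have hcz : σ * cross v z = σ * cross v q₁ + l * (σ * cross v q₂ - σ * cross v q₁) := by
    rw [hz']; simp [cross]; ring
  have hcz' : σ * cross v z = (1 - s) * (σ * cross v p) + s * (σ * cross v q) := by
    rw [hz]; simp [cross]; ring
  have hl0 : 0 < l := by
    by_contra! hle
    nlinarith
  have hl1 : l < 1 := by
    by_contra! hle
    nlinarith
  have hzb : z ∈ openEdge P b := (convex_openEdge P b).openSegment_subset w₁.right w₂.right
    (hz' ▸ add_smul_sub_mem_openSegment hl0 hl1)
  rcases hs1.eq_or_lt with h1 | h1
  · have : z = q := by rw [hz, h1, one_smul]; abel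
    exact hP.eq_of_mem (this ▸ hv.right) (openEdge_subset P b hzb)
  · exact absurd (hv.sub (add_smul_sub_mem_openSegment hs0 h1))
      (notMem_inside_of_mem_openEdge hzb)

end

/-! ### Stability of visible segments -/

/-- Edges through neither endpoint of the limit segment have positive distance from it by
compactness, so only the edges through an endpoint need the hypothesis `h`. The midpoint then
provides an inside point. -/
lemma eventually_openSegment_subset_inside {ι : Type*} {l : Filter ι} {f g : ι → Plane}
    {p q : Plane} (hf : Tendsto f l (𝓝 p)) (hg : Tendsto g l (𝓝 q))
    (hpq : openSegment ℝ p q ⊆ inside P)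
    (h : ∀ j, (p ∈ P.edgeSet ℝ j ∨ q ∈ P.edgeSet ℝ j) →
      ∀ᶠ i in l, Disjoint (openSegment ℝ (f i) (g i)) (P.edgeSet ℝ j)) :
    ∀ᶠ i in l, openSegment ℝ (f i) (g i) ⊆ inside P := by
  have key : ∀ j, ∀ᶠ i in l, Disjoint (openSegment ℝ (f i) (g i)) (P.edgeSet ℝ j) := by
    intro j
    by_cases hj : p ∈ P.edgeSet ℝ j ∨ q ∈ P.edgeSet ℝ j
    · exact h j hj
    push Not at hj
    have hcont : Continuous fun z : (Plane × Plane) × ℝ => z.1.1 + z.2 • (z.1.2 - z.1.1) := by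
      fun_prop
    have h1 : ∀ᶠ x : Plane × Plane in 𝓝 (p, q), ∀ s ∈ Icc (0:ℝ) 1,
        x.1 + s • (x.2 - x.1) ∉ P.edgeSet ℝ j := by
      apply isCompact_Icc.eventually_forall_of_forall_eventually
      intro s hs
      have hmem : p + s • (q - p) ∈ (P.edgeSet ℝ j)ᶜ := by
        intro hc
        have hsg : p + s • (q - p) ∈ segment ℝ p q := add_smul_sub_mem_segment hs.1 hs.2
        rw [← insert_endpoints_openSegment] at hsg
        rcases hsg with h' | h' | h'
        · rw [h'] at hc; exact hj.1 hc
        · rw [h'] at hc; exact hj.2 hc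
        · exact notMem_inside_of_mem_edgeSet hc (hpq h')
      exact (hcont.tendsto ((p, q), s)).eventually
        ((isCompact_edgeSet P j).isClosed.isOpen_compl.mem_nhds hmem)
    filter_upwards [(hf.prodMk_nhds hg).eventually h1] with i hi
    rw [disjoint_left]
    intro z hz
    rw [openSegment_eq_image'] at hz
    obtain ⟨s, hs, rfl⟩ := hz
    exact hi s ⟨hs.1.le, hs.2.le⟩
  have hmid : ∀ᶠ i in l, midpoint ℝ (f i) (g i) ∈ inside P := by
    have hc : Continuous fun z : Plane × Plane => midpoint ℝ z.1 z.2 := by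
      simp only [midpoint_eq_smul_add]; fun_prop
    exact ((hc.tendsto (p, q)).comp (hf.prodMk_nhds hg)).eventually
      ((isOpen_inside P).mem_nhds (hpq (midpoint_mem_openSegment p q)))
  filter_upwards [eventually_all.2 key, hmid] with i hi hm
  refine subset_inside (convex_openSegment _ _).isPreconnected ?_
    ⟨_, midpoint_mem_openSegment _ _, hm⟩
  rw [disjoint_left]
  intro z hz hzb
  obtain ⟨j, hj⟩ := mem_iUnion.1 hzb
  exact disjoint_left.1 (hi j) hz hj

/-! ### Reflections in edges -/

/-- The reflection in the direction of an edge as a linear isometry. -/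
def refl (P : Polygon Plane n) (i : Fin n) : Plane ≃ₗᵢ[ℝ] Plane :=
  (Submodule.span ℝ {P (finRotate n i) - P i}).reflection

lemma reflectIn_eq (P : Polygon Plane n) (i : Fin n) (v : Plane) :
    reflectIn P i v = refl P i v := rfl

@[simp] lemma refl_refl (i : Fin n) (v : Plane) : refl P i (refl P i v) = v :=
  Submodule.reflection_reflection _ _

lemma refl_apply (i : Fin n) (v : Plane) :
    refl P i v = (2 * (inner ℝ (P (finRotate n i) - P i) v / ‖P (finRotate n i) - P i‖ ^ 2)) •
      (P (finRotate n i) - P i) - v := by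
  rw [refl, Submodule.reflection_singleton_apply]
  simp [mul_smul, two_smul]

lemma IsSimple.edge_norm_pos (hP : IsSimple P) (i : Fin n) :
    0 < ‖P (finRotate n i) - P i‖ :=
  norm_pos_iff.2 (sub_ne_zero.2 (hP.nondegenerate i).symm)

lemma cross_refl (hP : IsSimple P) (i : Fin n) (a b : Plane) :
    cross (refl P i a) (refl P i b) = -cross a b := by
  have h := hP.edge_norm_pos i
  rw [refl_apply, refl_apply]
  set d := P (finRotate n i) - P i
  have h2 : (0:ℝ) < ‖d‖ ^ 2 := by positivity
  have hA : inner ℝ d a / ‖d‖ ^ 2 * ‖d‖ ^ 2 = inner ℝ d a := div_mul_cancel₀ _ h2.ne'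
  have hB : inner ℝ d b / ‖d‖ ^ 2 * ‖d‖ ^ 2 = inner ℝ d b := div_mul_cancel₀ _ h2.ne'
  set A := inner ℝ d a / ‖d‖ ^ 2
  set B := inner ℝ d b / ‖d‖ ^ 2
  have e : cross ((2 * A) • d - a) ((2 * B) • d - b) =
      cross a b - 2 * (A * cross d b - B * cross d a) := by
    simp [cross]; ring
  have e2 : (A * cross d b - B * cross d a) * ‖d‖ ^ 2 = cross a b * ‖d‖ ^ 2 := by
    have : (A * cross d b - B * cross d a) * ‖d‖ ^ 2 =
      inner ℝ d a * cross d b - inner ℝ d b * cross d a := by rw [← hA, ← hB]; ring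
    rw [this, norm_sq_eq, inner_eq, inner_eq, cross, cross, cross]; ring
  have e3 := mul_right_cancel₀ h2.ne' e2
  rw [e, e3]; ring

lemma refl_edge (i : Fin n) {x y : Plane} (hx : x ∈ P.edgeSet ℝ i) (hy : y ∈ P.edgeSet ℝ i) :
    refl P i (x - y) = x - y := by
  rw [edgeSet_eq, segment_eq_image'] at hx hy
  obtain ⟨r, -, rfl⟩ := hx
  obtain ⟨s, -, rfl⟩ := hy
  rw [refl, Submodule.reflection_eq_self_iff, Submodule.mem_span_singleton]
  exact ⟨r - s, by module⟩

/-- The reflection of the plane in the line spanned by an edge. -/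
def rho (P : Polygon Plane n) (i : Fin n) : Plane ≃ᵃⁱ[ℝ] Plane :=
  ((AffineIsometryEquiv.vaddConst ℝ (P i)).symm.trans (refl P i).toAffineIsometryEquiv).trans
    (AffineIsometryEquiv.vaddConst ℝ (P i))

lemma rho_apply (i : Fin n) (x : Plane) : rho P i x = refl P i (x - P i) + P i := rfl

lemma rho_edge {i : Fin n} {x : Plane} (hx : x ∈ P.edgeSet ℝ i) : rho P i x = x := by
  rw [rho_apply, refl_edge i hx (left_mem_edgeSet P i), sub_add_cancel]

/-! ### Unfolding -/

/-- The isometry that unfolds the table along the code `c` after `k` reflections. -/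
def unf (P : Polygon Plane n) (c : ℕ → Fin n) : ℕ → (Plane ≃ᵃⁱ[ℝ] Plane)
  | 0 => AffineIsometryEquiv.refl ℝ Plane
  | k + 1 => (rho P (c k)).trans (unf P c k)

/-- The linear part of the unfolding isometry. -/
def unfL (P : Polygon Plane n) (c : ℕ → Fin n) : ℕ → (Plane ≃ₗᵢ[ℝ] Plane)
  | 0 => LinearIsometryEquiv.refl ℝ Plane
  | k + 1 => (refl P (c k)).trans (unfL P c k)

@[simp] lemma unf_zero (c : ℕ → Fin n) (x : Plane) : unf P c 0 x = x := rfl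

lemma unf_succ (c : ℕ → Fin n) (k : ℕ) (x : Plane) :
    unf P c (k + 1) x = unf P c k (rho P (c k) x) := rfl

@[simp] lemma unfL_zero (c : ℕ → Fin n) (x : Plane) : unfL P c 0 x = x := rfl

lemma unfL_succ (c : ℕ → Fin n) (k : ℕ) (x : Plane) :
    unfL P c (k + 1) x = unfL P c k (refl P (c k) x) := rfl

lemma unf_sub (c : ℕ → Fin n) (k : ℕ) (x y : Plane) :
    unf P c k x - unf P c k y = unfL P c k (x - y) := by
  induction k generalizing x y with
  | zero => simp
  | succ k ih =>
    rw [unf_succ, unf_succ, ih, unfL_succ, rho_apply, rho_apply, add_sub_add_right_eq_sub,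
      ← map_sub, sub_sub_sub_cancel_right]

lemma unf_add (c : ℕ → Fin n) (k : ℕ) (x v : Plane) :
    unf P c k (x + v) = unf P c k x + unfL P c k v := by
  rw [← sub_eq_iff_eq_add', unf_sub, add_sub_cancel_left]

lemma unf_symm_sub (c : ℕ → Fin n) (k : ℕ) (x y : Plane) :
    (unf P c k).symm x - (unf P c k).symm y = (unfL P c k).symm (x - y) := by
  rw [LinearIsometryEquiv.eq_symm_apply, ← unf_sub]; simp

lemma unf_symm_add (c : ℕ → Fin n) (k : ℕ) (x v : Plane) :
    (unf P c k).symm (x + v) = (unf P c k).symm x + (unfL P c k).symm v := by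
  rw [← sub_eq_iff_eq_add', unf_symm_sub, add_sub_cancel_left]

/-- Consecutive copies of the table share a gate, so a point on gate `k` may be folded back from
copy `k` or from copy `k + 1`. -/
lemma unf_succ_edge {c : ℕ → Fin n} {k : ℕ} {x : Plane} (hx : x ∈ P.edgeSet ℝ (c k)) :
    unf P c (k + 1) x = unf P c k x := by
  rw [unf_succ, rho_edge hx]

lemma unf_congr {c c' : ℕ → Fin n} {k : ℕ} (h : ∀ i < k, c i = c' i) :
    unf P c k = unf P c' k ∧ unfL P c k = unfL P c' k := by
  induction k with
  | zero => exact ⟨rfl, rfl⟩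
  | succ k ih =>
    obtain ⟨h1, h2⟩ := ih fun i hi => h i (by omega)
    simp only [unf, unfL, h1, h2, h k (by omega)]
    exact ⟨trivial, trivial⟩

lemma cross_unfL (hP : IsSimple P) (c : ℕ → Fin n) (k : ℕ) (a b : Plane) :
    cross (unfL P c k a) (unfL P c k b) = (-1) ^ k * cross a b := by
  induction k generalizing a b with
  | zero => simp
  | succ k ih => rw [unfL_succ, unfL_succ, ih, cross_refl hP]; ring

lemma cross_unfL_symm (hP : IsSimple P) (c : ℕ → Fin n) (k : ℕ) (a b : Plane) :
    cross ((unfL P c k).symm a) ((unfL P c k).symm b) = (-1) ^ k * cross a b := by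
  have := cross_unfL hP c k ((unfL P c k).symm a) ((unfL P c k).symm b)
  simp only [LinearIsometryEquiv.apply_symm_apply] at this
  rw [this, ← mul_assoc, ← pow_add, Even.neg_one_pow ⟨k, rfl⟩, one_mul]

lemma unf_shift (c : ℕ → Fin n) (j k : ℕ) (x : Plane) :
    unf P c (j + k) x = unf P c j (unf P (fun i => c (j + i)) k x) := by
  induction k generalizing x with
  | zero => rfl
  | succ k ih => rw [← add_assoc, unf_succ, ih, unf_succ]

lemma unfL_shift (c : ℕ → Fin n) (j k : ℕ) (x : Plane) :
    unfL P c (j + k) x = unfL P c j (unfL P (fun i => c (j + i)) k x) := by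
  induction k generalizing x with
  | zero => rfl
  | succ k ih => rw [← add_assoc, unfL_succ, ih, unfL_succ]

lemma unf_shift_symm (c : ℕ → Fin n) (j k : ℕ) (x : Plane) :
    (unf P c (j + k)).symm x =
      (unf P (fun i => c (j + i)) k).symm ((unf P c j).symm x) := by
  rw [AffineIsometryEquiv.symm_apply_eq, unf_shift]; simp

lemma unfL_shift_symm (c : ℕ → Fin n) (j k : ℕ) (x : Plane) :
    (unfL P c (j + k)).symm x =
      (unfL P (fun i => c (j + i)) k).symm ((unfL P c j).symm x) := by
  rw [LinearIsometryEquiv.symm_apply_eq, unfL_shift]; simp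

/-! ### Unfolded trajectories -/

/-- In the unfolded plane, the segment from `p` on gate `k` to `q` on gate `k + 1` runs inside
the corresponding copy of the table. -/
def VisU (P : Polygon Plane n) (c : ℕ → Fin n) (k : ℕ) (p q : Plane) : Prop :=
  Vis P (c k) (c (k + 1)) ((unf P c (k + 1)).symm p) ((unf P c (k + 1)).symm q)

/-- The points `q 0, …, q m` of a line of direction `v` are the successive crossings of the gates
of the unfolded code `c`. -/
def Pass (P : Polygon Plane n) (c : ℕ → Fin n) (m : ℕ) (v : Plane) (q : ℕ → Plane) : Prop :=
  ∀ k < m, (∃ t : ℝ, 0 < t ∧ q (k + 1) = q k + t • v) ∧ VisU P c k (q k) (q (k + 1))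

lemma Pass.mono {c : ℕ → Fin n} {m m' : ℕ} {v : Plane} {q : ℕ → Plane} (h : Pass P c m v q)
    (hm : m' ≤ m) : Pass P c m' v q := fun k hk => h k (hk.trans_le hm)

lemma VisU.congr {c c' : ℕ → Fin n} {k : ℕ} {p q : Plane} (h : VisU P c k p q)
    (hc : ∀ i ≤ k + 1, c i = c' i) : VisU P c' k p q := by
  have h1 := (unf_congr (P := P) (k := k + 1) fun i hi => hc i (by omega)).1
  rw [VisU, ← h1, ← hc k (by omega), ← hc (k + 1) le_rfl]
  exact h

section
variable {c : ℕ → Fin n} {k : ℕ} {σ : ℝ} {p₁ q₁ v₁ p₂ q₂ v₂ : Plane} {t₁ t₂ : ℝ}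

lemma neg_one_pow_mul_self (k : ℕ) : (-1 : ℝ) ^ k * (-1) ^ k = 1 := by
  rw [← pow_add, Even.neg_one_pow ⟨k, rfl⟩]

/-- A convex quadrilateral between two gates in the unfolded plane. -/
structure QuadU (P : Polygon Plane n) (σ : ℝ) (c : ℕ → Fin n) (k : ℕ)
    (p₁ q₁ v₁ p₂ q₂ v₂ : Plane) : Prop where
  vis₁ : VisU P c k p₁ q₁
  vis₂ : VisU P c k p₂ q₂
  eq₁ : ∃ t : ℝ, 0 < t ∧ q₁ = p₁ + t • v₁
  eq₂ : ∃ t : ℝ, 0 < t ∧ q₂ = p₂ + t • v₂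
  conv₁ : 0 < σ * cross v₁ (p₂ - p₁)
  conv₂ : 0 < σ * cross v₁ (q₂ - q₁)
  conv₃ : 0 < σ * cross v₂ (p₂ - p₁)
  conv₄ : 0 < σ * cross v₂ (q₂ - q₁)

/-- Folding back copy `k + 1` multiplies determinants by `(-1) ^ (k + 1)`; the orientation factor
absorbs this sign. -/
lemma QuadU.data (hP : IsSimple P) (h : QuadU P σ c k p₁ q₁ v₁ p₂ q₂ v₂) :
    ∃ t₁ t₂, QuadData P (σ * (-1) ^ (k + 1)) (c k) (c (k + 1))
      ((unf P c (k + 1)).symm p₁) ((unf P c (k + 1)).symm q₁) ((unfL P c (k + 1)).symm v₁)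
      ((unf P c (k + 1)).symm p₂) ((unf P c (k + 1)).symm q₂) ((unfL P c (k + 1)).symm v₂)
      t₁ t₂ := by
  obtain ⟨w₁, w₂, ⟨t₁, ht₁, e₁⟩, ⟨t₂, ht₂, e₂⟩, c₁, c₂, c₃, c₄⟩ := h
  have key : ∀ v x y : Plane, 0 < σ * cross v (x - y) →
      0 < σ * (-1) ^ (k + 1) * cross ((unfL P c (k + 1)).symm v)
        ((unf P c (k + 1)).symm x - (unf P c (k + 1)).symm y) := by
    intro v x y h
    rw [unf_symm_sub, cross_unfL_symm hP, mul_assoc, ← mul_assoc ((-1) ^ (k + 1)),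
      neg_one_pow_mul_self, one_mul]
    exact h
  refine ⟨t₁, t₂, w₁, w₂, ht₁, ht₂, ?_, ?_, key _ _ _ c₁, key _ _ _ c₂, key _ _ _ c₃,
    key _ _ _ c₄⟩
  · rw [e₁, unf_symm_add, map_smul]
  · rw [e₂, unf_symm_add, map_smul]

/-- Up to the sign, folding changes the transverse coordinate only by a constant, so comparisons of
positions carry over between the table and the unfolded plane. -/
lemma cross_unf_symm (hP : IsSimple P) (c : ℕ → Fin n) (k : ℕ) (σ : ℝ) (v x : Plane) :
    σ * (-1) ^ k * cross ((unfL P c k).symm v) ((unf P c k).symm x) =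
      σ * cross v x - σ * cross v (unf P c k 0) := by
  have : (unf P c k).symm x = (unfL P c k).symm (x - unf P c k 0) := by
    rw [← unf_symm_sub]; simp
  rw [this, cross_unfL_symm hP, mul_assoc, ← mul_assoc ((-1) ^ k), neg_one_pow_mul_self, one_mul,
    cross_sub_right, mul_sub]

lemma QuadU.between (hP : IsSimple P) (h : QuadU P σ c k p₁ q₁ v₁ p₂ q₂ v₂)
    {v : Plane} {τ : ℝ} (hp₁ : σ * cross v p₁ < τ) (hq₁ : σ * cross v q₁ < τ)
    (hp₂ : τ < σ * cross v p₂) (hq₂ : τ < σ * cross v q₂) :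
    ∃ p q : Plane, (∃ t : ℝ, 0 < t ∧ q = p + t • v) ∧ VisU P c k p q ∧ σ * cross v p = τ := by
  obtain ⟨t₁, t₂, hd⟩ := h.data hP
  have e := cross_unf_symm hP c (k + 1) σ v
  obtain ⟨p, q, t, ht, hq, hvis, hτ⟩ := hd.between hP
    (v := (unfL P c (k + 1)).symm v) (τ := τ - σ * cross v (unf P c (k + 1) 0))
    (by rw [e]; linarith) (by rw [e]; linarith) (by rw [e]; linarith) (by rw [e]; linarith)
  refine ⟨unf P c (k + 1) p, unf P c (k + 1) q, ⟨t, ht, ?_⟩, ?_, ?_⟩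
  · rw [hq, unf_add, map_smul, LinearIsometryEquiv.apply_symm_apply]
  · simpa [VisU] using hvis
  · have := e (unf P c (k + 1) p)
    rw [AffineIsometryEquiv.symm_apply_apply, hτ] at this
    linarith

lemma QuadU.edge_eq (hP : IsSimple P) {v : Plane} (h : QuadU P σ c k p₁ q₁ v p₂ q₂ v)
    {c' : ℕ → Fin n} (hc : ∀ i ≤ k, c i = c' i) {p q v' : Plane} (hv : VisU P c' k p q)
    (hq : ∃ t : ℝ, 0 < t ∧ q = p + t • v')
    (hp₁ : σ * cross v p₁ < σ * cross v p) (hp₂ : σ * cross v p < σ * cross v p₂)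
    (hq₁ : σ * cross v p₁ < σ * cross v q) (hq₂ : σ * cross v q < σ * cross v p₂)
    (hv' : 0 < σ * cross v' (p₂ - p₁)) : c' (k + 1) = c (k + 1) := by
  obtain ⟨t₁, t₂, hd⟩ := h.data hP
  have e := cross_unf_symm hP c (k + 1) σ v
  obtain ⟨t, ht, rfl⟩ := hq
  have hu := (unf_congr (P := P) (k := k + 1) fun i hi => hc i (by omega)).1
  rw [VisU, ← hu, ← hc k le_rfl] at hv
  refine hd.edge_eq hP (v' := (unfL P c (k + 1)).symm v') hv ht
    (by rw [unf_symm_add, map_smul]) ?_ ?_ ?_ ?_ ?_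
  · rw [e, e]; linarith
  · rw [e, e]; linarith
  · rw [e, e]; linarith
  · rw [e, e]; linarith
  · rw [unf_symm_sub, cross_unfL_symm hP, mul_assoc, ← mul_assoc ((-1) ^ (k + 1)),
      neg_one_pow_mul_self, one_mul]
    exact hv'

end

/-! ### Chains of bounces -/

/-- The states `s 0, …, s m` follow each other by bounces at the edges `c 1, …, c m`. -/
def IsChain (P : Polygon Plane n) (c : ℕ → Fin n) (m : ℕ) (s : ℕ → Plane × Plane) : Prop :=
  ∀ k < m, Bounce P (c (k + 1)) (s k) (s (k + 1))

/-- Frame `0` is the table before the bounce at `c 0`. The common direction of the unfolded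
trajectory is therefore the velocity with which the particle arrives at `c 0`. -/
lemma IsChain.unfL_eq {c : ℕ → Fin n} {m : ℕ} {s : ℕ → Plane × Plane} (h : IsChain P c m s)
    {k : ℕ} (hk : k ≤ m) : unfL P c (k + 1) (s k).2 = refl P (c 0) (s 0).2 := by
  induction k with
  | zero => rfl
  | succ k ih =>
    obtain ⟨-, -, -, h4⟩ := h k (by omega)
    rw [h4, reflectIn_eq, unfL_succ, refl_refl, ih (by omega)]

lemma IsChain.norm_eq {c : ℕ → Fin n} {m : ℕ} {s : ℕ → Plane × Plane} (h : IsChain P c m s)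
    {k : ℕ} (hk : k ≤ m) : ‖(s k).2‖ = ‖(s 0).2‖ := by
  have := congrArg norm (h.unfL_eq hk)
  simpa only [LinearIsometryEquiv.norm_map] using this

lemma IsChain.mem_openEdge {c : ℕ → Fin n} {m : ℕ} {s : ℕ → Plane × Plane} (h : IsChain P c m s)
    (h0 : (s 0).1 ∈ openEdge P (c 0)) {k : ℕ} (hk : k ≤ m) : (s k).1 ∈ openEdge P (c k) := by
  rcases k with _ | k
  · exact h0
  · exact (h k (by omega)).2.2.1

lemma IsChain.pass {c : ℕ → Fin n} {m : ℕ} {s : ℕ → Plane × Plane} (h : IsChain P c m s)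
    (h0 : (s 0).1 ∈ openEdge P (c 0)) :
    Pass P c m (refl P (c 0) (s 0).2) fun k => unf P c (k + 1) (s k).1 := by
  intro k hk
  obtain ⟨⟨t, ht, h1⟩, h2, h3, -⟩ := h k hk
  have e : unf P c (k + 1 + 1) (s (k + 1)).1 = unf P c (k + 1) (s (k + 1)).1 :=
    unf_succ_edge (openEdge_subset _ _ h3)
  refine ⟨⟨t, ht, ?_⟩, ?_⟩
  · simp only [e]
    rw [h1, unf_add, map_smul, h.unfL_eq hk.le]
  · simp only [VisU, e, AffineIsometryEquiv.symm_apply_apply]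
    exact ⟨h.mem_openEdge h0 hk.le, h3, h2⟩

lemma Pass.chain {c : ℕ → Fin n} {m : ℕ} {v : Plane} {q : ℕ → Plane} (h : Pass P c m v q) :
    IsChain P c m fun k => ((unf P c (k + 1)).symm (q k), (unfL P c (k + 1)).symm v) := by
  intro k hk
  obtain ⟨⟨t, ht, h1⟩, h2⟩ := h k hk
  have e : (unf P c (k + 1 + 1)).symm (q (k + 1)) = (unf P c (k + 1)).symm (q (k + 1)) := by
    rw [AffineIsometryEquiv.symm_apply_eq, unf_succ_edge (openEdge_subset _ _ h2.right)]; simp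
  refine ⟨⟨t, ht, ?_⟩, ?_, ?_, ?_⟩
  · simp only [e]
    rw [h1, unf_symm_add, map_smul]
  · simp only [e]; exact h2.sub
  · simp only [e]; exact h2.right
  · simp only [reflectIn_eq]
    rw [LinearIsometryEquiv.symm_apply_eq, unfL_succ, refl_refl]; simp

lemma mem_openSegment_of_lt {x w : Plane} {t t' : ℝ} (ht : 0 < t) (h : t < t') :
    x + t • w ∈ openSegment ℝ x (x + t' • w) := by
  rw [openSegment_eq_image']
  have : 0 < t' := ht.trans h
  refine ⟨t / t', ⟨by positivity, (div_lt_one this).2 h⟩, ?_⟩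
  simp only [add_sub_cancel_left, smul_smul, div_mul_cancel₀ _ this.ne']

/-- The next bounce is determined by the state. -/
lemma Bounce.unique (hP : IsSimple P) {i j : Fin n} {s s' s'' : Plane × Plane}
    (h : Bounce P i s s') (h' : Bounce P j s s'') : i = j ∧ s' = s'' := by
  obtain ⟨⟨t, ht, h1⟩, h2, h3, h4⟩ := h
  obtain ⟨⟨t', ht', h1'⟩, h2', h3', h4'⟩ := h'
  have key : t = t' := by
    rcases lt_trichotomy t t' with hlt | heq | hlt
    · refine absurd (h2' ?_) (notMem_inside_of_mem_openEdge h3)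
      rw [h1, h1']; exact mem_openSegment_of_lt ht hlt
    · exact heq
    · refine absurd (h2 ?_) (notMem_inside_of_mem_openEdge h3')
      rw [h1, h1']; exact mem_openSegment_of_lt ht' hlt
  subst key
  have hs : s'.1 = s''.1 := by rw [h1, h1']
  have hij : i = j := hP.eq_of_mem h3 (hs ▸ openEdge_subset P j h3')
  subst hij
  exact ⟨rfl, Prod.ext hs (by rw [h4, h4'])⟩

/-- The state reached by time reversal. -/
def rev (P : Polygon Plane n) (i : Fin n) (s : Plane × Plane) : Plane × Plane :=
  (s.1, -refl P i s.2)

lemma Bounce.reverse {i j : Fin n} {s s' : Plane × Plane} (h : Bounce P i s s')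
    (hs : s.1 ∈ openEdge P j) : Bounce P j (rev P i s') (rev P j s) := by
  obtain ⟨⟨t, ht, h1⟩, h2, h3, h4⟩ := h
  have e : refl P i s'.2 = s.2 := by rw [h4, reflectIn_eq, refl_refl]
  refine ⟨⟨t, ht, ?_⟩, ?_, hs, ?_⟩
  · simp only [rev, e, h1]; module
  · rw [openSegment_symm]; exact h2
  · simp only [rev, e, reflectIn_eq, map_neg]

lemma rev_rev (i : Fin n) (s : Plane × Plane) : rev P i (rev P i s) = s := by
  simp [rev]

/-- The previous bounce is determined by the state. -/
lemma Bounce.unique_left (hP : IsSimple P) {i a b : Fin n} {s t s' : Plane × Plane}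
    (h : Bounce P i s s') (h' : Bounce P i t s') (hs : s.1 ∈ openEdge P a)
    (ht : t.1 ∈ openEdge P b) : a = b ∧ s = t := by
  obtain ⟨rfl, h2⟩ := (h.reverse hs).unique hP (h'.reverse ht)
  exact ⟨rfl, by rw [← rev_rev a s, h2, rev_rev]⟩

/-- Two chains from the same state follow the same code. -/
lemma IsChain.eq_of_eq (hP : IsSimple P) {c c' : ℕ → Fin n} {m : ℕ} {s s' : ℕ → Plane × Plane}
    (h : IsChain P c m s) (h' : IsChain P c' m s') (h0 : s 0 = s' 0) :
    ∀ k ≤ m, s k = s' k ∧ (0 < k → c k = c' k) := by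
  intro k hk
  induction k with
  | zero => exact ⟨h0, fun h => absurd h (lt_irrefl _)⟩
  | succ k ih =>
    have h1 := h k (by omega)
    have h2 := h' k (by omega)
    rw [← (ih (by omega)).1] at h2
    obtain ⟨h3, h4⟩ := h1.unique hP h2
    exact ⟨h4, fun _ => h3⟩

/-! ### Edges seen from a vertex -/

/-- An edge parametrised by the distance from one of its endpoints. -/
structure EdgeRay (P : Polygon Plane n) (i : Fin n) (z e : Plane) (L : ℝ) : Prop where
  norm_eq : ‖e‖ = 1
  pos : 0 < L
  mem_open : ∀ x, x ∈ openEdge P i ↔ ∃ r : ℝ, 0 < r ∧ r < L ∧ x = z + r • e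
  mem_edge : ∀ x, x ∈ P.edgeSet ℝ i ↔ ∃ r : ℝ, 0 ≤ r ∧ r ≤ L ∧ x = z + r • e
  refl_eq : ∀ v, refl P i v = (2 * inner ℝ e v) • e - v

lemma segment_ray {z y : Plane} (h : z ≠ y) :
    ∃ e : Plane, ∃ L : ℝ, ‖e‖ = 1 ∧ 0 < L ∧ y - z = L • e ∧
      (∀ x, x ∈ openSegment ℝ z y ↔ ∃ r : ℝ, 0 < r ∧ r < L ∧ x = z + r • e) ∧
      (∀ x, x ∈ segment ℝ z y ↔ ∃ r : ℝ, 0 ≤ r ∧ r ≤ L ∧ x = z + r • e) := by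
  have hL : 0 < ‖y - z‖ := norm_pos_iff.2 (sub_ne_zero.2 h.symm)
  have he : y - z = ‖y - z‖ • (‖y - z‖⁻¹ • (y - z)) := by
    rw [smul_smul, mul_inv_cancel₀ hL.ne', one_smul]
  refine ⟨‖y - z‖⁻¹ • (y - z), ‖y - z‖, ?_, hL, he, fun x => ?_, fun x => ?_⟩
  · rw [norm_smul, norm_inv, norm_norm, inv_mul_cancel₀ hL.ne']
  · rw [openSegment_eq_image']
    constructor
    · rintro ⟨s, ⟨h0, h1⟩, rfl⟩
      refine ⟨s * ‖y - z‖, by positivity, by nlinarith, ?_⟩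
      simp only [mul_smul, ← he]
    · rintro ⟨r, h0, h1, rfl⟩
      exact ⟨r * ‖y - z‖⁻¹, ⟨by positivity, by rw [← div_eq_mul_inv]; exact (div_lt_one hL).2 h1⟩,
        by simp only [mul_smul]⟩
  · rw [segment_eq_image']
    constructor
    · rintro ⟨s, ⟨h0, h1⟩, rfl⟩
      refine ⟨s * ‖y - z‖, by positivity, by nlinarith, ?_⟩
      simp only [mul_smul, ← he]
    · rintro ⟨r, h0, h1, rfl⟩
      exact ⟨r * ‖y - z‖⁻¹, ⟨by positivity, by rw [← div_eq_mul_inv]; exact (div_le_one hL).2 h1⟩,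
        by simp only [mul_smul]⟩

lemma exists_edgeRay (hP : IsSimple P) {i : Fin n} {z : Plane}
    (hz : z = P i ∨ z = P (finRotate n i)) : ∃ e L, EdgeRay P i z e L := by
  have hne := hP.nondegenerate i
  have key : ∀ (e : Plane) (L : ℝ), ‖e‖ = 1 → L ≠ 0 → P (finRotate n i) - P i = L • e → ∀ v,
      refl P i v = (2 * inner ℝ e v) • e - v := by
    intro e L he hL h v
    rw [refl_apply, h, norm_smul, he, inner_smul_left, smul_smul]
    congr 2
    simp only [conj_trivial, mul_one, Real.norm_eq_abs, sq_abs]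
    field_simp
  rcases hz with rfl | rfl
  · obtain ⟨e, L, h1, h2, h3, h4, h5⟩ := segment_ray hne
    exact ⟨e, L, h1, h2, h4, fun x => by rw [edgeSet_eq]; exact h5 x, key e L h1 h2.ne' h3⟩
  · obtain ⟨e, L, h1, h2, h3, h4, h5⟩ := segment_ray hne.symm
    refine ⟨e, L, h1, h2, fun x => by rw [openEdge, openSegment_symm]; exact h4 x,
      fun x => by rw [edgeSet_eq, segment_symm]; exact h5 x,
      key e (-L) h1 (neg_ne_zero.2 h2.ne') ?_⟩
    rw [neg_smul, ← h3, neg_sub]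

lemma IsSimple.vertex_of_mem_of_mem (hP : IsSimple P) {A B : Fin n} (hAB : A ≠ B) {z : Plane}
    (hA : z ∈ P.edgeSet ℝ A) (hB : z ∈ P.edgeSet ℝ B) : z = P A ∨ z = P (finRotate n A) := by
  rcases hP.eq_vertex hAB hA hB with ⟨rfl, h⟩ | ⟨-, h⟩
  · exact .inr h
  · exact .inl h

/-! ### Finitely many bounces in bounded time -/

/-- Here `w₀`, `w`, `w'` are the velocities before, between and after two bounces at the sides of a
corner. The increment times `t` equals `2 * cross e e' ^ 2 * (r + r')`, and `t ≤ r + r'` by the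
triangle inequality. -/
lemma corner_increment {e e' w w₀ w' : Plane} {r r' t : ℝ} (he : ‖e‖ = 1) (he' : ‖e'‖ = 1)
    (hr : 0 < r) (hr' : 0 < r') (ht : 0 < t) (hw : ‖w‖ = 1) (h : r' • e' - r • e = t • w)
    (h0 : w = (2 * inner ℝ e w₀) • e - w₀) (h1 : w' = (2 * inner ℝ e' w) • e' - w) :
    2 * cross e e' ^ 2 ≤ inner ℝ (e + e') w' - inner ℝ (e + e') w₀ := by
  have ht' : t ≤ r + r' := by
    have : ‖r' • e' - r • e‖ ≤ r' + r := by
      refine (norm_sub_le _ _).trans (le_of_eq ?_)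
      rw [norm_smul, norm_smul, he, he', Real.norm_of_nonneg hr.le, Real.norm_of_nonneg hr'.le]
      ring
    rw [h, norm_smul, hw, Real.norm_of_nonneg ht.le] at this
    linarith
  have e1 : e 0 ^ 2 + e 1 ^ 2 = 1 := by rw [← norm_sq_eq, he]; norm_num
  have e2 : e' 0 ^ 2 + e' 1 ^ 2 = 1 := by rw [← norm_sq_eq, he']; norm_num
  have k0 : r' * e' 0 - r * e 0 = t * w 0 := by simpa using congrFun (congrArg WithLp.ofLp h) 0
  have k1 : r' * e' 1 - r * e 1 = t * w 1 := by simpa using congrFun (congrArg WithLp.ofLp h) 1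
  have hw0 : w₀ = (2 * inner ℝ e w) • e - w := by
    have : inner ℝ e w = inner ℝ e w₀ := by
      rw [h0, inner_sub_right, inner_smul_right, real_inner_self_eq_norm_sq, he]; ring
    rw [this, h0]; module
  have main : t * (inner ℝ (e + e') w' - inner ℝ (e + e') w₀) =
      2 * cross e e' ^ 2 * (r + r') := by
    have A1 : inner ℝ (e + e') w' = 2 * inner ℝ e' w * (inner ℝ e e' + 1) - inner ℝ (e + e') w := by
      rw [h1]; simp only [inner_sub_right, inner_smul_right, inner_add_left,
        real_inner_self_eq_norm_sq, he']; ring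
    have A2 : inner ℝ (e + e') w₀ = 2 * inner ℝ e w * (inner ℝ e e' + 1) - inner ℝ (e + e') w := by
      rw [hw0]; simp only [inner_sub_right, inner_smul_right, inner_add_left,
        real_inner_self_eq_norm_sq, he, real_inner_comm e e']; ring
    have A3 : t * inner ℝ e' w = r' - r * inner ℝ e e' := by
      rw [← inner_smul_right, ← h, inner_sub_right, inner_smul_right, inner_smul_right,
        real_inner_self_eq_norm_sq, he', real_inner_comm e e']; ring
    have A4 : t * inner ℝ e w = r' * inner ℝ e e' - r := by
      rw [← inner_smul_right, ← h, inner_sub_right, inner_smul_right, inner_smul_right,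
        real_inner_self_eq_norm_sq, he]; ring
    have A5 := cross_sq_add_inner_sq e e'
    rw [he, he'] at A5
    rw [A1, A2]
    linear_combination 2 * (inner ℝ e e' + 1) * (A3 - A4) - 2 * (r + r') * A5
  have : t * (2 * cross e e' ^ 2) ≤ t * (inner ℝ (e + e') w' - inner ℝ (e + e') w₀) := by
    rw [main]; nlinarith [sq_nonneg (cross e e')]
  exact le_of_mul_le_mul_left this ht

/-- The component of the velocity along `eA + eB` is bounded, but it grows by a fixed amount with
every two bounces. -/
lemma corner_bound (hP : IsSimple P) {A B : Fin n} (hAB : A ≠ B) {z : Plane}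
    (hA : z ∈ P.edgeSet ℝ A) (hB : z ∈ P.edgeSet ℝ B) :
    ∃ N : ℕ, ∀ (c : ℕ → Fin n) (m : ℕ) (s : ℕ → Plane × Plane), IsChain P c m s →
      (s 0).1 ∈ openEdge P (c 0) → ‖(s 0).2‖ = 1 → (∀ k ≤ m, c k = A ∨ c k = B) → m < N := by
  obtain ⟨eA, LA, rA⟩ := exists_edgeRay hP (hP.vertex_of_mem_of_mem hAB hA hB)
  obtain ⟨eB, LB, rB⟩ := exists_edgeRay hP (hP.vertex_of_mem_of_mem hAB.symm hB hA)
  set μ := cross eA eB ^ 2 with hμ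
  set e : Fin n → Plane := fun i => if i = A then eA else eB with he
  have hr : ∀ i, i = A ∨ i = B → ∃ L, EdgeRay P i z (e i) L := by
    rintro i (rfl | rfl)
    · exact ⟨LA, by simpa [he] using rA⟩
    · exact ⟨LB, by simpa [he, hAB.symm] using rB⟩
  have hsum : ∀ i j, (i = A ∨ i = B) → (j = A ∨ j = B) → i ≠ j →
      e i + e j = eA + eB ∧ cross (e i) (e j) ^ 2 = μ := by
    rintro i j (rfl | rfl) (rfl | rfl) hij
    · exact absurd rfl hij
    · simp [he, hAB.symm, hμ]
    · simp [he, hAB.symm, hμ, add_comm, cross_comm eB]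
    · exact absurd rfl hij
  -- The component stays in `[-2, 2]` and gains at least `2 * μ` in two bounces, so `J > 2 / μ`
  -- pairs of bounces are too many.
  obtain ⟨J, hJ⟩ := exists_nat_gt (2 / μ)
  refine ⟨2 * J + 2, fun c m s hs h0 hn hc => ?_⟩
  by_contra! hm
  have hmem : ∀ k ≤ m, ∃ r : ℝ, 0 < r ∧ (s k).1 = z + r • e (c k) := fun k hk => by
    obtain ⟨L, hL⟩ := hr _ (hc k hk)
    obtain ⟨r, h1, -, h2⟩ := (hL.mem_open _).1 (hs.mem_openEdge h0 hk)
    exact ⟨r, h1, h2⟩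
  have hvis : ∀ k < m, Vis P (c k) (c (k + 1)) (s k).1 (s (k + 1)).1 := fun k hk =>
    ⟨hs.mem_openEdge h0 hk.le, (hs k hk).2.2.1, (hs k hk).2.1⟩
  -- At a straight angle `μ` vanishes, but a flight from one edge to the other is transverse to the
  -- first edge, so the edges are not collinear.
  have hpos : 0 < μ := by
    rw [hμ]
    have h1 := hvis 0 (by omega)
    have h2 := h1.cross_ne_zero (hP.nondegenerate _)
    obtain ⟨r, hr0, e0⟩ := hmem 0 (by omega)
    obtain ⟨r', hr1, e1⟩ := hmem 1 (by omega)
    have h3 := (hsum _ _ (hc 0 (by omega)) (hc 1 (by omega)) h1.edge_ne).2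
    rw [← hμ, ← h3]
    by_contra! hle
    have h4 : cross (e (c 0)) (e (c 1)) = 0 := by
      have := sq_nonneg (cross (e (c 0)) (e (c 1)))
      exact pow_eq_zero_iff (two_ne_zero) |>.1 (le_antisymm hle this)
    apply h2
    obtain ⟨L, hL⟩ := hr _ (hc 0 (by omega))
    have hd : ∃ l : ℝ, P (finRotate n (c 0)) - P (c 0) = l • e (c 0) := by
      obtain ⟨a, -, -, ha⟩ := (hL.mem_edge _).1 (left_mem_edgeSet P (c 0))
      obtain ⟨b, -, -, hb⟩ := (hL.mem_edge _).1 (right_mem_edgeSet P (c 0))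
      exact ⟨b - a, by rw [ha, hb]; module⟩
    obtain ⟨l, hl⟩ := hd
    rw [hl, e0, e1, add_sub_add_left_eq_sub, cross_smul_left, cross_sub_right, cross_smul_right,
      cross_smul_right, h4, cross_self]
    ring
  have hunit : ∀ k ≤ m, ‖(s k).2‖ = 1 := fun k hk => (hs.norm_eq hk).trans hn
  set H : ℕ → ℝ := fun k => inner ℝ (eA + eB) (s k).2 with hH
  have hstep : ∀ k, k + 2 ≤ m → H k + 2 * μ ≤ H (k + 2) := by
    intro k hk
    obtain ⟨r, hr0, x0⟩ := hmem (k + 1) (by omega)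
    obtain ⟨r', hr1, x1⟩ := hmem (k + 2) (by omega)
    have hne := (hvis (k + 1) (by omega)).edge_ne
    obtain ⟨s1, s2⟩ := hsum _ _ (hc (k + 1) (by omega)) (hc (k + 2) (by omega)) hne
    obtain ⟨-, -, -, b0⟩ := hs k (by omega)
    obtain ⟨⟨t, ht, b1⟩, -, -, b2⟩ := hs (k + 1) (by omega)
    obtain ⟨L, hL⟩ := hr _ (hc (k + 1) (by omega))
    obtain ⟨L', hL'⟩ := hr _ (hc (k + 2) (by omega))
    rw [reflectIn_eq, hL.refl_eq] at b0
    rw [reflectIn_eq, hL'.refl_eq] at b2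
    have := corner_increment hL.norm_eq hL'.norm_eq hr0 hr1 ht (hunit (k + 1) (by omega))
      (by rw [x0, x1] at b1
          have : r' • e (c (k + 2)) = r • e (c (k + 1)) + t • (s (k + 1)).2 := by
            rw [add_assoc] at b1; exact add_left_cancel b1
          rw [this]; abel) b0 b2
    rw [s1, s2] at this
    simp only [hH]
    linarith
  have hsum2 : ∀ j, 2 * j ≤ m → H 0 + 2 * μ * j ≤ H (2 * j) := by
    intro j hj
    induction j with
    | zero => simp
    | succ j ih =>
      have h1 := hstep (2 * j) (by omega)
      have h2 := ih (by omega)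
      rw [show 2 * (j + 1) = 2 * j + 2 by ring]
      push_cast; linarith
  have hb : ∀ k ≤ m, |H k| ≤ 2 := by
    intro k hk
    refine (abs_real_inner_le_norm _ _).trans ?_
    rw [hunit k hk, mul_one]
    refine (norm_add_le _ _).trans ?_
    rw [rA.norm_eq, rB.norm_eq]; norm_num
  have h1 := hsum2 J (by omega)
  have h2 := abs_le.1 (hb 0 (by omega))
  have h3 := abs_le.1 (hb (2 * J) (by omega))
  have h4 : 2 < μ * J := by rwa [div_lt_iff₀' hpos] at hJ
  linarith [h2.1, h3.2]

/-- For edges without a common point, the sum of the distances to them has a positive minimum on the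
compact edge `i₀`. There are finitely many families `T`, so one `c₀` serves all. -/
lemma exists_common_point (P : Polygon Plane n) : ∃ c₀ : ℝ, 0 < c₀ ∧
    ∀ (i₀ : Fin n) (T : Finset (Fin n)) (x : Plane), i₀ ∈ T → x ∈ P.edgeSet ℝ i₀ →
      (∀ i ∈ T, ∃ y ∈ P.edgeSet ℝ i, dist x y < c₀) → ∃ z, ∀ i ∈ T, z ∈ P.edgeSet ℝ i := by
  have key : ∀ (i₀ : Fin n) (T : Finset (Fin n)), ∀ᶠ c₀ : ℝ in 𝓝[>] 0, ∀ x, i₀ ∈ T →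
      x ∈ P.edgeSet ℝ i₀ → (∀ i ∈ T, ∃ y ∈ P.edgeSet ℝ i, dist x y < c₀) →
      ∃ z, ∀ i ∈ T, z ∈ P.edgeSet ℝ i := by
    intro i₀ T
    by_cases hT : ∃ z, ∀ i ∈ T, z ∈ P.edgeSet ℝ i
    · exact Eventually.of_forall fun _ _ _ _ _ => hT
    have hne : ∀ i, (P.edgeSet ℝ i).Nonempty := fun i => ⟨_, left_mem_edgeSet P i⟩
    have hcont : Continuous fun x : Plane => ∑ i ∈ T, Metric.infDist x (P.edgeSet ℝ i) :=
      continuous_finsetSum _ fun i _ => Metric.continuous_infDist_pt _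
    obtain ⟨x₀, -, hx₀⟩ := (isCompact_edgeSet P i₀).exists_isMinOn (hne i₀) hcont.continuousOn
    set M := ∑ i ∈ T, Metric.infDist x₀ (P.edgeSet ℝ i) with hM
    have hMpos : 0 < M := by
      rw [hM]
      apply Finset.sum_pos' (fun i _ => Metric.infDist_nonneg)
      by_contra! hc
      apply hT
      refine ⟨x₀, fun i hi => ?_⟩
      rw [(isCompact_edgeSet P i).isClosed.mem_iff_infDist_zero (hne i)]
      exact le_antisymm (hc i hi) Metric.infDist_nonneg
    have hev : ∀ᶠ c₀ : ℝ in 𝓝[>] 0, (T.card : ℝ) * c₀ < M := by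
      have : Tendsto (fun c₀ : ℝ => (T.card : ℝ) * c₀) (𝓝[>] 0) (𝓝 0) := by
        have h : Continuous fun c₀ : ℝ => (T.card : ℝ) * c₀ := by fun_prop
        simpa using (h.tendsto 0).mono_left nhdsWithin_le_nhds
      exact this.eventually (gt_mem_nhds hMpos)
    filter_upwards [hev] with c₀ hc x _ hx hall
    exfalso
    have h1 : M ≤ ∑ i ∈ T, Metric.infDist x (P.edgeSet ℝ i) := hx₀ hx
    have h2 : ∑ i ∈ T, Metric.infDist x (P.edgeSet ℝ i) ≤ T.card • c₀ := by
      apply Finset.sum_le_card_nsmul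
      intro i hi
      obtain ⟨y, hy, hd⟩ := hall i hi
      exact (Metric.infDist_le_dist_of_mem hy).trans hd.le
    rw [nsmul_eq_mul] at h2
    linarith
  have h := (eventually_all.2 fun i₀ => eventually_all.2 fun T => key i₀ T).and
    (self_mem_nhdsWithin : ∀ᶠ c₀ : ℝ in 𝓝[>] 0, c₀ ∈ Ioi (0:ℝ))
  obtain ⟨c₀, h1, h2⟩ := h.exists
  exact ⟨c₀, h2, fun i₀ T x => h1 i₀ T x⟩

/-- The length of the part of an unfolded trajectory between the gates `k` and `l`. -/
lemma Pass.length {c : ℕ → Fin n} {m : ℕ} {v : Plane} {q : ℕ → Plane} (h : Pass P c m v q)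
    (hv : ‖v‖ = 1) {k l : ℕ} (hkl : k ≤ l) (hl : l ≤ m) :
    q l = q k + (inner ℝ v (q l - q k)) • v ∧
    dist ((unf P c (l + 1)).symm (q l)) ((unf P c (k + 1)).symm (q k)) ≤
      inner ℝ v (q l - q k) ∧ 0 ≤ inner ℝ v (q l - q k) := by
  induction l, hkl using Nat.le_induction with
  | base => simp
  | succ l hkl ih =>
    obtain ⟨h1, h2, h3⟩ := ih (by omega)
    obtain ⟨⟨t, ht, e⟩, hvis⟩ := h l (by omega)
    have hin : inner ℝ v (q (l + 1) - q k) = t + inner ℝ v (q l - q k) := by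
      rw [e, add_sub_right_comm, inner_add_right, inner_smul_right, real_inner_self_eq_norm_sq, hv]
      ring
    have hfold : (unf P c (l + 1 + 1)).symm (q (l + 1)) = (unf P c (l + 1)).symm (q (l + 1)) := by
      rw [AffineIsometryEquiv.symm_apply_eq, unf_succ_edge (openEdge_subset _ _ hvis.right)]; simp
    refine ⟨?_, ?_, by rw [hin]; positivity⟩
    · rw [hin, add_smul, add_comm (t • v), ← add_assoc, ← h1, e]
    · rw [hin, hfold]
      refine (dist_triangle _ ((unf P c (l + 1)).symm (q l)) _).trans (add_le_add ?_ h2)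
      rw [AffineIsometryEquiv.dist_map, e, dist_self_add_left, norm_smul, hv,
        Real.norm_of_nonneg ht.le, mul_one]

lemma Pass.mem {c : ℕ → Fin n} {m : ℕ} {v : Plane} {q : ℕ → Plane} (h : Pass P c m v q)
    (hm : 0 < m) {k : ℕ} (hk : k ≤ m) : (unf P c (k + 1)).symm (q k) ∈ openEdge P (c k) := by
  rcases k with _ | k
  · exact (h 0 hm).2.left
  · exact (h.chain k (by omega)).2.2.1

/-- A trajectory needs a definite length for a fixed number of bounces. -/
lemma exists_length_bound (hP : IsSimple P) : ∃ N : ℕ, 0 < N ∧ ∃ c₀ : ℝ, 0 < c₀ ∧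
    ∀ (c : ℕ → Fin n) (m : ℕ) (v : Plane) (q : ℕ → Plane), Pass P c m v q → ‖v‖ = 1 →
      ∀ k, k + N ≤ m → c₀ ≤ inner ℝ v (q (k + N) - q k) := by
  obtain ⟨c₀, hc₀, hcommon⟩ := exists_common_point P
  have hN : ∃ N : ℕ, ∀ A B j, A ≠ B → P j ∈ P.edgeSet ℝ A → P j ∈ P.edgeSet ℝ B →
      ∀ (c : ℕ → Fin n) (m : ℕ) (s : ℕ → Plane × Plane), IsChain P c m s →
      (s 0).1 ∈ openEdge P (c 0) → ‖(s 0).2‖ = 1 → (∀ k ≤ m, c k = A ∨ c k = B) → m < N := by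
    have h1 : ∀ x : Fin n × Fin n × Fin n, ∃ N : ℕ, x.1 ≠ x.2.1 →
        P x.2.2 ∈ P.edgeSet ℝ x.1 → P x.2.2 ∈ P.edgeSet ℝ x.2.1 →
        ∀ (c : ℕ → Fin n) (m : ℕ) (s : ℕ → Plane × Plane), IsChain P c m s →
        (s 0).1 ∈ openEdge P (c 0) → ‖(s 0).2‖ = 1 → (∀ k ≤ m, c k = x.1 ∨ c k = x.2.1) →
          m < N := by
      rintro ⟨A, B, j⟩
      by_cases h : A ≠ B ∧ P j ∈ P.edgeSet ℝ A ∧ P j ∈ P.edgeSet ℝ B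
      · obtain ⟨N, hN⟩ := corner_bound hP h.1 h.2.1 h.2.2
        exact ⟨N, fun _ _ _ => hN⟩
      · exact ⟨0, fun a b c => absurd ⟨a, b, c⟩ h⟩
    choose N hN using h1
    refine ⟨Finset.univ.sup N, fun A B j h1 h2 h3 c m s a1 a2 a3 a4 => ?_⟩
    exact (hN (A, B, j) h1 h2 h3 c m s a1 a2 a3 a4).trans_le
      (Finset.le_sup (f := N) (Finset.mem_univ (A, B, j)))
  obtain ⟨N, hN⟩ := hN
  refine ⟨N + 1, by omega, c₀, hc₀, fun c m v q h hv k hk => ?_⟩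
  -- A piece of `N + 1` flights shorter than `c₀` brings all its edges within `c₀` of one point, so
  -- they have a common point. Consecutive edges differ, so this point is a vertex, through which
  -- only two edges pass; the corner bound is violated.
  by_contra! hlt
  have hm : 0 < m := by omega
  have hmono : ∀ i ≤ N + 1, dist ((unf P c (k + 1)).symm (q k))
      ((unf P c (k + i + 1)).symm (q (k + i))) < c₀ := by
    intro i hi
    have h1 := (h.length hv (k := k) (l := k + i) (by omega) (by omega)).2.1
    have h2 := (h.length hv (k := k + i) (l := k + (N + 1)) (by omega) (by omega)).2.2
    have h3 : inner ℝ v (q (k + (N + 1)) - q k) =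
        inner ℝ v (q (k + (N + 1)) - q (k + i)) + inner ℝ v (q (k + i) - q k) := by
      rw [← inner_add_right, sub_add_sub_cancel]
    rw [dist_comm]
    linarith
  obtain ⟨z, hz⟩ := hcommon (c k) ((Finset.range (N + 2)).image fun i => c (k + i))
    ((unf P c (k + 1)).symm (q k)) (Finset.mem_image.2 ⟨0, by simp, rfl⟩)
    (openEdge_subset _ _ (h.mem hm (by omega))) (by
      intro i hi
      obtain ⟨j, hj, rfl⟩ := Finset.mem_image.1 hi
      rw [Finset.mem_range] at hj
      exact ⟨_, openEdge_subset _ _ (h.mem hm (k := k + j) (by omega)), hmono j (by omega)⟩)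
  have hz' : ∀ i ≤ N + 1, z ∈ P.edgeSet ℝ (c (k + i)) := fun i hi =>
    hz _ (Finset.mem_image.2 ⟨i, Finset.mem_range.2 (by omega), rfl⟩)
  have hne : c k ≠ c (k + 1) := (h k (by omega)).2.edge_ne
  have hz0 := hz' 0 (by omega)
  have hz1 := hz' 1 (by omega)
  obtain ⟨j, rfl⟩ : ∃ j, z = P j := by
    rcases hP.vertex_of_mem_of_mem hne hz0 hz1 with h | h
    · exact ⟨_, h⟩
    · exact ⟨_, h⟩
  have hch : IsChain P (fun i => c (k + i)) (N + 1)
      (fun i => ((unf P c (k + i + 1)).symm (q (k + i)), (unfL P c (k + i + 1)).symm v)) :=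
    fun i hi => h.chain (k + i) (by omega)
  have := hN (c k) (c (k + 1)) j hne hz0 hz1 _ (N + 1) _ hch (h.mem hm (k := k) (by omega))
    (by simpa using hv) fun i hi => hP.eq_or_eq_of_mem hne hz0 hz1 (hz' i hi)
  omega

lemma exists_diam_bound (P : Polygon Plane n) : ∃ D : ℝ, 0 < D ∧
    (∀ i j x y, x ∈ P.edgeSet ℝ i → y ∈ P.edgeSet ℝ j → dist x y ≤ D) ∧
    ∀ i x, x ∈ P.edgeSet ℝ i → ‖x‖ ≤ D := by
  obtain ⟨D, hD⟩ := (isCompact_boundary P).isBounded.exists_norm_le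
  have hD' : ∀ i x, x ∈ P.edgeSet ℝ i → ‖x‖ ≤ D := fun i x hx =>
    hD x (edgeSet_subset_boundary P i hx)
  refine ⟨2 * |D| + 1, by positivity, fun i j x y hx hy => ?_, fun i x hx => ?_⟩
  · rw [dist_eq_norm]
    refine (norm_sub_le _ _).trans ?_
    linarith [hD' i x hx, hD' j y hy, le_abs_self D]
  · linarith [hD' i x hx, le_abs_self D, abs_nonneg D]

/-- The length of a trajectory grows at least linearly. -/
lemma linear_growth {m : ℕ} {v : Plane} {q : ℕ → Plane} {N : ℕ} {c₀ : ℝ}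
    (hb : ∀ k, k + N ≤ m → c₀ ≤ inner ℝ v (q (k + N) - q k)) {j : ℕ} (hj : N * j ≤ m) :
    c₀ * j ≤ inner ℝ v (q (N * j) - q 0) := by
  induction j with
  | zero => simp
  | succ j ih =>
    have h1 := ih (by nlinarith)
    have h2 := hb (N * j) (by rw [mul_add, mul_one] at hj; exact hj)
    have h3 : inner ℝ v (q (N * (j + 1)) - q 0) =
        inner ℝ v (q (N * j + N) - q (N * j)) + inner ℝ v (q (N * j) - q 0) := by
      rw [← inner_add_right, sub_add_sub_cancel, mul_add, mul_one]
    rw [h3]; push_cast; linarith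

/-- Points of trajectories with the same code on the same gate are close. -/
lemma Pass.dist_le {c : ℕ → Fin n} {m : ℕ} {v v' : Plane} {q q' : ℕ → Plane}
    (h : Pass P c m v q) (h' : Pass P c m v' q') (hm : 0 < m) {D : ℝ}
    (hD : ∀ i j x y, x ∈ P.edgeSet ℝ i → y ∈ P.edgeSet ℝ j → dist x y ≤ D) {k : ℕ} (hk : k ≤ m) :
    ‖q k - q' k‖ ≤ D := by
  have := hD _ _ _ _ (openEdge_subset _ _ (h.mem hm hk)) (openEdge_subset _ _ (h'.mem hm hk))
  rwa [AffineIsometryEquiv.dist_map, dist_eq_norm] at this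

/-- Trajectories that follow the same code for a long time are almost parallel. -/
lemma exists_parallel_bound (hP : IsSimple P) : ∃ N : ℕ, 0 < N ∧ ∃ C : ℝ, 0 < C ∧
    ∀ (c : ℕ → Fin n) (j : ℕ) (v v' : Plane) (q q' : ℕ → Plane), 0 < j → Pass P c (N * j) v q →
      Pass P c (N * j) v' q' → ‖v‖ = 1 → ‖v'‖ = 1 → ‖v - v'‖ * j ≤ C := by
  obtain ⟨N, hN, c₀, hc₀, hlen⟩ := exists_length_bound hP
  obtain ⟨D, hD0, hD, -⟩ := exists_diam_bound P
  refine ⟨N, hN, 4 * D / c₀, by positivity, fun c j v v' q q' hj h h' hv hv' => ?_⟩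
  have hm : 0 < N * j := by positivity
  set T := inner ℝ v (q (N * j) - q 0) with hT
  set T' := inner ℝ v' (q' (N * j) - q' 0) with hT'
  have hTj : c₀ * j ≤ T := linear_growth (hlen c _ v q h hv) le_rfl
  have e := (h.length hv (Nat.zero_le (N * j)) le_rfl).1
  have e' := (h'.length hv' (Nat.zero_le (N * j)) le_rfl).1
  have hT0 := (h.length hv (Nat.zero_le (N * j)) le_rfl).2.2
  have hT0' := (h'.length hv' (Nat.zero_le (N * j)) le_rfl).2.2
  rw [← hT] at e hT0
  rw [← hT'] at e' hT0'
  have d0 := h.dist_le h' hm hD (Nat.zero_le _)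
  have d1 := h.dist_le h' hm hD (k := N * j) le_rfl
  -- At the first and at the last gate the two lines are at distance at most `D`, while the length
  -- `T` grows linearly in `j`; the difference of the directions is thus of order `1 / j`.
  have hTT : ‖T • v - T' • v'‖ ≤ 2 * D := by
    have : T • v - T' • v' = (q (N * j) - q' (N * j)) - (q 0 - q' 0) := by
      rw [e, e']; abel
    rw [this]
    refine (norm_sub_le _ _).trans (by linarith)
  have hdiff : |T - T'| ≤ 2 * D := by
    have := abs_norm_sub_norm_le (T • v) (T' • v')
    rw [norm_smul, norm_smul, hv, hv', Real.norm_of_nonneg hT0, Real.norm_of_nonneg hT0', mul_one,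
      mul_one] at this
    linarith
  have hfin : T * ‖v - v'‖ ≤ 4 * D := by
    have e3 : T • (v - v') = (T • v - T' • v') - (T - T') • v' := by module
    have : ‖T • (v - v')‖ ≤ 4 * D := by
      rw [e3]
      refine (norm_sub_le _ _).trans ?_
      rw [norm_smul (T - T'), hv', Real.norm_eq_abs]
      linarith
    rwa [norm_smul, Real.norm_of_nonneg hT0] at this
  rw [le_div_iff₀ hc₀]
  nlinarith [norm_nonneg (v - v')]

/-! ### Strips of parallel trajectories -/

/-- Between the gates `k` and `k + 1` of the unfolded code `c`, the line of direction `v` at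
transverse position `τ` runs inside the table. -/
def LineStep (P : Polygon Plane n) (c : ℕ → Fin n) (v : Plane) (k : ℕ) (τ : ℝ) : Prop :=
  ∃ p q : Plane, (∃ t : ℝ, 0 < t ∧ q = p + t • v) ∧ VisU P c k p q ∧ cross v p = τ

/-- A visible segment is transverse to the edge where it starts, so its line meets that edge in one
point only. -/
lemma Vis.eq_of_cross_eq_zero (hP : IsSimple P) {a b : Fin n} {p q p' w : Plane} {t : ℝ}
    (h : Vis P a b p q) (hq : q = p + t • w) (hp' : p' ∈ P.edgeSet ℝ a)
    (h0 : cross w (p' - p) = 0) : p' = p := by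
  have h1 := h.cross_ne_zero (hP.nondegenerate a)
  rw [hq, add_sub_cancel_left, cross_smul_right] at h1
  have hw : cross (P (finRotate n a) - P a) w ≠ 0 := right_ne_zero_of_mul h1
  have h2 : cross (P (finRotate n a) - P a) (p' - p) = 0 := by
    have e1 := cross_edge (left_mem_edgeSet P a) (right_mem_edgeSet P a) hp'
    have e2 := cross_edge (left_mem_edgeSet P a) (right_mem_edgeSet P a)
      (openEdge_subset P a h.left)
    have : p' - p = (p' - P a) - (p - P a) := by abel
    rw [this, cross_sub_right, e1, e2, sub_zero]
  have h3 := eq_smul_of_cross_eq_zero' h2 hw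
  rw [cross_comm, h0, neg_zero, zero_div, zero_smul] at h3
  exact sub_eq_zero.1 h3

lemma VisU.left_eq_of_cross_eq (hP : IsSimple P) {c : ℕ → Fin n} {k : ℕ} {p q p' v : Plane}
    (h : VisU P c k p q) (hq : ∃ t : ℝ, 0 < t ∧ q = p + t • v)
    (hp' : (unf P c (k + 1)).symm p' ∈ P.edgeSet ℝ (c k)) (hc : cross v p' = cross v p) :
    p' = p := by
  obtain ⟨t, -, hq⟩ := hq
  apply (unf P c (k + 1)).symm.injective
  refine Vis.eq_of_cross_eq_zero hP h (w := (unfL P c (k + 1)).symm v) (t := t) ?_ hp' ?_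
  · rw [hq, unf_symm_add, map_smul]
  · rw [unf_symm_sub, cross_unfL_symm hP, cross_sub_right, hc, sub_self, mul_zero]

lemma VisU.symm_right_eq {c : ℕ → Fin n} {k : ℕ} {p q : Plane} (h : VisU P c k p q) :
    (unf P c (k + 1 + 1)).symm q = (unf P c (k + 1)).symm q := by
  rw [AffineIsometryEquiv.symm_apply_eq, unf_succ_edge (openEdge_subset _ _ h.right)]; simp

lemma VisU.symm_left_eq {c : ℕ → Fin n} {k : ℕ} {p q : Plane} (h : VisU P c k p q) :
    (unf P c (k + 1)).symm p = (unf P c k).symm p := by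
  have h1 : unf P c (k + 1) ((unf P c (k + 1)).symm p) = unf P c k ((unf P c (k + 1)).symm p) :=
    unf_succ_edge (openEdge_subset _ _ h.left)
  rw [AffineIsometryEquiv.apply_symm_apply] at h1
  rw [eq_comm, AffineIsometryEquiv.symm_apply_eq, ← h1]

/-- The pieces at height `τ` end and begin on the same gate of the same line, and a transverse line
meets a gate only once; so they fit together. -/
lemma exists_pass_of_lineStep (hP : IsSimple P) {c : ℕ → Fin n} {v : Plane} {τ : ℝ}
    (h : ∀ k, LineStep P c v k τ) :
    ∃ q : ℕ → Plane, (∀ m, Pass P c m v q) ∧ ∀ k, cross v (q k) = τ := by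
  choose p q hq hvis hτ using h
  have key : ∀ k, q k = p (k + 1) := by
    intro k
    refine (hvis (k + 1)).left_eq_of_cross_eq hP (hq (k + 1)) ?_ ?_
    · rw [(hvis k).symm_right_eq]; exact openEdge_subset _ _ (hvis k).right
    · obtain ⟨t, -, e⟩ := hq k
      rw [e, cross_add_smul_self, hτ, hτ]
  exact ⟨p, fun m k _ => ⟨key k ▸ hq k, key k ▸ hvis k⟩, hτ⟩

lemma LineStep.exists_quad {c : ℕ → Fin n} {v : Plane} {k : ℕ} {τ₁ τ₂ : ℝ}
    (h₁ : LineStep P c v k τ₁) (h₂ : LineStep P c v k τ₂) (h : τ₁ < τ₂) :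
    ∃ p₁ q₁ p₂ q₂, QuadU P 1 c k p₁ q₁ v p₂ q₂ v ∧ cross v p₁ = τ₁ ∧ cross v q₁ = τ₁ ∧
      cross v p₂ = τ₂ ∧ cross v q₂ = τ₂ := by
  obtain ⟨p₁, q₁, ⟨t₁, ht₁, e₁⟩, w₁, d₁⟩ := h₁
  obtain ⟨p₂, q₂, ⟨t₂, ht₂, e₂⟩, w₂, d₂⟩ := h₂
  have d₁' : cross v q₁ = τ₁ := by rw [e₁, cross_add_smul_self, d₁]
  have d₂' : cross v q₂ = τ₂ := by rw [e₂, cross_add_smul_self, d₂]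
  exact ⟨p₁, q₁, p₂, q₂, ⟨w₁, w₂, ⟨t₁, ht₁, e₁⟩, ⟨t₂, ht₂, e₂⟩,
    by rw [cross_sub_right]; linarith, by rw [cross_sub_right]; linarith,
    by rw [cross_sub_right]; linarith, by rw [cross_sub_right]; linarith⟩, d₁, d₁', d₂, d₂'⟩

lemma LineStep.convex (hP : IsSimple P) {c : ℕ → Fin n} {v : Plane} {k : ℕ} {τ₁ τ τ₂ : ℝ}
    (h₁ : LineStep P c v k τ₁) (h₂ : LineStep P c v k τ₂) (h : τ₁ < τ) (h' : τ < τ₂) :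
    LineStep P c v k τ := by
  obtain ⟨p₁, q₁, p₂, q₂, hq, e1, e2, e3, e4⟩ := h₁.exists_quad h₂ (h.trans h')
  obtain ⟨p, q, ht, hv, hτ⟩ := hq.between hP (v := v) (τ := τ) (by linarith) (by linarith)
    (by linarith) (by linarith)
  exact ⟨p, q, ht, hv, by linarith⟩

lemma LineStep.congr {c c' : ℕ → Fin n} {v : Plane} {k : ℕ} {τ : ℝ} (h : LineStep P c v k τ)
    (hc : ∀ i ≤ k + 1, c i = c' i) : LineStep P c' v k τ := by
  obtain ⟨p, q, ht, hv, hτ⟩ := h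
  exact ⟨p, q, ht, hv.congr hc, hτ⟩

lemma norm_unf_le (c : ℕ → Fin n) (k : ℕ) (x : Plane) : ‖unf P c k x‖ ≤ ‖x‖ + ‖unf P c k 0‖ := by
  have h1 : unf P c k x = (unf P c k x - unf P c k 0) + unf P c k 0 := by abel
  rw [h1]
  refine (norm_add_le _ _).trans ?_
  rw [unf_sub, LinearIsometryEquiv.norm_map, sub_zero]

lemma VisU.norm_le {D : ℝ} (hD : ∀ i x, x ∈ P.edgeSet ℝ i → ‖x‖ ≤ D)
    {c : ℕ → Fin n} {k : ℕ} {p q : Plane} (h : VisU P c k p q) :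
    ‖p‖ ≤ D + ‖unf P c (k + 1) 0‖ ∧ ‖q‖ ≤ D + ‖unf P c (k + 1) 0‖ := by
  have key : ∀ p i, (unf P c (k + 1)).symm p ∈ openEdge P i → ‖p‖ ≤ D + ‖unf P c (k + 1) 0‖ := by
    intro p i hp
    have := norm_unf_le (P := P) c (k + 1) ((unf P c (k + 1)).symm p)
    rw [AffineIsometryEquiv.apply_symm_apply] at this
    linarith [hD _ _ (openEdge_subset _ _ hp)]
  exact ⟨key _ _ h.left, key _ _ h.right⟩

/-- Runs of lines are stable under small changes of the direction. -/
lemma LineStep.perturb (hP : IsSimple P) {D : ℝ} (hD : ∀ i x, x ∈ P.edgeSet ℝ i → ‖x‖ ≤ D)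
    {c c' : ℕ → Fin n} {v v' : Plane} {k : ℕ} {τ η : ℝ}
    (h₁ : LineStep P c' v' k (τ - η)) (h₂ : LineStep P c' v' k (τ + η))
    (hc : ∀ i ≤ k + 1, c' i = c i) (hη : ‖v - v'‖ * (D + ‖unf P c (k + 1) 0‖) < η) :
    LineStep P c v k τ := by
  have hη0 : 0 < η := by
    refine lt_of_le_of_lt (mul_nonneg (norm_nonneg _) (add_nonneg ?_ (norm_nonneg _))) hη
    exact (norm_nonneg _).trans (hD (c 0) _ (left_mem_edgeSet P _))
  obtain ⟨p₁, q₁, p₂, q₂, hq, e1, e2, e3, e4⟩ := (h₁.congr hc).exists_quad (h₂.congr hc)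
    (by linarith)
  have key : ∀ x, ‖x‖ ≤ D + ‖unf P c (k + 1) 0‖ → |cross v x - cross v' x| < η := by
    intro x hx
    rw [← cross_sub_left]
    exact (abs_cross_le _ _).trans_lt
      (lt_of_le_of_lt (mul_le_mul_of_nonneg_left hx (norm_nonneg _)) hη)
  have b1 := abs_lt.1 (key _ (VisU.norm_le hD hq.vis₁).1)
  have b2 := abs_lt.1 (key _ (VisU.norm_le hD hq.vis₁).2)
  have b3 := abs_lt.1 (key _ (VisU.norm_le hD hq.vis₂).1)
  have b4 := abs_lt.1 (key _ (VisU.norm_le hD hq.vis₂).2)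
  obtain ⟨p, q, ht, hv, hτ⟩ := hq.between hP (v := v) (τ := τ) (by linarith [b1.2])
    (by linarith [b2.2]) (by linarith [b3.1]) (by linarith [b4.1])
  exact ⟨p, q, ht, hv, by linarith⟩

lemma LineStep.abs_le {D : ℝ} (hD : ∀ i x, x ∈ P.edgeSet ℝ i → ‖x‖ ≤ D)
    {c : ℕ → Fin n} {v : Plane} (hv : ‖v‖ = 1) {τ : ℝ}
    (h : LineStep P c v 0 τ) : |τ| ≤ D := by
  obtain ⟨p, q, -, hvis, rfl⟩ := h
  refine (abs_cross_le _ _).trans ?_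
  rw [hv, one_mul]
  have h1 := hvis.left
  rw [hvis.symm_left_eq] at h1
  exact hD _ _ (openEdge_subset _ _ h1)

/-- The code after `j` bounces. -/
def shiftC (c : ℕ → Fin n) (j : ℕ) : ℕ → Fin n := fun i => c (j + i)

/-- The direction after `j` bounces, in the frame of the table. -/
def shiftV (P : Polygon Plane n) (c : ℕ → Fin n) (v : Plane) (j : ℕ) : Plane :=
  (unfL P c j).symm v

lemma norm_shiftV (c : ℕ → Fin n) (v : Plane) (j : ℕ) : ‖shiftV P c v j‖ = ‖v‖ := by
  simp [shiftV]

/-- In the frame of the table after `j` bounces the orientation has been reversed `j` times, whence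
the sign, and the origin has moved. -/
lemma LineStep.shift (hP : IsSimple P) {c : ℕ → Fin n} {v : Plane} {j k : ℕ} {τ : ℝ}
    (h : LineStep P c v (j + k) τ) :
    LineStep P (shiftC c j) (shiftV P c v j) k ((-1) ^ j * (τ - cross v (unf P c j 0))) := by
  obtain ⟨p, q, ⟨t, ht, e⟩, hvis, rfl⟩ := h
  refine ⟨(unf P c j).symm p, (unf P c j).symm q, ⟨t, ht, ?_⟩, ?_, ?_⟩
  · rw [e, unf_symm_add, map_smul]; rfl
  · rw [VisU, add_assoc, unf_shift_symm c j (k + 1), unf_shift_symm c j (k + 1)] at hvis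
    exact hvis
  · have h1 := cross_unf_symm hP c j 1 v p
    simp only [one_mul] at h1
    rw [← h1, ← mul_assoc, neg_one_pow_mul_self, one_mul]; rfl

/-- There is a strip of width `w` that follows the first `m` gates of `c`. -/
def HasStrip (P : Polygon Plane n) (c : ℕ → Fin n) (v : Plane) (w : ℝ) (m : ℕ) : Prop :=
  ∃ α : ℝ, ∀ τ ∈ Ioo α (α + w), ∀ k < m, LineStep P c v k τ

lemma hasStrip_shift (hP : IsSimple P) {c : ℕ → Fin n} {v : Plane} {α β : ℝ} {j m : ℕ}
    (h : ∀ τ ∈ Ioo α β, ∀ k < m, LineStep P c v (j + k) τ) :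
    HasStrip P (shiftC c j) (shiftV P c v j) (β - α) m := by
  set K := cross v (unf P c j 0) with hK
  rcases neg_one_pow_eq_or ℝ j with hs | hs
  · refine ⟨α - K, fun τ hτ k hk => ?_⟩
    have := (h (τ + K) ⟨by linarith [hτ.1], by linarith [hτ.2]⟩ k hk).shift hP
    rwa [← hK, hs, add_sub_cancel_right, one_mul] at this
  · refine ⟨K - β, fun τ hτ k hk => ?_⟩
    have := (h (K - τ) ⟨by linarith [hτ.2], by linarith [hτ.1]⟩ k hk).shift hP
    rwa [← hK, hs, sub_sub_cancel_left, neg_one_mul, neg_neg] at this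

lemma shiftC_shiftC (c : ℕ → Fin n) (j k : ℕ) : shiftC (shiftC c j) k = shiftC c (j + k) := by
  funext i; simp [shiftC, add_assoc]

lemma shiftV_shiftV (c : ℕ → Fin n) (v : Plane) (j k : ℕ) :
    shiftV P (shiftC c j) (shiftV P c v j) k = shiftV P c v (j + k) := by
  rw [shiftV, shiftV, shiftV, unfL_shift_symm]; rfl

/-- Convergence of codes and directions makes finitely many conditions hold eventually. -/
lemma eventually_near {ι : Type*} {l : Filter ι} {C : ι → ℕ → Fin n} {V : ι → Plane}
    {c : ℕ → Fin n} {v : Plane} (hC : Tendsto C l (𝓝 c)) (hV : Tendsto V l (𝓝 v)) (K : ℕ)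
    (B : ℕ → ℝ) {η : ℝ} (hη : 0 < η) :
    ∀ᶠ i in l, (∀ m ≤ K, C i m = c m) ∧ ∀ k ≤ K, ‖v - V i‖ * B k < η := by
  have h1 : ∀ m, ∀ᶠ i in l, C i m = c m := fun m => by
    have := tendsto_pi_nhds.1 hC m
    rwa [nhds_discrete, tendsto_pure] at this
  have h2 : ∀ k, ∀ᶠ i in l, ‖v - V i‖ * B k < η := fun k => by
    have : Tendsto (fun i => ‖v - V i‖ * B k) l (𝓝 0) := by
      have := ((tendsto_const_nhds (x := v)).sub hV).norm.mul_const (B k)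
      simpa using this
    exact this.eventually (gt_mem_nhds hη)
  have h3 := (eventually_all_finite (Set.finite_Iic K)).2 fun m _ => (h1 m).and (h2 m)
  filter_upwards [h3] with i hi
  exact ⟨fun m hm => (hi m hm).1, fun m hm => (hi m hm).2⟩

/-! ### A strip of parallel trajectories has a periodic code -/

lemma HasStrip.mono {c : ℕ → Fin n} {v : Plane} {w w' : ℝ} {m m' : ℕ} (h : HasStrip P c v w m)
    (hw : w' ≤ w) (hm : m' ≤ m) : HasStrip P c v w' m' := by
  obtain ⟨α, hα⟩ := h
  exact ⟨α, fun τ hτ k hk => hα τ ⟨hτ.1, by linarith [hτ.2]⟩ k (by omega)⟩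

/-- By convexity the positions of lines between two given gates form an interval, so a gap between
two families of such lines is filled as well. -/
lemma lineStep_hull (hP : IsSimple P) {c : ℕ → Fin n} {v : Plane} {k : ℕ} {a b a' b' : ℝ}
    (hab : a < b) (hab' : a' < b') (h : ∀ τ ∈ Ioo a b, LineStep P c v k τ)
    (h' : ∀ τ ∈ Ioo a' b', LineStep P c v k τ) :
    ∀ τ ∈ Ioo (min a a') (max b b'), LineStep P c v k τ := by
  intro τ hτ
  have key : ∀ a b a' b' : ℝ, a < b → a' < b' → (∀ τ ∈ Ioo a b, LineStep P c v k τ) →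
      (∀ τ ∈ Ioo a' b', LineStep P c v k τ) → a < τ → τ < b' → LineStep P c v k τ := by
    intro a b a' b' hab hab' h h' h1 h2
    by_cases hb : τ < b
    · exact h τ ⟨h1, hb⟩
    by_cases ha' : a' < τ
    · exact h' τ ⟨ha', h2⟩
    push Not at hb ha'
    exact (h ((a + b) / 2) ⟨by linarith, by linarith⟩).convex hP
      (h' ((a' + b') / 2) ⟨by linarith, by linarith⟩) (by linarith) (by linarith)
  rcases min_lt_iff.1 hτ.1 with h1 | h1 <;> rcases lt_max_iff.1 hτ.2 with h2 | h2
  · exact h τ ⟨h1, h2⟩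
  · exact key a b a' b' hab hab' h h' h1 h2
  · exact key a' b' a b hab' hab h' h h1 h2
  · exact h' τ ⟨h1, h2⟩

/-- A strip that slowly drifts out of another one widens the latter for a long time. -/
lemma exists_wide_of_drift (hP : IsSimple P) {D : ℝ} (hD0 : 0 < D)
    (hD : ∀ i j x y, x ∈ P.edgeSet ℝ i → y ∈ P.edgeSet ℝ j → dist x y ≤ D)
    (hD' : ∀ i x, x ∈ P.edgeSet ℝ i → ‖x‖ ≤ D)
    {c c' : ℕ → Fin n} {v v' : Plane} {α β α' δ : ℝ} {M : ℕ} (hv' : ‖v'‖ = 1)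
    (hy : ∀ τ ∈ Ioo α β, ∀ k, LineStep P c v k τ)
    (hs : ∀ τ ∈ Ioo α' (α' + 10 * δ), ∀ k, LineStep P c' v' k τ) (hδ : 0 < δ)
    (h1 : α - δ / 4 ≤ α') (h2 : α' + 10 * δ ≤ β + δ / 4) (hc0 : c' 0 = c 0)
    (hε : ‖v - v'‖ * ((M + 2) * D) ≤ δ / 4) (hκ : 0 < cross v v') :
    ∃ k, ∀ τ ∈ Ioo α (β + δ), ∀ i, k ≤ i → i < k + M → LineStep P c v i τ := by
  -- Two lines of the second strip, at distance `δ` from its two sides and `8 * δ` apart.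
  obtain ⟨q, hq, hqτ⟩ := exists_pass_of_lineStep hP (hs (α' + δ) ⟨by linarith, by linarith⟩)
  obtain ⟨q', hq', hqτ'⟩ := exists_pass_of_lineStep hP
    (hs (α' + 9 * δ) ⟨by linarith, by linarith⟩)
  set ε := ‖v - v'‖ with hεdef
  have hε0 : 0 ≤ ε := norm_nonneg _
  have hεD : ε * D ≤ δ / 4 := by
    refine le_trans ?_ hε
    have : ε * D ≤ (M + 1) * (ε * D) + ε * D := by
      have : 0 ≤ (M + 1) * (ε * D) := by positivity
      linarith
    nlinarith
  have hκε : cross v v' ≤ ε := by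
    have : cross v v' = cross (v - v') v' := by rw [cross_sub_left, cross_self, sub_zero]
    rw [this]
    refine (le_abs_self _).trans ((abs_cross_le _ _).trans ?_)
    rw [hv', mul_one]
  -- The position of the lower line as measured across the first strip. It increases because `v'` is
  -- turned to the positive side of `v`, by at most `ε * D` in one flight.
  set f : ℕ → ℝ := fun k => cross v (q k) with hf
  have hfold0 := (hq 1).mem one_pos (k := 0) zero_le_one
  have hstep : ∀ k, f k < f (k + 1) ∧ f (k + 1) ≤ f k + ε * D := by
    intro k
    obtain ⟨⟨t, ht, e⟩, hvis⟩ := hq (k + 1) k (by omega)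
    have hfk : f (k + 1) = f k + t * cross v v' := by
      simp only [hf, e, cross_add_right, cross_smul_right]
    have htD : t ≤ D := by
      have h3 := hD _ _ _ _ (openEdge_subset _ _ hvis.left) (openEdge_subset _ _ hvis.right)
      rw [AffineIsometryEquiv.dist_map, e, dist_self_add_right, norm_smul, hv', mul_one,
        Real.norm_of_nonneg ht.le] at h3
      exact h3
    rw [hfk]
    refine ⟨by linarith [mul_pos ht hκ], ?_⟩
    have : t * cross v v' ≤ D * ε := mul_le_mul htD hκε hκ.le hD0.le
    linarith
  have hmono : StrictMono f := strictMono_nat_of_lt_succ fun k => (hstep k).1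
  have hnear : ∀ x : Plane, ‖x‖ ≤ D → |cross v x - cross v' x| ≤ δ / 4 := by
    intro x hx
    rw [← cross_sub_left]
    exact (abs_cross_le _ _).trans ((mul_le_mul_of_nonneg_left hx hε0).trans hεD)
  have hf0 : |f 0 - (α' + δ)| ≤ δ / 4 := by
    rw [← hqτ 0]
    apply hnear
    have h3 := (hq 1 0 one_pos).2
    have h4 := h3.left
    rw [h3.symm_left_eq] at h4
    exact hD' _ _ (openEdge_subset _ _ h4)
  obtain ⟨hf0a, hf0b⟩ := abs_le.1 hf0
  have hex : ∃ k, β - 3 * δ ≤ f k := by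
    obtain ⟨N, -, c₀, hc₀, hlen⟩ := exists_length_bound hP
    obtain ⟨j, hj⟩ := exists_nat_gt ((β - 3 * δ - f 0) / (c₀ * cross v v'))
    have hpos : 0 < c₀ * cross v v' := by positivity
    rw [div_lt_iff₀ hpos] at hj
    have h3 := linear_growth (hlen c' (N * j) v' q (hq _) hv') (j := j) le_rfl
    have h4 := ((hq (N * j)).length hv' (Nat.zero_le (N * j)) le_rfl).1
    refine ⟨N * j, ?_⟩
    have h5 : f (N * j) = f 0 + inner ℝ v' (q (N * j) - q 0) * cross v v' := by
      simp only [hf]; rw [h4, cross_add_right, cross_smul_right]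
      simp only [inner_smul_right, add_sub_cancel_left, real_inner_self_eq_norm_sq, hv']
      ring
    rw [h5]
    nlinarith
  classical
  -- The first moment when the lower line is within `3 * δ` of the upper side `β`. By `hε` it is
  -- still below `β - 2 * δ` at the following `M + 1` gates.
  set K := Nat.find hex with hK
  have hKspec : β - 3 * δ ≤ f K := Nat.find_spec hex
  have hKmin : ∀ k < K, f k < β - 3 * δ := fun k hk => not_le.1 (Nat.find_min hex hk)
  have hK0 : 0 < K := by
    rw [Nat.pos_iff_ne_zero]
    intro h0
    rw [h0] at hKspec
    linarith
  have hafter : ∀ m : ℕ, f (K + m) ≤ β - 3 * δ + (m + 1) * (ε * D) := by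
    intro m
    induction m with
    | zero =>
      have h3 := (hstep (K - 1)).2
      rw [show K - 1 + 1 = K by omega] at h3
      have h4 := hKmin (K - 1) (by omega)
      simp; linarith
    | succ m ih =>
      have h3 := (hstep (K + m)).2
      push_cast
      rw [← add_assoc]; linarith
  have hupper : ∀ k ≤ K + M + 1, f k ≤ β - 2 * δ := by
    intro k hk
    have h3 := hafter (M + 1)
    have h4 : f k ≤ f (K + (M + 1)) := hmono.monotone (by omega)
    push_cast at h3
    have h5 : ((M : ℝ) + 1 + 1) * (ε * D) = ε * ((M + 2) * D) := by ring
    rw [h5] at h3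
    linarith
  -- As long as the lower line stays within the first strip, it can only cross the gates of that
  -- strip, so the two codes agree.
  have hcode : ∀ k ≤ K + M + 1, c' k = c k := by
    intro k
    induction k using Nat.strong_induction_on with
    | _ k ih =>
      intro hk
      rcases k with _ | k
      · exact hc0
      set lo := (α + f 0) / 2 with hlo
      have hlo1 : α < lo := by linarith
      have hlo2 : lo < f 0 := by linarith
      have hf0k : f 0 ≤ f k := hmono.monotone (Nat.zero_le k)
      have hfk1 := hupper (k + 1) hk
      have hfk := (hstep k).1
      obtain ⟨p₁, q₁, p₂, q₂, hquad, e1, e2, e3, e4⟩ :=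
        (hy lo ⟨hlo1, by linarith⟩ k).exists_quad (hy (β - δ) ⟨by linarith, by linarith⟩ k)
          (by linarith)
      obtain ⟨ht, hvis⟩ := hq (k + 1) k (by omega)
      refine hquad.edge_eq hP (fun i hi => (ih i (by omega) (by omega)).symm) hvis ht ?_ ?_ ?_ ?_ ?_
      · rw [one_mul, one_mul, e1]; exact lt_of_lt_of_le hlo2 hf0k
      · rw [one_mul, one_mul, e3]; change f k < _; linarith
      · rw [one_mul, one_mul, e1]; change _ < f (k + 1); linarith
      · rw [one_mul, one_mul, e3]; change f (k + 1) < _; linarith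
      · have hd : ‖p₂ - p₁‖ ≤ D := by
          have := hD _ _ _ _ (openEdge_subset _ _ hquad.vis₂.left)
            (openEdge_subset _ _ hquad.vis₁.left)
          rwa [AffineIsometryEquiv.dist_map, dist_eq_norm] at this
        have h3 := abs_le.1 (hnear _ hd)
        rw [cross_sub_right, e1, e3] at h3
        rw [one_mul]
        linarith [h3.2]
  refine ⟨K, fun τ hτ i hi hi' => ?_⟩
  by_cases hτβ : τ < β
  · exact hy τ ⟨hτ.1, hτβ⟩ i
  push Not at hτβ
  -- Positions between `β` and `β + δ` are caught between the two lines: after time `K` the lower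
  -- one is below `β - 2 * δ` and the upper one, nearly `8 * δ` further, above `β + δ`.
  have hquad : QuadU P 1 c' i (q i) (q (i + 1)) v' (q' i) (q' (i + 1)) v' := by
    refine ⟨(hq (i + 1) i (by omega)).2, (hq' (i + 1) i (by omega)).2, (hq (i + 1) i (by omega)).1,
      (hq' (i + 1) i (by omega)).1, ?_, ?_, ?_, ?_⟩ <;>
    · rw [one_mul, cross_sub_right, hqτ, hqτ']; linarith
  have hup : ∀ k, K ≤ k → τ < cross v (q' k) := by
    intro k hk
    have hd := (hq' (k + 1)).dist_le (hq (k + 1)) (by omega) hD (k := k) (by omega)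
    have h3 := abs_le.1 (hnear _ hd)
    rw [cross_sub_right, cross_sub_right, hqτ, hqτ'] at h3
    have h4 : f K ≤ cross v (q k) := hmono.monotone hk
    linarith [h3.1, hτ.2]
  have hdown : ∀ k ≤ K + M + 1, cross v (q k) < τ := fun k hk => by
    have := hupper k hk
    simp only [hf] at this
    linarith
  obtain ⟨p, r, ht, hvis, hpτ⟩ := hquad.between hP (v := v) (τ := τ)
    (by rw [one_mul]; exact hdown i (by omega)) (by rw [one_mul]; exact hdown _ (by omega))
    (by rw [one_mul]; exact hup i hi) (by rw [one_mul]; exact hup _ (by omega))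
  exact ⟨p, r, ht, hvis.congr fun j hj => hcode j (by omega), by linarith⟩

/-- Data on a strip of parallel trajectories and a limit of its positions that carries a strip of
the largest possible width `ω`. -/
structure StripLimit (P : Polygon Plane n) (c : ℕ → Fin n) (v : Plane) (w ω : ℝ) (φ : ℕ → ℕ)
    (cs : ℕ → Fin n) (vs : Plane) : Prop where
  norm_eq : ‖v‖ = 1
  w_pos : 0 < w
  ω_pos : 0 < ω
  strip : ∃ a, ∀ τ ∈ Ioo a (a + w), ∀ k, LineStep P c v k τ
  not_wider : ∀ w' > ω, ∃ M, ∀ j ≥ M, ¬ HasStrip P (shiftC c j) (shiftV P c v j) w' M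
  tendsto_φ : Tendsto φ atTop atTop
  tendsto_code : Tendsto (fun i => shiftC c (φ i)) atTop (𝓝 cs)
  tendsto_dir : Tendsto (fun i => shiftV P c v (φ i)) atTop (𝓝 vs)
  limit_strip : ∃ α, ∀ τ ∈ Ioo α (α + ω), ∀ k, LineStep P cs vs k τ

section
variable {c : ℕ → Fin n} {v : Plane} {w ω : ℝ} {φ : ℕ → ℕ} {cs : ℕ → Fin n} {vs : Plane}

lemma StripLimit.strip_shift (hP : IsSimple P) (h : StripLimit P c v w ω φ cs vs) (j : ℕ) :
    ∃ α, ∀ τ ∈ Ioo α (α + w), ∀ k, LineStep P (shiftC c j) (shiftV P c v j) k τ := by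
  obtain ⟨a, ha⟩ := h.strip
  set K := cross v (unf P c j 0) with hK
  rcases neg_one_pow_eq_or ℝ j with hs | hs
  · refine ⟨a - K, fun τ hτ k => ?_⟩
    have := (ha (τ + K) ⟨by linarith [hτ.1], by linarith [hτ.2]⟩ (j + k)).shift hP
    rwa [← hK, hs, add_sub_cancel_right, one_mul] at this
  · refine ⟨K - (a + w), fun τ hτ k => ?_⟩
    have := (ha (K - τ) ⟨by linarith [hτ.2], by linarith [hτ.1]⟩ (j + k)).shift hP
    rwa [← hK, hs, sub_sub_cancel_left, neg_one_mul, neg_neg] at this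

/-- Lines near the limit position are lines of the strip. -/
lemma StripLimit.eventually_lineStep (hP : IsSimple P) (h : StripLimit P c v w ω φ cs vs)
    (K : ℕ) {η : ℝ} (hη : 0 < η) :
    ∀ᶠ i in atTop, ∀ k < K, ∀ τ, LineStep P cs vs k (τ - η) → LineStep P cs vs k (τ + η) →
      LineStep P (shiftC c (φ i)) (shiftV P c v (φ i)) k τ := by
  obtain ⟨D, -, -, hD⟩ := exists_diam_bound P
  filter_upwards [eventually_near h.tendsto_code h.tendsto_dir K
    (fun k => D + ‖unf P cs (k + 1) 0‖) hη] with i hi k hk τ h1 h2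
  refine h1.perturb hP hD h2 (fun m hm => (hi.1 m (by omega)).symm) ?_
  rw [(unf_congr (P := P) (k := k + 1) fun m hm => hi.1 m (by omega)).1, norm_sub_rev]
  exact hi.2 k hk.le

/-- A stretch of the limit wider than `ω` would persist, slightly narrowed, at nearby late positions
of the original code, against `not_wider`. -/
lemma StripLimit.exists_not_wide (hP : IsSimple P) (h : StripLimit P c v w ω φ cs vs) {δ : ℝ}
    (hδ : 0 < δ) : ∃ M : ℕ, ∀ k a b, ω + δ ≤ b - a →
      ¬ ∀ τ ∈ Ioo a b, ∀ i, k ≤ i → i < k + M → LineStep P cs vs i τ := by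
  obtain ⟨M, hM⟩ := h.not_wider (ω + δ / 2) (by linarith)
  refine ⟨M, fun k a b hab hall => ?_⟩
  obtain ⟨i, hi, hiM⟩ := ((h.eventually_lineStep hP (k + M) (η := δ / 4) (by linarith)).and
    (h.tendsto_φ.eventually_ge_atTop M)).exists
  refine hM (φ i + k) (by omega) ?_
  rw [← shiftC_shiftC, ← shiftV_shiftV]
  refine (hasStrip_shift hP (α := a + δ / 4) (β := b - δ / 4) fun τ hτ m hm => ?_).mono
    (by linarith) le_rfl
  exact hi (k + m) (by omega) τ (hall _ ⟨by linarith [hτ.1], by linarith [hτ.2]⟩ _ (by omega)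
    (by omega)) (hall _ ⟨by linarith [hτ.1], by linarith [hτ.2]⟩ _ (by omega) (by omega))

/-- The strips close to the limit position are contained in a neighbourhood of the limit strip. -/
lemma StripLimit.eventually_contained (hP : IsSimple P) (h : StripLimit P c v w ω φ cs vs)
    {α : ℝ} (hα : ∀ τ ∈ Ioo α (α + ω), ∀ k, LineStep P cs vs k τ) {δ : ℝ} (hδ : 0 < δ) :
    ∀ᶠ i in atTop, ∀ a, (∀ τ ∈ Ioo a (a + w), ∀ k,
      LineStep P (shiftC c (φ i)) (shiftV P c v (φ i)) k τ) → α - δ ≤ a ∧ a + w ≤ α + ω + δ := by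
  obtain ⟨M, hM⟩ := h.not_wider (ω + δ / 2) (by linarith)
  have hω := h.ω_pos
  have hw := h.w_pos
  set η := min (δ / 4) (ω / 4) with hη
  have hη0 : 0 < η := lt_min (by linarith) (by linarith)
  have hη1 : η ≤ δ / 4 := min_le_left _ _
  have hη2 : η ≤ ω / 4 := min_le_right _ _
  filter_upwards [h.eventually_lineStep hP M hη0, h.tendsto_φ.eventually_ge_atTop M]
    with i hi hiM a ha
  -- The given strip and the slightly shrunk limit strip together span a strip. Maximality of `ω`
  -- bounds its width, so the given strip protrudes by less than `δ`.
  have hhull : ∀ k < M, ∀ τ ∈ Ioo (min (α + η) a) (max (α + ω - η) (a + w)),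
      LineStep P (shiftC c (φ i)) (shiftV P c v (φ i)) k τ := fun k hk =>
    lineStep_hull hP (by linarith) (by linarith)
      (fun τ hτ => hi k hk τ (hα _ ⟨by linarith [hτ.1], by linarith [hτ.2]⟩ k)
        (hα _ ⟨by linarith [hτ.1], by linarith [hτ.2]⟩ k)) (fun τ hτ => ha τ hτ k)
  have hle : max (α + ω - η) (a + w) - min (α + η) a < ω + δ / 2 := by
    by_contra! hc
    exact hM (φ i) hiM ⟨min (α + η) a, fun τ hτ k hk =>
      hhull k hk τ ⟨hτ.1, by linarith [hτ.2]⟩⟩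
  have b1 := le_max_left (α + ω - η) (a + w)
  have b2 := le_max_right (α + ω - η) (a + w)
  have b3 := min_le_left (α + η) a
  have b4 := min_le_right (α + η) a
  constructor <;> linarith

/-- A direction on the positive side of `vs` would make the strip drift across the limit strip and
widen it by `δ` along `M` gates, which `StripLimit.exists_not_wide` forbids. -/
lemma StripLimit.eventually_cross_le (hP : IsSimple P) (h : StripLimit P c v w ω φ cs vs) :
    ∀ᶠ i in atTop, cross vs (shiftV P c v (φ i)) ≤ 0 := by
  obtain ⟨D, hD0, hD, hD'⟩ := exists_diam_bound P
  obtain ⟨α, hα⟩ := h.limit_strip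
  have hw := h.w_pos
  set δ := w / 10 with hδ
  have hδ0 : 0 < δ := by positivity
  obtain ⟨M, hM⟩ := h.exists_not_wide hP hδ0
  filter_upwards [h.eventually_contained hP hα (δ := δ / 4) (by linarith),
    eventually_near h.tendsto_code h.tendsto_dir 0 (fun _ => (M + 2) * D)
      (η := δ / 4) (by linarith)] with i h1 h2
  by_contra! hκ
  obtain ⟨a, ha⟩ := h.strip_shift hP (φ i)
  obtain ⟨h3, h4⟩ := h1 a ha
  have hwδ : w = 10 * δ := by rw [hδ]; ring
  rw [hwδ] at ha h4
  obtain ⟨k, hk⟩ := exists_wide_of_drift hP hD0 hD hD' (M := M)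
    (by rw [norm_shiftV, h.norm_eq]) hα ha hδ0 h3 h4
    (h2.1 0 le_rfl) (h2.2 0 le_rfl).le hκ
  exact hM k α (α + ω + δ) (by linarith) hk

lemma shiftV_one (c : ℕ → Fin n) (v : Plane) : shiftV P c v 1 = refl P (c 0) v := by
  rw [shiftV, LinearIsometryEquiv.symm_apply_eq, unfL_succ, refl_refl]; rfl

lemma StripLimit.succ (hP : IsSimple P) (h : StripLimit P c v w ω φ cs vs) :
    StripLimit P c v w ω (fun i => φ i + 1) (shiftC cs 1) (shiftV P cs vs 1) := by
  refine ⟨h.norm_eq, h.w_pos, h.ω_pos, h.strip, h.not_wider,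
    (tendsto_add_atTop_nat 1).comp h.tendsto_φ, ?_, ?_, ?_⟩
  · simp_rw [← shiftC_shiftC c _ 1]
    have : Continuous fun c : ℕ → Fin n => shiftC c 1 := by unfold shiftC; fun_prop
    exact (this.tendsto cs).comp h.tendsto_code
  · simp_rw [← shiftV_shiftV c v _ 1]
    have h1 : ∀ᶠ i in atTop, shiftV P cs (shiftV P c v (φ i)) 1 =
        shiftV P (shiftC c (φ i)) (shiftV P c v (φ i)) 1 := by
      filter_upwards [eventually_near h.tendsto_code h.tendsto_dir 0 (fun _ => 0) one_pos]
        with i hi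
      rw [shiftV_one, shiftV_one, hi.1 0 le_rfl]
    refine Tendsto.congr' h1 ?_
    have : Continuous fun v : Plane => shiftV P cs v 1 := (unfL P cs 1).symm.continuous
    exact (this.tendsto vs).comp h.tendsto_dir
  · obtain ⟨α, hα⟩ := h.limit_strip
    set K := cross vs (unf P cs 1 0) with hK
    refine ⟨K - (α + ω), fun τ hτ k => ?_⟩
    have := (hα (K - τ) ⟨by linarith [hτ.2], by linarith [hτ.1]⟩ (1 + k)).shift hP
    rwa [← hK, pow_one, sub_sub_cancel_left, neg_one_mul, neg_neg] at this

/-- A bounce reverses orientation, so `eventually_cross_le` for `h` and for `h.succ` gives both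
inequalities. The directions are then parallel to `vs`, of norm one, and close to it. -/
lemma StripLimit.eventually_dir_eq (hP : IsSimple P) (h : StripLimit P c v w ω φ cs vs) :
    ∀ᶠ i in atTop, shiftV P c v (φ i) = vs := by
  have hvs : ‖vs‖ = 1 := by
    refine tendsto_nhds_unique h.tendsto_dir.norm ?_
    simp_rw [norm_shiftV, h.norm_eq]
    exact tendsto_const_nhds
  have h3 : ∀ᶠ i in atTop, (0:ℝ) < inner ℝ vs (shiftV P c v (φ i)) := by
    have : Tendsto (fun i => inner ℝ vs (shiftV P c v (φ i))) atTop (𝓝 (inner ℝ vs vs)) :=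
      (tendsto_const_nhds).inner h.tendsto_dir
    refine this.eventually (lt_mem_nhds ?_)
    rw [real_inner_self_eq_norm_sq, hvs]; norm_num
  filter_upwards [h.eventually_cross_le hP, (h.succ hP).eventually_cross_le hP, h3,
    eventually_near h.tendsto_code h.tendsto_dir 0 (fun _ => 0) one_pos] with i h1 h2 h3 h4
  rw [← shiftV_shiftV c v _ 1, shiftV_one, shiftV_one, h4.1 0 le_rfl, cross_refl hP] at h2
  have h0 : cross vs (shiftV P c v (φ i)) = 0 := by linarith
  have h5 := eq_smul_of_cross_eq_zero hvs h0
  have h6 := cross_sq_add_inner_sq vs (shiftV P c v (φ i))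
  rw [h0, hvs, norm_shiftV, h.norm_eq] at h6
  have h7 : inner ℝ vs (shiftV P c v (φ i)) = 1 := by nlinarith
  rw [h5, h7, one_smul]

end

/-- A maximal limit of the positions of a strip exists. -/
lemma exists_stripLimit (hP : IsSimple P) {c : ℕ → Fin n} {v : Plane} {a w : ℝ} (hv : ‖v‖ = 1)
    (hw : 0 < w) (h : ∀ τ ∈ Ioo a (a + w), ∀ k, LineStep P c v k τ) :
    ∃ ω φ cs vs, StripLimit P c v w ω φ cs vs := by
  obtain ⟨D, hD0, -, hD⟩ := exists_diam_bound P
  -- The widths of strips that occur arbitrarily late and over arbitrarily many gates; the supremum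
  -- `ω` of `W` is attained by a limit position.
  set W : Set ℝ := {w' | ∀ M, ∃ j ≥ M, HasStrip P (shiftC c j) (shiftV P c v j) w' M} with hW
  have hstripbd : ∀ (c : ℕ → Fin n) (v : Plane) (w' α : ℝ) (M : ℕ), ‖v‖ = 1 → 0 < w' → 0 < M →
      (∀ τ ∈ Ioo α (α + w'), ∀ k < M, LineStep P c v k τ) → -D ≤ α ∧ α + w' ≤ D := by
    intro c v w' α M hv hw' hM hα
    have key : ∀ τ ∈ Ioo α (α + w'), τ ∈ Icc (-D) D := fun τ hτ =>
      abs_le.1 ((hα τ hτ 0 hM).abs_le hD hv)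
    have h1 : Icc α (α + w') ⊆ Icc (-D) D := by
      rw [← closure_Ioo (by linarith : α ≠ α + w')]
      exact closure_minimal key isClosed_Icc
    exact ⟨(h1 (left_mem_Icc.2 (by linarith))).1, (h1 (right_mem_Icc.2 (by linarith))).2⟩
  have hwW : w ∈ W := fun M => ⟨M, le_rfl, by
    have := hasStrip_shift hP (c := c) (v := v) (α := a) (β := a + w) (j := M) (m := M)
      fun τ hτ k _ => h τ hτ (M + k)
    rwa [add_sub_cancel_left] at this⟩
  have hbdd : BddAbove W := by
    refine ⟨2 * D, fun w' hw' => ?_⟩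
    by_contra! hlt
    obtain ⟨j, -, α, hα⟩ := hw' 1
    have := hstripbd _ _ w' α 1 (by rw [norm_shiftV, hv]) (by linarith) one_pos hα
    linarith [this.1, this.2]
  set ω := sSup W with hω
  have hω0 : 0 < ω := hw.trans_le (le_csSup hbdd hwW)
  have hsmaller : ∀ w' < ω, w' ∈ W := by
    intro w' hw'
    obtain ⟨w'', h1, h2⟩ := exists_lt_of_lt_csSup ⟨w, hwW⟩ hw'
    intro M
    obtain ⟨j, hj, hs⟩ := h1 M
    exact ⟨j, hj, hs.mono h2.le le_rfl⟩
  have hlarger : ∀ w' > ω, ∃ M, ∀ j ≥ M, ¬ HasStrip P (shiftC c j) (shiftV P c v j) w' M := by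
    intro w' hw'
    by_contra! hc
    exact absurd (le_csSup hbdd (show w' ∈ W from hc)) (not_le.2 hw')
  -- Positive widths increasing to `ω`; the strip of width `ww i` is taken at a time later than `i`
  -- and over `i + 1` gates, so that a limit point carries a strip over all gates.
  set ww : ℕ → ℝ := fun i => ω - ω / (i + 2) with hww
  have hww1 : ∀ i, ww i < ω := fun i => by
    have : 0 < ω / ((i : ℝ) + 2) := by positivity
    simp only [hww]; linarith
  have hww0 : ∀ i, 0 < ww i := fun i => by
    have : ω / ((i : ℝ) + 2) < ω := div_lt_self hω0 (by linarith [(Nat.cast_nonneg i : (0:ℝ) ≤ i)])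
    simp only [hww]; linarith
  have hwwlim : Tendsto ww atTop (𝓝 ω) := by
    have h1 : Tendsto (fun i : ℕ => ω / ((i : ℝ) + 2)) atTop (𝓝 0) :=
      tendsto_const_nhds.div_atTop
        (tendsto_atTop_add_const_right _ _ tendsto_natCast_atTop_atTop)
    simpa using (tendsto_const_nhds (x := ω)).sub h1
  choose J hJ hJs using fun i : ℕ => hsmaller (ww i) (hww1 i) (i + 1)
  choose α hα using hJs
  have hαbd : ∀ i, α i ∈ Icc (-D) D := fun i => by
    have := hstripbd _ _ _ _ _ (by rw [norm_shiftV, hv]) (hww0 i) (Nat.succ_pos i) (hα i)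
    exact ⟨this.1, by linarith [this.2, hww0 i]⟩
  have hcomp : IsCompact ((univ : Set (ℕ → Fin n)) ×ˢ (Metric.sphere (0 : Plane) 1 ×ˢ Icc (-D) D)) :=
    isCompact_univ.prod ((isCompact_sphere _ _).prod isCompact_Icc)
  obtain ⟨⟨cs, vs, αs⟩, -, ψ, hψ, hlim⟩ := hcomp.tendsto_subseq
    (x := fun i => (shiftC c (J i), shiftV P c v (J i), α i))
    (fun i => ⟨mem_univ _, by simp [norm_shiftV, hv], hαbd i⟩)
  have hl1 : Tendsto (fun i => shiftC c (J (ψ i))) atTop (𝓝 cs) :=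
    (continuous_fst.tendsto _).comp hlim
  have hl2 : Tendsto (fun i => shiftV P c v (J (ψ i))) atTop (𝓝 vs) :=
    ((continuous_fst.comp continuous_snd).tendsto _).comp hlim
  have hl3 : Tendsto (fun i => α (ψ i)) atTop (𝓝 αs) :=
    ((continuous_snd.comp continuous_snd).tendsto _).comp hlim
  have hJt : Tendsto J atTop atTop := tendsto_atTop_mono
    (fun i => (Nat.le_succ i).trans (hJ i)) tendsto_id
  refine ⟨ω, J ∘ ψ, cs, vs, hv, hw, hω0, ⟨a, h⟩, hlarger, hJt.comp hψ.tendsto_atTop, hl1, hl2, αs,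
    fun τ hτ k => ?_⟩
  obtain ⟨η, hη0, hη1, hη2⟩ : ∃ η : ℝ, 0 < η ∧ αs < τ - η ∧ τ + η < αs + ω :=
    ⟨min ((τ - αs) / 2) ((αs + ω - τ) / 2), lt_min (by linarith [hτ.1]) (by linarith [hτ.2]),
      by linarith [min_le_left ((τ - αs) / 2) ((αs + ω - τ) / 2), hτ.1],
      by linarith [min_le_right ((τ - αs) / 2) ((αs + ω - τ) / 2), hτ.2]⟩
  have hl4 : Tendsto (fun i => α (ψ i) + ww (ψ i)) atTop (𝓝 (αs + ω)) :=
    hl3.add (hwwlim.comp hψ.tendsto_atTop)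
  obtain ⟨i, ⟨⟨hi1, hi2⟩, hi3⟩, hi4⟩ := (((eventually_near hl1 hl2 (k + 1)
    (fun k => D + ‖unf P cs (k + 1) 0‖) hη0).and (hl3.eventually (gt_mem_nhds hη1))).and
    ((hl4.eventually (lt_mem_nhds hη2)).and (hψ.tendsto_atTop.eventually_ge_atTop k))).exists
  refine (hα (ψ i) (τ - η) ⟨hi3, by linarith [hi4.1]⟩ k (by have := hi4.2; omega)).perturb hP hD
    (hα (ψ i) (τ + η) ⟨by linarith, hi4.1⟩ k (by have := hi4.2; omega)) (fun m hm => hi1 m hm)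
    (hi2 k (by omega))

/-- The code of a strip of parallel trajectories is periodic. -/
theorem exists_periodic_of_strip (hP : IsSimple P) {c : ℕ → Fin n} {v : Plane} {a b : ℝ}
    (hv : ‖v‖ = 1) (hab : a < b) (h : ∀ τ ∈ Ioo a b, ∀ k, LineStep P c v k τ) :
    ∃ p > 0, Function.Periodic c p := by
  obtain ⟨w, hw⟩ : ∃ w, w = b - a := ⟨_, rfl⟩
  obtain rfl : b = a + w := by linarith
  have hw0 : 0 < w := by linarith
  obtain ⟨ω, φ, cs, vs, hL⟩ := exists_stripLimit hP hv hw0 h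
  obtain ⟨α, hα⟩ := hL.limit_strip
  set K : ℕ → ℝ := fun j => cross v (unf P c j 0) with hK
  -- The lower end of the strip in the frame after `j` bounces: the centre is moved with its sign
  -- and half the width is subtracted, which covers both parities of `j`.
  set lo : ℕ → ℝ := fun j => (-1) ^ j * (a + w / 2 - K j) - w / 2 with hlo
  have hmem : ∀ j, ∀ τ ∈ Ioo (lo j) (lo j + w), (-1) ^ j * τ + K j ∈ Ioo a (a + w) := by
    intro j τ hτ
    simp only [hlo] at hτ
    rcases neg_one_pow_eq_or ℝ j with hs | hs <;> rw [hs] at hτ ⊢ <;>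
      exact ⟨by linarith [hτ.1, hτ.2], by linarith [hτ.1, hτ.2]⟩
  have hlo_strip : ∀ j, ∀ τ ∈ Ioo (lo j) (lo j + w), ∀ k,
      LineStep P (shiftC c j) (shiftV P c v j) k τ := by
    intro j τ hτ k
    have := (h _ (hmem j τ hτ) (j + k)).shift hP
    rwa [add_sub_cancel_right, ← mul_assoc, neg_one_pow_mul_self, one_mul] at this
  have hcont := hL.eventually_contained hP hα one_pos
  obtain ⟨I, hI⟩ := ((hcont.and (hL.eventually_dir_eq hP)).and
    (eventually_near hL.tendsto_code hL.tendsto_dir 0 (fun _ => 0) one_pos)).exists_forall_of_atTop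
  have hbd : ∀ i, lo (φ (i + I)) ∈ Icc (α - 1) (α + ω + 1) := fun i => by
    have := (hI (i + I) (by omega)).1.1 _ (hlo_strip _)
    exact ⟨this.1, by linarith [this.2]⟩
  -- The lower ends stay in a compact interval, so at two different times they are within `w / 4` of
  -- the same `x`, and both strips contain the position `x + w / 2`.
  obtain ⟨x, -, ψ, hψ, hx⟩ := isCompact_Icc.tendsto_subseq hbd
  obtain ⟨N, hN⟩ := (Metric.tendsto_atTop.1 hx) (w / 4) (by linarith)
  obtain ⟨N', hN', hφ⟩ : ∃ N' ≥ N, φ (ψ N + I) < φ (ψ N' + I) := by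
    have h1 : Tendsto (fun i => φ (ψ i + I)) atTop atTop :=
      hL.tendsto_φ.comp ((tendsto_add_atTop_nat I).comp hψ.tendsto_atTop)
    obtain ⟨i, hi⟩ := ((h1.eventually_gt_atTop (φ (ψ N + I))).and (eventually_ge_atTop N)).exists
    exact ⟨i, hi.2, hi.1⟩
  have hd1 := abs_lt.1 (hN N le_rfl)
  have hd2 := abs_lt.1 (hN N' hN')
  simp only [Function.comp] at hd1 hd2
  obtain ⟨⟨-, hdir1⟩, hc1, -⟩ := hI (ψ N + I) (by omega)
  obtain ⟨⟨-, hdir2⟩, hc2, -⟩ := hI (ψ N' + I) (by omega)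
  set j := φ (ψ N + I) with hj
  set l := φ (ψ N' + I) with hl
  have hedge : c j = c l := (hc1 0 le_rfl).trans (hc2 0 le_rfl).symm
  obtain ⟨q, hq, hqτ⟩ := exists_pass_of_lineStep hP
    (h _ (hmem j (x + w / 2) ⟨by linarith [hd1.2], by linarith [hd1.1]⟩))
  obtain ⟨q', hq', hqτ'⟩ := exists_pass_of_lineStep hP
    (h _ (hmem l (x + w / 2) ⟨by linarith [hd2.2], by linarith [hd2.1]⟩))
  set s : ℕ → Plane × Plane :=
    fun k => ((unf P c (k + 1)).symm (q k), (unfL P c (k + 1)).symm v) with hs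
  set s' : ℕ → Plane × Plane :=
    fun k => ((unf P c (k + 1)).symm (q' k), (unfL P c (k + 1)).symm v) with hs'
  have hch : ∀ m, IsChain P c m s := fun m => (hq m).chain
  have hch' : ∀ m, IsChain P c m s' := fun m => (hq' m).chain
  have hmems : ∀ k, (s k).1 ∈ openEdge P (c k) := fun k => (hq (k + 1)).mem (by omega) (by omega)
  have hmems' : ∀ k, (s' k).1 ∈ openEdge P (c k) := fun k =>
    (hq' (k + 1)).mem (by omega) (by omega)
  have hpos : ∀ (q : ℕ → Plane) (j : ℕ), (∀ m, Pass P c m v q) →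
      (∀ k, cross v (q k) = (-1) ^ j * (x + w / 2) + K j) →
      cross (shiftV P c v j) ((unf P c (j + 1)).symm (q j)) = x + w / 2 := by
    intro q j hq hqτ
    rw [(hq (j + 1) j (by omega)).2.symm_left_eq]
    have h1 := cross_unf_symm hP c j 1 v (q j)
    simp only [one_mul] at h1
    rw [hqτ j, add_sub_cancel_right] at h1
    have h2 := congrArg (fun y => (-1 : ℝ) ^ j * y) h1
    simp only [← mul_assoc, neg_one_pow_mul_self, one_mul] at h2
    exact h2
  have hsucc : ∀ j, (unfL P c (j + 1)).symm v = refl P (c j) (shiftV P c v j) := by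
    intro j
    rw [LinearIsometryEquiv.symm_apply_eq, unfL_succ, refl_refl, shiftV,
      LinearIsometryEquiv.apply_symm_apply]
  have hstate : s j = s' l := by
    have e1 := hpos q j hq hqτ
    have e2 := hpos q' l hq' hqτ'
    rw [hdir1] at e1
    rw [hdir2] at e2
    refine Prod.ext ?_ ?_
    · obtain ⟨⟨t, -, ht⟩, -, -, -⟩ := hch (j + 1) j (by omega)
      have hvis := (hq (j + 1) j (by omega)).2
      refine (Vis.eq_of_cross_eq_zero hP hvis.symm.symm (p' := (s' l).1)
        (w := (unfL P c (j + 1)).symm v) (t := t) ?_ ?_ ?_).symm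
      · rw [← hvis.symm_right_eq]; exact ht
      · rw [hedge]; exact openEdge_subset _ _ (hmems' l)
      · have hd : refl P (c j) ((s' l).1 - (s j).1) = (s' l).1 - (s j).1 :=
          refl_edge _ (hedge ▸ openEdge_subset _ _ (hmems' l)) (openEdge_subset _ _ (hmems j))
        change cross ((unfL P c (j + 1)).symm v) ((s' l).1 - (s j).1) = 0
        rw [hsucc, ← hd, cross_refl hP, hdir1, cross_sub_right]
        simp only [hs, hs', e1, e2, sub_self, neg_zero]
    · simp only [hs, hs', hsucc, hdir1, hdir2, hedge]
  -- Determinism backward in time carries the coincidence down to time `0`; thus `c` is periodic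
  -- from its first term on and not just eventually.
  have hback : ∀ i ≤ j, s (j - i) = s' (l - i) ∧ c (j - i) = c (l - i) := by
    intro i hi
    induction i with
    | zero => exact ⟨hstate, hedge⟩
    | succ i ih =>
      obtain ⟨ih1, ih2⟩ := ih (by omega)
      have b1 := hch j (j - (i + 1)) (by omega)
      have b2 := hch' l (l - (i + 1)) (by omega)
      rw [show j - (i + 1) + 1 = j - i by omega] at b1
      rw [show l - (i + 1) + 1 = l - i by omega, ← ih1, ← ih2] at b2
      obtain ⟨e1, e2⟩ := b1.unique_left hP b2 (hmems _) (hmems' _)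
      exact ⟨e2, e1⟩
  have hfwd : ∀ k, c (j + k) = c (l + k) := by
    intro k
    rcases k with _ | k
    · exact hedge
    have c1 : IsChain P (shiftC c j) (k + 1) (fun i => s (j + i)) := fun i hi => hch _ (j + i)
      (Nat.lt_succ_self _)
    have c2 : IsChain P (shiftC c l) (k + 1) (fun i => s' (l + i)) := fun i hi => hch' _ (l + i)
      (Nat.lt_succ_self _)
    exact (c1.eq_of_eq hP c2 hstate (k + 1) le_rfl).2 (by omega)
  refine ⟨l - j, by omega, fun k => ?_⟩
  rcases le_total k j with hk | hk
  · have := (hback (j - k) (by omega)).2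
    rw [show j - (j - k) = k by omega, show l - (j - k) = k + (l - j) by omega] at this
    exact this.symm
  · have := hfwd (k - j)
    rw [show j + (k - j) = k by omega, show l + (k - j) = k + (l - j) by omega] at this
    exact this.symm

/-! ### Trajectories with a common aperiodic code -/

lemma Pass.length_le {c : ℕ → Fin n} {m : ℕ} {v : Plane} {q : ℕ → Plane} (h : Pass P c m v q)
    (hv : ‖v‖ = 1) {D : ℝ}
    (hD : ∀ i j x y, x ∈ P.edgeSet ℝ i → y ∈ P.edgeSet ℝ j → dist x y ≤ D) {k : ℕ} (hk : k ≤ m) :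
    inner ℝ v (q k - q 0) ≤ k * D := by
  induction k with
  | zero => simp
  | succ k ih =>
    obtain ⟨⟨t, ht, e⟩, hvis⟩ := h k (by omega)
    have h3 := hD _ _ _ _ (openEdge_subset _ _ hvis.left) (openEdge_subset _ _ hvis.right)
    rw [AffineIsometryEquiv.dist_map, e, dist_self_add_right, norm_smul, hv, mul_one,
      Real.norm_of_nonneg ht.le] at h3
    have h4 : inner ℝ v (q (k + 1) - q 0) = t + inner ℝ v (q k - q 0) := by
      rw [e, add_sub_right_comm, inner_add_right, inner_smul_right, real_inner_self_eq_norm_sq, hv]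
      ring
    rw [h4]; push_cast
    linarith [ih (by omega)]

section
variable {E : ℕ → Fin n} {m : ℕ → ℕ} {v v' : ℕ → Plane} {q q' : ℕ → ℕ → Plane} {u u' x x' : Plane}

/-- Up to a fixed gate the line has run a bounded length, so the deviation of its direction from `u`
has a vanishing effect there. -/
lemma tendsto_cross_pass (hm : Tendsto m atTop atTop) (h : ∀ i, Pass P E (m i) (v i) (q i))
    (hv : ∀ i, ‖v i‖ = 1) (hvu : Tendsto v atTop (𝓝 u))
    (hq : Tendsto (fun i => q i 0) atTop (𝓝 x)) (k : ℕ) :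
    Tendsto (fun i => cross u (q i k)) atTop (𝓝 (cross u x)) := by
  obtain ⟨D, hD0, hD, -⟩ := exists_diam_bound P
  have h1 : Tendsto (fun i => cross u (q i 0)) atTop (𝓝 (cross u x)) :=
    tendsto_cross tendsto_const_nhds hq
  have h2 : Tendsto (fun i => cross u (q i k) - cross u (q i 0)) atTop (𝓝 0) := by
    have h3 : Tendsto (fun i => k * D * |cross u (v i)|) atTop (𝓝 0) := by
      have : Tendsto (fun i => cross u (v i)) atTop (𝓝 (cross u u)) :=
        tendsto_cross tendsto_const_nhds hvu
      rw [cross_self] at this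
      simpa using this.abs.const_mul (k * D)
    refine squeeze_zero_norm' ?_ h3
    filter_upwards [hm.eventually_ge_atTop k] with i hi
    obtain ⟨e1, -, e3⟩ := (h i).length (hv i) (Nat.zero_le k) hi
    have e4 := (h i).length_le (hv i) hD hi
    rw [e1, cross_add_right, cross_smul_right, add_sub_cancel_left, Real.norm_eq_abs, abs_mul,
      abs_of_nonneg e3]
    exact mul_le_mul_of_nonneg_right e4 (abs_nonneg _)
  simpa using h2.add h1

/-- Limits of trajectories that follow a common code are parallel. -/
lemma limit_dir_eq (hP : IsSimple P) (hm : Tendsto m atTop atTop)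
    (h : ∀ i, Pass P E (m i) (v i) (q i)) (h' : ∀ i, Pass P E (m i) (v' i) (q' i))
    (hv : ∀ i, ‖v i‖ = 1) (hv' : ∀ i, ‖v' i‖ = 1) (hvu : Tendsto v atTop (𝓝 u))
    (hvu' : Tendsto v' atTop (𝓝 u')) : u = u' := by
  obtain ⟨N, hN, C, hC, hpar⟩ := exists_parallel_bound hP
  by_contra hne
  have hd : 0 < ‖u - u'‖ := norm_pos_iff.2 (sub_ne_zero.2 hne)
  obtain ⟨J, hJ⟩ := exists_nat_gt (2 * C / ‖u - u'‖)
  have hlim : Tendsto (fun i => ‖v i - v' i‖) atTop (𝓝 ‖u - u'‖) := (hvu.sub hvu').norm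
  obtain ⟨i, hi1, hi2⟩ := ((hlim.eventually (lt_mem_nhds (half_lt_self hd))).and
    (hm.eventually_ge_atTop (N * (J + 1)))).exists
  have h1 := hpar E (J + 1) _ _ _ _ (Nat.succ_pos J) ((h i).mono hi2) ((h' i).mono hi2) (hv i)
    (hv' i)
  rw [div_lt_iff₀ hd] at hJ
  push_cast at h1
  nlinarith

/-- If the limits were distinct, then at any given gate the two approximating trajectories would
eventually enclose each line strictly between the limits. These lines would form a strip with code
`E`, which is aperiodic. -/
lemma not_limit_cross_lt (hP : IsSimple P) (hE : IsAperiodic E) (hm : Tendsto m atTop atTop)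
    (h : ∀ i, Pass P E (m i) (v i) (q i)) (h' : ∀ i, Pass P E (m i) (v' i) (q' i))
    (hv : ∀ i, ‖v i‖ = 1) (hv' : ∀ i, ‖v' i‖ = 1) (hvu : Tendsto v atTop (𝓝 u))
    (hvu' : Tendsto v' atTop (𝓝 u)) (hq : Tendsto (fun i => q i 0) atTop (𝓝 x))
    (hq' : Tendsto (fun i => q' i 0) atTop (𝓝 x')) : ¬ cross u x < cross u x' := by
  intro hlt
  obtain ⟨D, hD0, hD, -⟩ := exists_diam_bound P
  have hu : ‖u‖ = 1 := by
    refine tendsto_nhds_unique hvu.norm ?_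
    simp_rw [hv]; exact tendsto_const_nhds
  obtain ⟨p, hp, hper⟩ := exists_periodic_of_strip hP (c := E) hu hlt (fun τ hτ k => by
    have t1 := fun k => tendsto_cross_pass hm h hv hvu hq k
    have t2 := fun k => tendsto_cross_pass hm h' hv' hvu' hq' k
    have t3 : ∀ (w : ℕ → Plane), Tendsto w atTop (𝓝 u) → ∀ k,
        ∀ᶠ i in atTop, 0 < cross (w i) (q' i k - q i k) := by
      intro w hw k
      have a1 : Tendsto (fun i => cross u (q' i k - q i k)) atTop (𝓝 (cross u x' - cross u x)) := by
        simp_rw [cross_sub_right]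
        exact (t2 k).sub (t1 k)
      have a2 : Tendsto (fun i => cross (w i - u) (q' i k - q i k)) atTop (𝓝 0) := by
        have a3 : Tendsto (fun i => ‖w i - u‖ * D) atTop (𝓝 0) := by
          simpa using ((hw.sub_const u).norm).mul_const D
        refine squeeze_zero_norm' ?_ a3
        filter_upwards [hm.eventually_ge_atTop (k + 1)] with i hi
        rw [Real.norm_eq_abs]
        refine (abs_cross_le _ _).trans (mul_le_mul_of_nonneg_left ?_ (norm_nonneg _))
        exact (h' i).dist_le (h i) (by omega) hD (by omega)
      have a4 := a2.add a1
      simp_rw [← cross_add_left, sub_add_cancel, zero_add] at a4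
      exact a4.eventually (lt_mem_nhds (by linarith))
    obtain ⟨i, ⟨⟨⟨b1, b2⟩, b3, b4⟩, ⟨b5, b6⟩, b7, b8⟩, b9⟩ :=
      ((((((t1 k).eventually (gt_mem_nhds hτ.1)).and ((t1 (k + 1)).eventually (gt_mem_nhds hτ.1))).and
      (((t2 k).eventually (lt_mem_nhds hτ.2)).and ((t2 (k + 1)).eventually (lt_mem_nhds hτ.2)))).and
      (((t3 v hvu k).and (t3 v hvu (k + 1))).and ((t3 v' hvu' k).and (t3 v' hvu' (k + 1))))).and
      (hm.eventually_ge_atTop (k + 1))).exists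
    have hquad : QuadU P 1 E k (q i k) (q i (k + 1)) (v i) (q' i k) (q' i (k + 1)) (v' i) :=
      ⟨(h i k (by omega)).2, (h' i k (by omega)).2, (h i k (by omega)).1, (h' i k (by omega)).1,
        by linarith, by linarith, by linarith, by linarith⟩
    obtain ⟨y, z, ht, hvis, hτ'⟩ := hquad.between hP (v := u) (τ := τ) (by linarith) (by linarith)
      (by linarith) (by linarith)
    exact ⟨y, z, ht, hvis, by linarith⟩)
  exact hE p hp hper

/-- All trajectories that follow an aperiodic code for a long time are close to one line. -/
lemma limit_line_eq (hP : IsSimple P) (hE : IsAperiodic E) (hm : Tendsto m atTop atTop)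
    (h : ∀ i, Pass P E (m i) (v i) (q i)) (h' : ∀ i, Pass P E (m i) (v' i) (q' i))
    (hv : ∀ i, ‖v i‖ = 1) (hv' : ∀ i, ‖v' i‖ = 1) (hvu : Tendsto v atTop (𝓝 u))
    (hvu' : Tendsto v' atTop (𝓝 u')) (hq : Tendsto (fun i => q i 0) atTop (𝓝 x))
    (hq' : Tendsto (fun i => q' i 0) atTop (𝓝 x')) : u = u' ∧ cross u x = cross u x' := by
  obtain rfl := limit_dir_eq hP hm h h' hv hv' hvu hvu'
  exact ⟨rfl, le_antisymm (not_lt.1 (not_limit_cross_lt hP hE hm h' h hv' hv hvu' hvu hq' hq))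
    (not_lt.1 (not_limit_cross_lt hP hE hm h h' hv hv' hvu hvu' hq hq'))⟩

end

/-! ### Forward trajectories -/

/-- The states `s 0, …, s m` follow each other by bounces at the edges `e 0, …, e (m - 1)`. -/
def Fwd (P : Polygon Plane n) (e : ℕ → Fin n) (m : ℕ) (s : ℕ → Plane × Plane) : Prop :=
  ∀ k < m, Bounce P (e k) (s k) (s (k + 1))

lemma Fwd.mono {e : ℕ → Fin n} {m m' : ℕ} {s : ℕ → Plane × Plane} (h : Fwd P e m s)
    (hm : m' ≤ m) : Fwd P e m' s := fun k hk => h k (hk.trans_le hm)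

lemma Fwd.tail {e : ℕ → Fin n} {m : ℕ} {s : ℕ → Plane × Plane} (h : Fwd P e (m + 1) s) :
    IsChain P e m fun k => s (k + 1) := fun k hk => h (k + 1) (by omega)

lemma Fwd.norm_eq {e : ℕ → Fin n} {m : ℕ} {s : ℕ → Plane × Plane} (h : Fwd P e m s)
    {k : ℕ} (hk : k ≤ m) : ‖(s k).2‖ = ‖(s 0).2‖ := by
  induction k with
  | zero => rfl
  | succ k ih =>
    rw [(h k (by omega)).2.2.2, reflectIn_eq, LinearIsometryEquiv.norm_map, ih (by omega)]

/-- The part of a forward trajectory from the first bounce on, unfolded. -/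
lemma Fwd.pass {e : ℕ → Fin n} {m : ℕ} {s : ℕ → Plane × Plane} (h : Fwd P e (m + 1) s) :
    Pass P e m (s 0).2 fun k => unf P e (k + 1) (s (k + 1)).1 := by
  have h0 := h 0 (Nat.succ_pos m)
  have := h.tail.pass h0.2.2.1
  simp only [h0.2.2.2, reflectIn_eq, refl_refl] at this
  exact this

lemma Fwd.pass_zero {e : ℕ → Fin n} {m : ℕ} {s : ℕ → Plane × Plane} (h : Fwd P e (m + 1) s) :
    unf P e (0 + 1) (s (0 + 1)).1 = (s 1).1 :=
  unf_succ_edge (openEdge_subset _ _ (h 0 (Nat.succ_pos m)).2.2.1)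

/-- Forward trajectories from the same state have the same code. -/
lemma Fwd.eq_of_eq (hP : IsSimple P) {e e' : ℕ → Fin n} {m : ℕ} {s s' : ℕ → Plane × Plane}
    (h : Fwd P e m s) (h' : Fwd P e' m s') (h0 : s 0 = s' 0) :
    (∀ k ≤ m, s k = s' k) ∧ ∀ k < m, e k = e' k := by
  have key : ∀ k ≤ m, s k = s' k := by
    intro k hk
    induction k with
    | zero => exact h0
    | succ k ih =>
      have h2 := h' k (by omega)
      rw [← ih (by omega)] at h2
      exact ((h k (by omega)).unique hP h2).2
  refine ⟨key, fun k hk => ?_⟩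
  have h2 := h' k hk
  rw [← key k hk.le] at h2
  exact ((h k hk).unique hP h2).1

/-- The particle in state `s` moves into the interior of the table. -/
def Enters (P : Polygon Plane n) (s : Plane × Plane) : Prop :=
  ∀ᶠ t : ℝ in 𝓝[>] 0, s.1 + t • s.2 ∈ inside P

lemma isPreconnected_ray (x w : Plane) {S : Set ℝ} (hS : IsPreconnected S) :
    IsPreconnected ((fun t : ℝ => x + t • w) '' S) :=
  hS.image _ (by fun_prop)

lemma Enters.exists_hit {s : Plane × Plane} (h : Enters P s) (hs : ‖s.2‖ = 1) :
    ∃ T : ℝ, 0 < T ∧ openSegment ℝ s.1 (s.1 + T • s.2) ⊆ inside P ∧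
      s.1 + T • s.2 ∈ P.boundary ℝ := by
  obtain ⟨x, w⟩ := s
  simp only [Enters] at h hs ⊢
  obtain ⟨ε, hε0, hε⟩ := (mem_nhdsGT_iff_exists_Ioo_subset).1 h
  rw [mem_Ioi] at hε0
  have hε' : ∀ t : ℝ, 0 < t → t < ε → x + t • w ∈ inside P := fun t h0 h1 => hε ⟨h0, h1⟩
  -- Starting at `ε / 2` keeps the set of hitting times closed while discarding time `0`, when the
  -- particle may be on the boundary.
  set S : Set ℝ := {t | ε / 2 ≤ t ∧ x + t • w ∈ P.boundary ℝ} with hS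
  have hSc : IsClosed S := isClosed_Ici.inter
    ((isCompact_boundary P).isClosed.preimage (by fun_prop : Continuous fun t : ℝ => x + t • w))
  have hbnd : ∀ t ∈ S, ε ≤ t := fun t ht => by
    by_contra! hlt
    exact (hε' t (by linarith [ht.1]) hlt).1 ht.2
  have hmid : x + (ε / 2) • w ∈ inside P := hε' _ (by linarith) (by linarith)
  have hne : S.Nonempty := by
    by_contra hemp
    rw [not_nonempty_iff_eq_empty] at hemp
    have hsub : (fun t : ℝ => x + t • w) '' Ici (ε / 2) ⊆ (P.boundary ℝ)ᶜ := by
      rintro _ ⟨t, ht, rfl⟩ hb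
      have : t ∈ S := ⟨ht, hb⟩
      rw [hemp] at this; exact this
    have h2 := (isPreconnected_ray x w (isPreconnected_Ici (a := ε / 2))).subset_connectedComponentIn
      ⟨ε / 2, mem_Ici.2 le_rfl, rfl⟩ hsub
    obtain ⟨R, hR⟩ := (hmid.2.subset h2).exists_norm_le
    set t := max (ε / 2) (R + ‖x‖ + 1) with ht
    have h3 := hR _ ⟨t, mem_Ici.2 (le_max_left _ _), rfl⟩
    have h4 : ‖t • w‖ - ‖x‖ ≤ ‖x + t • w‖ := by
      have := norm_sub_le (x + t • w) x
      rw [add_sub_cancel_left] at this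
      linarith
    have ht0 : 0 ≤ t := le_trans (by linarith) (le_max_left _ _)
    rw [norm_smul, hs, mul_one, Real.norm_of_nonneg ht0] at h4
    have := le_max_right (ε / 2) (R + ‖x‖ + 1)
    simp only at h3
    linarith
  have hT := hSc.csInf_mem hne ⟨ε, hbnd⟩
  set T := sInf S with hTdef
  have hT0 : ε ≤ T := hbnd T hT
  refine ⟨T, by linarith, ?_, hT.2⟩
  have hseg : openSegment ℝ x (x + T • w) = (fun t : ℝ => x + t • w) '' Ioo 0 T := by
    ext z
    rw [openSegment_eq_image']
    constructor
    · rintro ⟨r, ⟨h0, h1⟩, rfl⟩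
      refine ⟨r * T, ⟨by nlinarith, by nlinarith⟩, ?_⟩
      simp only [add_sub_cancel_left, mul_smul]
    · rintro ⟨t, ⟨h0, h1⟩, rfl⟩
      have hTpos : 0 < T := by linarith
      refine ⟨t / T, ⟨by positivity, (div_lt_one hTpos).2 h1⟩, ?_⟩
      simp only [add_sub_cancel_left, smul_smul, div_mul_cancel₀ _ hTpos.ne']
  rw [hseg]
  refine subset_inside (isPreconnected_ray x w isPreconnected_Ioo) ?_
    ⟨_, ⟨ε / 2, ⟨by linarith, by linarith⟩, rfl⟩, hmid⟩
  rw [disjoint_left]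
  rintro _ ⟨t, ⟨h0, h1⟩, rfl⟩ hb
  rcases lt_or_ge t (ε / 2) with hlt | hge
  · exact (hε' t h0 (by linarith)).1 hb
  · exact absurd (csInf_le ⟨ε, hbnd⟩ (show t ∈ S from ⟨hge, hb⟩)) (not_le.2 h1)

lemma Enters.bounce_or_vertex {s : Plane × Plane} (h : Enters P s) (hs : ‖s.2‖ = 1) :
    (∃ i s', Bounce P i s s') ∨ ∃ T : ℝ, 0 < T ∧ ∃ j, s.1 + T • s.2 = P j := by
  obtain ⟨T, hT, hsub, hb⟩ := h.exists_hit hs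
  obtain ⟨i, hi⟩ := mem_iUnion.1 hb
  rcases mem_openEdge_or_vertex hi with ho | ⟨j, hj⟩
  · exact .inl ⟨i, (s.1 + T • s.2, reflectIn P i s.2), ⟨T, hT, rfl⟩, hsub, ho, rfl⟩
  · exact .inr ⟨T, hT, j, hj⟩

lemma openSegment_add_smul {x w : Plane} {t T : ℝ} (h0 : 0 < t) (h1 : t < T)
    (h : openSegment ℝ x (x + T • w) ⊆ inside P) : x + t • w ∈ inside P :=
  h (mem_openSegment_of_lt h0 h1)

/-- Shortly after the bounce the particle can be joined to its mirror position before the bounce by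
a segment parallel to the edge. That segment misses edge `i` by transversality and the other edges
because the bounce point has positive distance from them. -/
lemma Bounce.enters (hP : IsSimple P) {i : Fin n} {s s' : Plane × Plane} (h : Bounce P i s s') :
    Enters P s' := by
  obtain ⟨⟨T, hT, e⟩, hsub, hi, hv⟩ := h
  obtain ⟨x, w⟩ := s
  obtain ⟨x', w'⟩ := s'
  simp only at e hsub hi hv
  have hne := hP.nondegenerate i
  set d := P (finRotate n i) - P i with hd
  have hw : cross d w ≠ 0 := by
    have := cross_ne_zero_of_openSegment hi (by rw [openSegment_symm]; exact hsub) hne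
    rw [e] at this
    intro h0
    apply this
    have e2 : x - (x + T • w) = (-T) • w := by module
    rw [e2, cross_smul_right, ← hd, h0, mul_zero]
  have hww : ∃ l : ℝ, w + w' = l • d := by
    rw [hv, reflectIn_eq, refl_apply]
    exact ⟨_, by rw [add_sub_cancel]⟩
  obtain ⟨l, hl⟩ := hww
  set U : Set Plane := (⋃ j ∈ {j | j ≠ i}, P.edgeSet ℝ j)ᶜ with hU
  have hUo : IsOpen U := by
    rw [hU, isOpen_compl_iff]
    exact (Set.toFinite _).isClosed_biUnion fun j _ => (isCompact_edgeSet P j).isClosed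
  have hx'U : x' ∈ U := by
    intro hc
    simp only [mem_iUnion, mem_ofPred_eq] at hc
    obtain ⟨j, hj, hm⟩ := hc
    exact hP.notMem_edgeSet (Ne.symm hj) hi hm
  have hcont : Continuous fun z : ℝ × ℝ => x' - z.1 • w + (z.2 * z.1) • (w + w') := by fun_prop
  have hev : ∀ᶠ r : ℝ in 𝓝 0, ∀ y ∈ Icc (0:ℝ) 1, x' - r • w + (y * r) • (w + w') ∈ U := by
    apply isCompact_Icc.eventually_forall_of_forall_eventually
    intro y _
    refine (hcont.tendsto (0, y)).eventually (hUo.mem_nhds ?_)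
    simpa using hx'U
  have hr0 : ∀ᶠ r : ℝ in 𝓝[>] 0, r ∈ Ioo (0:ℝ) T := Ioo_mem_nhdsGT hT
  filter_upwards [hev.filter_mono nhdsWithin_le_nhds, hr0] with r hr1 hr2
  have hconv : IsPreconnected ((fun y : ℝ => (x' - r • w) + (y * r) • (w + w')) '' Icc 0 1) :=
    isPreconnected_Icc.image _ (by fun_prop)
  have hmem : x' + r • w' ∈ (fun y : ℝ => (x' - r • w) + (y * r) • (w + w')) '' Icc 0 1 :=
    ⟨1, ⟨zero_le_one, le_rfl⟩, by simp only; module⟩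
  refine subset_inside hconv ?_ ⟨x' - r • w, ⟨0, ⟨le_rfl, zero_le_one⟩, by simp⟩, ?_⟩ hmem
  · rw [disjoint_left]
    rintro _ ⟨y, hy, rfl⟩ hb
    obtain ⟨j, hj⟩ := mem_iUnion.1 hb
    by_cases hji : j = i
    · subst hji
      have h1 := cross_edge (openEdge_subset _ _ hi) (left_mem_edgeSet P j) hj
      have h2 := cross_edge (openEdge_subset _ _ hi) (right_mem_edgeSet P j) hj
      have h3 : cross d ((x' - r • w) + (y * r) • (w + w') - x') = 0 := by
        rw [hd, ← sub_sub_sub_cancel_right _ _ x', cross_sub_left, h1, h2, sub_zero]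
      rw [hl, add_sub_right_comm, cross_add_right, cross_smul_right, cross_smul_right, cross_self,
        sub_sub_cancel_left, cross_neg_right, cross_smul_right] at h3
      have : r * cross d w = 0 := by linarith
      rcases mul_eq_zero.1 this with h | h
      · exact hr2.1.ne' h
      · exact hw h
    · exact hr1 y hy (by simp only [mem_iUnion, mem_ofPred_eq]; exact ⟨j, hji, hj⟩)
  · rw [e]
    have : x + T • w - r • w = x + (T - r) • w := by module
    rw [this]
    rw [e] at hsub
    exact openSegment_add_smul (by linarith [hr2.2]) (by linarith [hr2.1]) hsub

/-- The particle moves into the table and never meets a vertex. -/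
def Nonsingular (P : Polygon Plane n) (s : Plane × Plane) : Prop :=
  Enters P s ∧ ‖s.2‖ = 1 ∧ ∀ e m st, st 0 = s → Fwd P e m st →
    ∀ T : ℝ, 0 < T → ∀ j, (st m).1 + T • (st m).2 ≠ P j

lemma Nonsingular.exists_next (hP : IsSimple P) {s : Plane × Plane} (h : Nonsingular P s) :
    ∃ i s', Bounce P i s s' ∧ Nonsingular P s' := by
  obtain ⟨h1, h2, h3⟩ := h
  rcases h1.bounce_or_vertex h2 with ⟨i, s', hb⟩ | ⟨T, hT, j, hj⟩
  · refine ⟨i, s', hb, hb.enters hP, ?_, fun e m st h0 hst T hT j => ?_⟩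
    · rw [hb.2.2.2, reflectIn_eq, LinearIsometryEquiv.norm_map, h2]
    · refine h3 (fun k => Nat.casesOn k i e) (m + 1) (fun k => Nat.casesOn k s st) rfl ?_ T hT j
      intro k hk
      rcases k with _ | k
      · simp only [h0]; exact hb
      · exact hst k (by omega)
  · exact absurd hj (h3 (fun _ => j) 0 (fun _ => s) rfl (fun k hk => absurd hk (Nat.not_lt_zero k))
      T hT j)

lemma Nonsingular.exists_fwd (hP : IsSimple P) {s : Plane × Plane} (h : Nonsingular P s) :
    ∃ e st, st 0 = s ∧ ∀ m, Fwd P e m st := by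
  choose i nx hb hn using fun s : {s // Nonsingular P s} => s.2.exists_next hP
  set F : {s // Nonsingular P s} → {s // Nonsingular P s} := fun s => ⟨nx s, hn s⟩ with hF
  refine ⟨fun k => i (F^[k] ⟨s, h⟩), fun k => (F^[k] ⟨s, h⟩).1, rfl, fun m k _ => ?_⟩
  change Bounce P _ (F^[k] ⟨s, h⟩).1 (F^[k + 1] ⟨s, h⟩).1
  rw [Function.iterate_succ_apply']
  exact hb _

/-- The vertices of all copies of the table in all unfoldings. -/
def unfoldedVertices (P : Polygon Plane n) : Set Plane :=
  {x | ∃ e m j, x = unf P e m (P j)}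

/-- Codes are uncountably many, but a copy depends only on finitely many letters. -/
lemma countable_unfoldedVertices (P : Polygon Plane n) : (unfoldedVertices P).Countable := by
  rcases n with _ | n
  · refine Set.Countable.mono ?_ Set.countable_empty
    rintro x ⟨-, -, j, -⟩
    exact j.elim0
  have hsub : unfoldedVertices P ⊆ ⋃ m : ℕ, ⋃ j : Fin (n + 1), range fun f : Fin m → Fin (n + 1) =>
      unf P (fun k => if h : k < m then f ⟨k, h⟩ else 0) m (P j) := by
    rintro x ⟨e, m, j, rfl⟩
    refine mem_iUnion.2 ⟨m, mem_iUnion.2 ⟨j, ⟨fun k => e k, ?_⟩⟩⟩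
    simp only
    rw [(unf_congr (P := P) (k := m) fun i hi => ?_).1]
    simp [hi]
  exact (Set.countable_iUnion fun m => Set.countable_iUnion fun j => Set.countable_range _).mono hsub

lemma Fwd.unf_eq {e : ℕ → Fin n} {m : ℕ} {s : ℕ → Plane × Plane} (h : Fwd P e m s) :
    unfL P e m (s m).2 = (s 0).2 ∧ ∃ T : ℝ, 0 ≤ T ∧ unf P e m (s m).1 = (s 0).1 + T • (s 0).2 := by
  induction m with
  | zero => exact ⟨rfl, 0, le_rfl, by simp⟩
  | succ m ih =>
    obtain ⟨h1, T, hT, h2⟩ := ih (h.mono (Nat.le_succ m))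
    obtain ⟨⟨t, ht, a1⟩, -, a3, a4⟩ := h m (Nat.lt_succ_self m)
    refine ⟨?_, T + t, by positivity, ?_⟩
    · rw [a4, reflectIn_eq, unfL_succ, refl_refl, h1]
    · rw [unf_succ_edge (openEdge_subset _ _ a3), a1, unf_add, map_smul, h1, h2]; module

/-- A trajectory unfolds to a straight ray and its vertices to unfolded vertices. So nonsingularity
is ensured by avoiding a countable set, whatever the code turns out to be. -/
lemma nonsingular_of_forall_notMem {s : Plane × Plane} (h : Enters P s) (hs : ‖s.2‖ = 1)
    (hV : ∀ T : ℝ, 0 < T → s.1 + T • s.2 ∉ unfoldedVertices P) : Nonsingular P s := by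
  refine ⟨h, hs, fun e m st h0 hst T hT j hj => ?_⟩
  obtain ⟨h1, T', hT', h2⟩ := hst.unf_eq
  apply hV (T' + T) (by positivity)
  refine ⟨e, m, j, ?_⟩
  rw [← hj, unf_add, map_smul, h1, h2, h0]; module

/-! ### Bi-infinite trajectories -/

/-- A bi-infinite unit speed trajectory with its code. -/
def BiChain (P : Polygon Plane n) (e : ℤ → Fin n) (s : ℤ → Plane × Plane) : Prop :=
  ∀ k : ℤ, ‖(s k).2‖ = 1 ∧ Bounce P (e (k + 1)) (s k) (s (k + 1))

section
variable {e : ℤ → Fin n} {s : ℤ → Plane × Plane}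

lemma BiChain.mem_openEdge (h : BiChain P e s) (k : ℤ) : (s k).1 ∈ openEdge P (e k) := by
  have := (h (k - 1)).2.2.2.1
  rwa [sub_add_cancel] at this

lemma BiChain.shift (h : BiChain P e s) (a : ℤ) :
    BiChain P (fun k => e (k + a)) fun k => s (k + a) := fun k => by
  have := h (k + a)
  rw [add_right_comm] at this
  exact this

lemma BiChain.reverse (h : BiChain P e s) :
    BiChain P (fun k => e (-k)) fun k => rev P (e (-k)) (s (-k)) := fun k => by
  refine ⟨?_, ?_⟩
  · change ‖-refl P _ (s (-k)).2‖ = 1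
    rw [norm_neg, LinearIsometryEquiv.norm_map, (h _).1]
  · have := (h (-(k + 1))).2
    rw [show -(k + 1) + 1 = -k by ring] at this
    exact this.reverse (h.mem_openEdge _)

lemma BiChain.fwd (h : BiChain P e s) (m : ℕ) :
    Fwd P (fun k : ℕ => e (k + 1)) m fun k : ℕ => s k := fun k _ => (h k).2

end

/-- The bi-infinite sequence with the given two halves. -/
def glueC {α : Type*} (b : α) (E E' : ℕ → α) : ℤ → α
  | Int.ofNat 0 => b
  | Int.ofNat (k + 1) => E k
  | Int.negSucc k => E' k

section
variable {α : Type*} {b : α} {E E' : ℕ → α}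

lemma glueC_zero : glueC b E E' 0 = b := rfl

lemma glueC_pos (k : ℕ) : glueC b E E' (k + 1) = E k := rfl

lemma glueC_neg (k : ℕ) : glueC b E E' (-1 - k) = E' k := by
  rw [show (-1 - k : ℤ) = Int.negSucc k by rw [Int.negSucc_eq]; ring]; rfl

lemma eq_glueC {e : ℤ → α} {k : ℤ} {m : ℕ} (h0 : e 0 = b) (h1 : ∀ k < m, e (k + 1) = E k)
    (h2 : ∀ k < m, e (-1 - k) = E' k) (hk : |k| ≤ m) : e k = glueC b E E' k := by
  rcases k with k | k
  · rcases k with _ | k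
    · exact h0
    · refine h1 k ?_
      rw [abs_of_nonneg (show (0 : ℤ) ≤ Int.ofNat (k + 1) from Int.natCast_nonneg _)] at hk
      exact Int.ofNat_le.1 hk
  · have e1 : Int.negSucc k = -1 - (k : ℤ) := by rw [Int.negSucc_eq]; ring
    rw [e1, abs_of_neg (by omega)] at hk
    rw [e1, glueC_neg]
    exact h2 k (by omega)

end

/-- Two forward trajectories that leave a point of an edge in opposite ways form a bi-infinite
trajectory. -/
lemma glueC_mem {b : Fin n} {E E' : ℕ → Fin n} {f g : ℕ → Plane × Plane}
    (hf : ∀ m, Fwd P E m f) (hg : ∀ m, Fwd P E' m g) (hb : (f 0).1 ∈ openEdge P b)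
    (h0 : g 0 = rev P b (f 0)) (hn : ‖(f 0).2‖ = 1) : glueC b E E' ∈ bounceSpectrum P := by
  have hn' : ‖(g 0).2‖ = 1 := by rw [h0, rev, norm_neg, LinearIsometryEquiv.norm_map, hn]
  refine ⟨fun k => match k with
    | Int.ofNat k => f k
    | Int.negSucc k => rev P (E' k) (g (k + 1)), fun k => ?_⟩
  rcases k with k | k
  · exact ⟨((hf k).norm_eq le_rfl).trans hn, hf (k + 1) k (Nat.lt_succ_self k)⟩
  · refine ⟨?_, ?_⟩
    · change ‖(rev P (E' k) (g (k + 1))).2‖ = 1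
      rw [rev, norm_neg, LinearIsometryEquiv.norm_map, (hg (k + 1)).norm_eq le_rfl, hn']
    · rcases k with _ | k
      · have := (hg 1 0 Nat.one_pos).reverse (j := b) (by rw [h0]; exact hb)
        rw [h0, rev_rev] at this
        exact this
      · exact (hg (k + 2) (k + 1) (Nat.lt_succ_self _)).reverse (hg (k + 1) k (Nat.lt_succ_self k)).2.2.1

/-! ### Words and closures -/

lemma retroWord_mem_iff {A B : Fin n} {E : ℕ → Fin n} {m : ℕ} :
    retroWord A B E m ∈ bounceLanguage P ↔ ∃ e s, BiChain P e s ∧ e (-1) = A ∧ e 0 = B ∧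
      ∀ k < m, e (k + 1) = E k ∧ e (-2 - k) = E k := by
  have hlen : (retroWord A B E m).length = 2 * m + 2 := by simp [retroWord]; ring
  have hget : ∀ (j : ℕ) (hj : j < (retroWord A B E m).length), (retroWord A B E m)[j] =
      if j < m then E (m - 1 - j) else if j = m then A else if j = m + 1 then B
        else E (j - m - 2) := by
    intro j hj
    have h1 := hj
    rw [hlen] at h1
    simp only [retroWord, List.append_assoc, List.getElem_append, List.length_reverse,
      List.length_map, List.length_range, List.getElem_reverse, List.getElem_map,
      List.getElem_range, List.length_cons, List.length_nil]
    split_ifs with a1 a2 a3 a4 a5 a6 <;> try omega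
    · subst a3; simp
    · obtain rfl : j = m + 1 := by omega
      simp
    · congr 1
  constructor
  · rintro ⟨e, ⟨s, hs⟩, a, ha⟩
    have hs' : BiChain P e s := hs
    have key : ∀ j < 2 * m + 2, e (a + j) = if j < m then E (m - 1 - j) else if j = m then A
        else if j = m + 1 then B else E (j - m - 2) := fun j hj => by
      rw [← ha j (by omega), hget]
    -- The word begins at index `a`, which places its letter `B` at `a + m + 1`; the shift moves it
    -- to `0`.
    refine ⟨_, _, hs'.shift (a + m + 1), ?_, ?_, fun k hk => ⟨?_, ?_⟩⟩
    · have := key m (by omega)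
      simp only [lt_irrefl, if_false, if_true] at this
      rw [← this]; congr 1; ring
    · have := key (m + 1) (by omega)
      simp only [add_lt_iff_neg_left, not_lt_zero, if_false, if_true, Nat.succ_ne_self] at this
      rw [← this]; congr 1; push_cast; ring
    · have := key (m + 2 + k) (by omega)
      rw [if_neg (by omega), if_neg (by omega), if_neg (by omega)] at this
      rw [show k = m + 2 + k - m - 2 by omega, ← this]; congr 1; push_cast; omega
    · have := key (m - 1 - k) (by omega)
      rw [if_pos (by omega)] at this
      rw [show E k = E (m - 1 - (m - 1 - k)) by congr 1; omega, ← this]; congr 1; omega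
  · rintro ⟨e, s, hs, hA, hB, hE⟩
    refine ⟨e, ⟨s, hs⟩, -1 - m, fun j hj => ?_⟩
    rw [hget]
    rw [hlen] at hj
    split_ifs with a1 a2 a3
    · rw [← (hE _ (by omega)).2]; congr 1; omega
    · rw [← hA]; congr 1; omega
    · rw [← hB]; congr 1; omega
    · rw [← (hE _ (by omega)).1]; congr 1; omega

lemma mem_closure_pi_discrete {ι α : Type*} [TopologicalSpace α] [DiscreteTopology α]
    {S : Set (ι → α)} {e : ι → α} :
    e ∈ closure S ↔ ∀ F : Finset ι, ∃ e' ∈ S, ∀ k ∈ F, e' k = e k := by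
  rw [mem_closure_iff]
  constructor
  · intro h F
    obtain ⟨e', h1, h2⟩ := h {e' | ∀ k ∈ F, e' k = e k} (by
      have : {e' : ι → α | ∀ k ∈ F, e' k = e k} = (F : Set ι).pi fun k => {e k} := by
        ext; simp [Set.mem_pi]
      rw [this]
      exact isOpen_set_pi F.finite_toSet fun _ _ => isOpen_discrete _) (fun _ _ => rfl)
    exact ⟨e', h2, h1⟩
  · intro h o ho he
    obtain ⟨I, u, hu, hsub⟩ := isOpen_pi_iff.1 ho e he
    obtain ⟨e', h1, h2⟩ := h I
    exact ⟨e', hsub fun k hk => by rw [h2 k hk]; exact (hu k hk).2, h1⟩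

lemma mem_closure_nat {α : Type*} [TopologicalSpace α] [DiscreteTopology α]
    {S : Set (ℕ → α)} {e : ℕ → α} :
    e ∈ closure S ↔ ∀ m : ℕ, ∃ e' ∈ S, ∀ k < m, e' k = e k := by
  rw [mem_closure_pi_discrete]
  constructor
  · intro h m
    obtain ⟨e', h1, h2⟩ := h (Finset.range m)
    exact ⟨e', h1, fun k hk => h2 k (Finset.mem_range.2 hk)⟩
  · intro h F
    obtain ⟨m, hm⟩ := F.exists_nat_subset_range
    obtain ⟨e', h1, h2⟩ := h m
    exact ⟨e', h1, fun k hk => h2 k (Finset.mem_range.1 (hm hk))⟩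

lemma mem_closure_int {α : Type*} [TopologicalSpace α] [DiscreteTopology α]
    {S : Set (ℤ → α)} {e : ℤ → α} :
    e ∈ closure S ↔ ∀ m : ℕ, ∃ e' ∈ S, ∀ k : ℤ, |k| ≤ m → e' k = e k := by
  rw [mem_closure_pi_discrete]
  constructor
  · intro h m
    obtain ⟨e', h1, h2⟩ := h (Finset.Icc (-m) m)
    exact ⟨e', h1, fun k hk => h2 k (Finset.mem_Icc.2 (abs_le.1 hk))⟩
  · intro h F
    obtain ⟨m, hm⟩ : ∃ m : ℕ, ∀ k ∈ F, |k| ≤ m := by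
      refine ⟨F.sup Int.natAbs, fun k hk => ?_⟩
      rw [Int.abs_eq_natAbs]
      exact_mod_cast Finset.le_sup (f := Int.natAbs) hk
    obtain ⟨e', h1, h2⟩ := h m
    exact ⟨e', h1, fun k hk => h2 k (hm k hk)⟩

/-! ### Generic positions -/

/-- Of a family of parallel lines, only countably many meet a given countable set. -/
lemma countable_parallel {V : Set Plane} (hV : V.Countable) (x : Plane) {d u : Plane}
    (h : cross u d ≠ 0) : {t : ℝ | ∃ T : ℝ, x + t • d + T • u ∈ V}.Countable := by
  refine (hV.image fun y => cross u (y - x) / cross u d).mono ?_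
  rintro t ⟨T, hT⟩
  refine ⟨_, hT, ?_⟩
  simp only
  rw [div_eq_iff h, show x + t • d + T • u - x = t • d + T • u by abel, cross_add_smul_self,
    cross_smul_right]

lemma exists_mem_Ioo_notMem {S : Set ℝ} (hS : S.Countable) {a b : ℝ} (hab : a < b) :
    ∃ t ∈ Ioo a b, t ∉ S := by
  obtain ⟨t, h1, h2⟩ := (hS.dense_compl ℝ).exists_mem_open isOpen_Ioo (nonempty_Ioo.2 hab)
  exact ⟨t, h2, h1⟩

/-! ### Continuity of the billiard map -/

lemma eq_smul_of_cross_eq_zero_of_ne {d y : Plane} (hd : d ≠ 0) (h : cross d y = 0) :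
    y = (inner ℝ d y / ‖d‖ ^ 2) • d := by
  have h1 : ‖d‖ ^ 2 ≠ 0 := by positivity
  rw [norm_sq_eq] at h1
  rw [cross] at h
  refine plane_ext ?_ ?_ <;>
  · rw [PiLp.smul_apply, smul_eq_mul, div_mul_eq_mul_div, eq_div_iff (by rwa [norm_sq_eq]),
      norm_sq_eq, inner_eq]
    first | linear_combination d 1 * h | linear_combination -d 1 * h | linear_combination d 0 * h

/-- The state after the bounce at the line of edge `i`. -/
def next (P : Polygon Plane n) (i : Fin n) (s : Plane × Plane) : Plane × Plane :=
  (s.1 + (cross (P (finRotate n i) - P i) (P i - s.1) / cross (P (finRotate n i) - P i) s.2) • s.2,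
    refl P i s.2)

lemma Bounce.cross_ne_zero (hP : IsSimple P) {i : Fin n} {s s' : Plane × Plane}
    (h : Bounce P i s s') : cross (P (finRotate n i) - P i) s.2 ≠ 0 := by
  obtain ⟨⟨T, hT, e⟩, hsub, hi, -⟩ := h
  have := cross_ne_zero_of_openSegment hi (by rw [openSegment_symm]; exact hsub)
    (hP.nondegenerate i)
  rw [e, sub_add_cancel_left, cross_neg_right, cross_smul_right] at this
  exact right_ne_zero_of_mul (neg_ne_zero.1 this)

lemma next_eq {i : Fin n} {x w : Plane} {T : ℝ}
    (h : cross (P (finRotate n i) - P i) w ≠ 0) (hx : x + T • w ∈ P.edgeSet ℝ i) :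
    next P i (x, w) = (x + T • w, refl P i w) := by
  have h1 := cross_edge (left_mem_edgeSet P i) (right_mem_edgeSet P i) hx
  have : cross (P (finRotate n i) - P i) (P i - x) / cross (P (finRotate n i) - P i) w = T := by
    rw [div_eq_iff h]
    rw [cross_sub_right, cross_add_right, cross_smul_right] at h1
    rw [cross_sub_right]; linarith
  simp only [next, this]

lemma continuousAt_next {i : Fin n} {s : Plane × Plane}
    (h : cross (P (finRotate n i) - P i) s.2 ≠ 0) : ContinuousAt (next P i) s := by
  unfold next
  refine ContinuousAt.prodMk ?_ (by fun_prop)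
  have h1 : ContinuousAt (fun s : Plane × Plane =>
      cross (P (finRotate n i) - P i) (P i - s.1) / cross (P (finRotate n i) - P i) s.2) s :=
    ContinuousAt.div
      (Continuous.cross continuous_const (continuous_const.sub continuous_fst)).continuousAt
      (Continuous.cross continuous_const continuous_snd).continuousAt h
  exact continuousAt_fst.add (h1.smul continuousAt_snd)

lemma cross_next (i : Fin n) {s : Plane × Plane}
    (h : cross (P (finRotate n i) - P i) s.2 ≠ 0) :
    cross (P (finRotate n i) - P i) ((next P i s).1 - P i) = 0 := by
  simp only [next]
  rw [cross_sub_right, cross_add_right, cross_smul_right, div_mul_cancel₀ _ h, cross_sub_right]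
  ring

section
variable {ι : Type*} {l : Filter ι} {g : ι → Plane × Plane} {i : Fin n} {s s' : Plane × Plane}

lemma Bounce.tendsto_next (hP : IsSimple P) (h : Bounce P i s s') (hg : Tendsto g l (𝓝 s)) :
    Tendsto (fun a => next P i (g a)) l (𝓝 s') := by
  have hc := h.cross_ne_zero hP
  obtain ⟨⟨T, hT, e⟩, hsub, hi, hv⟩ := h
  have h1 : next P i s = s' := by
    rw [show s = (s.1, s.2) from rfl, next_eq hc (T := T) (by rw [← e]; exact openEdge_subset _ _ hi)]
    exact Prod.ext e.symm hv.symm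
  rw [← h1]
  exact (continuousAt_next hc).tendsto.comp hg

/-- A bounce persists for nearby states, provided that they move away from the edges
containing the initial position. -/
lemma Bounce.eventually (hP : IsSimple P) (h : Bounce P i s s') (hg : Tendsto g l (𝓝 s))
    (havoid : ∀ j, s.1 ∈ P.edgeSet ℝ j → ∀ᶠ a in l, ∀ t : ℝ, 0 < t →
      (g a).1 + t • (g a).2 ∉ P.edgeSet ℝ j) : ∀ᶠ a in l, Bounce P i (g a) (next P i (g a)) := by
  have hnext := h.tendsto_next hP hg
  have hc := h.cross_ne_zero hP
  obtain ⟨⟨T, hT, e⟩, hsub, hi, hv⟩ := h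
  set d := P (finRotate n i) - P i with hd
  have hd0 : d ≠ 0 := sub_ne_zero.2 (hP.nondegenerate i).symm
  have hg2 : Tendsto (fun a => (g a).2) l (𝓝 s.2) := (continuous_snd.tendsto s).comp hg
  have hg1 : Tendsto (fun a => (g a).1) l (𝓝 s.1) := (continuous_fst.tendsto s).comp hg
  have hn1 : Tendsto (fun a => (next P i (g a)).1) l (𝓝 s'.1) :=
    (continuous_fst.tendsto s').comp hnext
  have hcross : ∀ᶠ a in l, cross d (g a).2 ≠ 0 :=
    (tendsto_cross tendsto_const_nhds hg2).eventually_ne hc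
  have hτ : Tendsto (fun a => cross d (P i - (g a).1) / cross d (g a).2) l (𝓝 T) := by
    have h1 : Tendsto (fun a => cross d (P i - (g a).1) / cross d (g a).2) l
        (𝓝 (cross d (P i - s.1) / cross d s.2)) :=
      (tendsto_cross tendsto_const_nhds (tendsto_const_nhds.sub hg1)).div
        (tendsto_cross tendsto_const_nhds hg2) hc
    have h2 := cross_edge (left_mem_edgeSet P i) (right_mem_edgeSet P i) (openEdge_subset _ _ hi)
    rw [e, ← hd, cross_sub_right, cross_add_right, cross_smul_right] at h2
    have h3 : cross d (P i - s.1) / cross d s.2 = T := by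
      rw [div_eq_iff hc, cross_sub_right]; linarith
    rwa [h3] at h1
  have hpos := hτ.eventually (lt_mem_nhds hT)
  have hin : ∀ᶠ a in l, (next P i (g a)).1 ∈ openEdge P i := by
    rw [openEdge, openSegment_eq_image'] at hi
    obtain ⟨r, hr, hre⟩ := hi
    have h1 : Tendsto (fun a => inner ℝ d ((next P i (g a)).1 - P i) / ‖d‖ ^ 2) l (𝓝 r) := by
      have h2 : Tendsto (fun a => inner ℝ d ((next P i (g a)).1 - P i) / ‖d‖ ^ 2) l
        (𝓝 (inner ℝ d (s'.1 - P i) / ‖d‖ ^ 2)) :=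
        (tendsto_const_nhds.inner (hn1.sub_const _)).div_const _
      rw [← hre] at h2
      simp only [add_sub_cancel_left, ← hd, inner_smul_right, real_inner_self_eq_norm_sq] at h2
      rwa [mul_div_cancel_right₀ _ (by positivity)] at h2
    filter_upwards [h1.eventually (isOpen_Ioo.mem_nhds hr), hcross] with a ha hca
    rw [openEdge, openSegment_eq_image']
    refine ⟨_, ha, ?_⟩
    simp only
    rw [← hd, ← eq_smul_of_cross_eq_zero_of_ne hd0 (cross_next i hca), add_sub_cancel]
  have hseg : ∀ᶠ a in l, openSegment ℝ (g a).1 (next P i (g a)).1 ⊆ inside P := by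
    -- Edges through the initial point are avoided by assumption. The end is on the open edge `i`,
    -- hence on no other edge, and the flight meets the line of `i` at no earlier time.
    refine eventually_openSegment_subset_inside hg1 hn1 hsub fun j hj => ?_
    have hpt : ∀ a, ∀ x ∈ openSegment ℝ (g a).1 (next P i (g a)).1,
        0 < cross d (P i - (g a).1) / cross d (g a).2 → ∃ t : ℝ, 0 < t ∧
          t < cross d (P i - (g a).1) / cross d (g a).2 ∧ x = (g a).1 + t • (g a).2 := by
      intro a x hx hp
      rw [openSegment_eq_image'] at hx
      obtain ⟨r, ⟨hr0, hr1⟩, rfl⟩ := hx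
      refine ⟨r * (cross d (P i - (g a).1) / cross d (g a).2), by positivity, by nlinarith, ?_⟩
      simp only [next, ← hd, add_sub_cancel_left, mul_smul]
    rcases hj with hj | hj
    · filter_upwards [havoid j hj, hpos] with a ha hp
      rw [disjoint_left]
      intro x hx hxj
      obtain ⟨t, ht, -, rfl⟩ := hpt a x hx hp
      exact ha t ht hxj
    · obtain rfl := hP.eq_of_mem hi hj
      filter_upwards [hpos, hcross] with a hp hca
      rw [disjoint_left]
      intro x hx hxj
      obtain ⟨t, ht, ht', rfl⟩ := hpt a x hx hp
      have h2 := cross_edge (left_mem_edgeSet P i) (right_mem_edgeSet P i) hxj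
      rw [← hd, add_sub_right_comm, cross_add_right, cross_smul_right, ← neg_sub, cross_neg_right] at h2
      have h3 : cross d (P i - (g a).1) = t * cross d (g a).2 := by linarith
      rw [h3, mul_div_cancel_right₀ _ hca] at ht'
      exact lt_irrefl _ ht'
  filter_upwards [hpos, hin, hseg] with a h1 h2 h3
  exact ⟨⟨_, h1, rfl⟩, h3, h2, rfl⟩

lemma Bounce.eventually_avoid (hP : IsSimple P) (h : Bounce P i s s') (hg : Tendsto g l (𝓝 s'))
    (hi : ∀ᶠ a in l, (g a).1 ∈ openEdge P i) {j : Fin n} (hj : s'.1 ∈ P.edgeSet ℝ j) :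
    ∀ᶠ a in l, ∀ t : ℝ, 0 < t → (g a).1 + t • (g a).2 ∉ P.edgeSet ℝ j := by
  obtain rfl := hP.eq_of_mem h.2.2.1 hj
  have hc : cross (P (finRotate n i) - P i) s'.2 ≠ 0 := by
    have h1 := cross_refl hP i (P (finRotate n i) - P i) s.2
    rw [refl_edge i (right_mem_edgeSet P i) (left_mem_edgeSet P i)] at h1
    rw [h.2.2.2, reflectIn_eq, h1]
    exact neg_ne_zero.2 (h.cross_ne_zero hP)
  have hg2 : Tendsto (fun a => (g a).2) l (𝓝 s'.2) := (continuous_snd.tendsto s').comp hg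
  filter_upwards [hi, (tendsto_cross tendsto_const_nhds hg2).eventually_ne hc] with a ha hca t ht hmem
  have h1 := cross_edge (openEdge_subset _ _ ha) (left_mem_edgeSet P i) hmem
  have h2 := cross_edge (openEdge_subset _ _ ha) (right_mem_edgeSet P i) hmem
  rw [add_sub_cancel_left, cross_smul_right] at h1 h2
  have h3 := sub_eq_zero.2 (h2.trans h1.symm)
  rw [← mul_sub, ← cross_sub_left, sub_sub_sub_cancel_right] at h3
  exact hca ((mul_eq_zero.1 h3).resolve_left ht.ne')

end

/-- The states obtained by bouncing successively at the lines of the edges `E 0, E 1, …`. -/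
def orbit (P : Polygon Plane n) (E : ℕ → Fin n) (s : Plane × Plane) : ℕ → Plane × Plane
  | 0 => s
  | k + 1 => next P (E k) (orbit P E s k)

/-- Later bounces happen in open edges, which nearby trajectories leave transversally. Only the
starting point may be a vertex, so only there is `havoid` assumed. -/
lemma Fwd.eventually (hP : IsSimple P) {E : ℕ → Fin n} {m : ℕ} {f : ℕ → Plane × Plane}
    (h : Fwd P E m f) {ι : Type*} {l : Filter ι} {g : ι → Plane × Plane}
    (hg : Tendsto g l (𝓝 (f 0)))
    (havoid : ∀ j, (f 0).1 ∈ P.edgeSet ℝ j → ∀ᶠ a in l, ∀ t : ℝ, 0 < t →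
      (g a).1 + t • (g a).2 ∉ P.edgeSet ℝ j) : ∀ᶠ a in l, Fwd P E m (orbit P E (g a)) := by
  have key : ∀ k ≤ m, Tendsto (fun a => orbit P E (g a) k) l (𝓝 (f k)) ∧
      ∀ᶠ a in l, Fwd P E k (orbit P E (g a)) := by
    intro k hk
    induction k with
    | zero => exact ⟨hg, Eventually.of_forall fun a k hk => absurd hk (Nat.not_lt_zero k)⟩
    | succ k ih =>
      obtain ⟨h1, h2⟩ := ih (by omega)
      have hb := h k (by omega)
      refine ⟨hb.tendsto_next hP h1, ?_⟩
      have hb' : ∀ᶠ a in l, Bounce P (E k) (orbit P E (g a) k) (next P (E k) (orbit P E (g a) k)) := by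
        refine hb.eventually hP h1 fun j hj => ?_
        rcases k with _ | k
        · exact havoid j hj
        · refine (h k (by omega)).eventually_avoid hP h1 ?_ hj
          filter_upwards [h2] with a ha
          exact (ha k (Nat.lt_succ_self k)).2.2.1
      filter_upwards [h2, hb'] with a ha hba j hj
      rcases Nat.lt_succ_iff_lt_or_eq.1 hj with hj | rfl
      · exact ha j hj
      · exact hba
  exact (key m le_rfl).2

/-! ### Right-angled corners -/

lemma Fwd.congr {e e' : ℕ → Fin n} {m : ℕ} {s : ℕ → Plane × Plane} (h : Fwd P e m s)
    (he : ∀ k < m, e k = e' k) : Fwd P e' m s := fun k hk => he k hk ▸ h k hk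

lemma Bounce.enters_left {i : Fin n} {s s' : Plane × Plane} (h : Bounce P i s s') :
    Enters P s := by
  obtain ⟨⟨T, hT, e⟩, hsub, -⟩ := h
  filter_upwards [Ioo_mem_nhdsGT hT] with t ht
  rw [e] at hsub
  exact openSegment_add_smul ht.1 ht.2 hsub

lemma eq_add_of_orthonormal {a b : Plane} (ha : ‖a‖ = 1) (hb : ‖b‖ = 1) (hab : inner ℝ a b = 0)
    (w : Plane) : w = (inner ℝ a w : ℝ) • a + (inner ℝ b w : ℝ) • b := by
  obtain ⟨d, hd⟩ : ∃ d, d = w - ((inner ℝ a w : ℝ) • a + (inner ℝ b w : ℝ) • b) := ⟨_, rfl⟩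
  have h1 : inner ℝ d a = 0 := by
    rw [hd, inner_sub_left, inner_add_left, real_inner_smul_left, real_inner_smul_left,
      real_inner_self_eq_norm_sq, ha, real_inner_comm, real_inner_comm a b, hab]; ring
  have h2 : inner ℝ d b = 0 := by
    rw [hd, inner_sub_left, inner_add_left, real_inner_smul_left, real_inner_smul_left,
      real_inner_self_eq_norm_sq, hb, real_inner_comm, hab]; ring
  have h3 : inner ℝ d (cross a b • d) = 0 := by
    rw [cross_smul_eq a d b, inner_add_right, inner_smul_right, inner_smul_right, h1, h2]; ring
  have h4 : cross a b ≠ 0 := by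
    intro h0
    have := cross_sq_add_inner_sq a b
    rw [h0, hab, ha, hb] at this
    norm_num at this
  rw [inner_smul_right, real_inner_self_eq_norm_sq] at h3
  have h5 : d = 0 := by
    rcases mul_eq_zero.1 h3 with h | h
    · exact absurd h h4
    · simpa using h
  rw [hd] at h5
  exact sub_eq_zero.1 h5

/-- A vertex `z` of the table with interior angle `π / 2`, between the edges `A` and `B`. -/
structure Corner (P : Polygon Plane n) (A B : Fin n) (z a b : Plane) (LA LB r : ℝ) : Prop where
  ne : A ≠ B
  rayA : EdgeRay P A z a LA
  rayB : EdgeRay P B z b LB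
  orth : inner ℝ a b = 0
  r_pos : 0 < r
  sector : ∀ s t : ℝ, 0 < s → s < r → 0 < t → t < r → z + s • a + t • b ∈ inside P

lemma Corner.symm {A B : Fin n} {z a b : Plane} {LA LB r : ℝ} (h : Corner P A B z a b LA LB r) :
    Corner P B A z b a LB LA r :=
  ⟨h.ne.symm, h.rayB, h.rayA, by rw [real_inner_comm]; exact h.orth, h.r_pos,
    fun s t hs hs' ht ht' => by rw [add_right_comm]; exact h.sector t s ht ht' hs hs'⟩

lemma EdgeRay.mem {i : Fin n} {z e : Plane} {L : ℝ} (h : EdgeRay P i z e L) :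
    z ∈ P.edgeSet ℝ i := (h.mem_edge z).2 ⟨0, le_rfl, h.pos.le, by simp⟩

lemma EdgeRay.inner_eq_zero {i : Fin n} {z e e' : Plane} {L : ℝ} (h : EdgeRay P i z e L)
    (ho : inner ℝ e e' = 0) {x : Plane} (hx : x ∈ P.edgeSet ℝ i) : inner ℝ e' (x - z) = 0 := by
  obtain ⟨r, -, -, rfl⟩ := (h.mem_edge x).1 hx
  rw [add_sub_cancel_left, inner_smul_right, real_inner_comm, ho, mul_zero]

/-- The vector from an endpoint of an edge to the other endpoint. -/
lemma EdgeRay.exists_eq_smul {i : Fin n} {z e y : Plane} {L : ℝ} (h : EdgeRay P i z e L)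
    (hy : y ∈ P.edgeSet ℝ i) (hne : y ≠ z) : ∃ r : ℝ, 0 < r ∧ y - z = r • e := by
  obtain ⟨r, h0, -, rfl⟩ := (h.mem_edge y).1 hy
  refine ⟨r, h0.lt_of_ne ?_, add_sub_cancel_left _ _⟩
  rintro rfl
  simp at hne

lemma exists_ball_disjoint (hP : IsSimple P) {A B : Fin n} (hAB : A ≠ B) {z : Plane}
    (hA : z ∈ P.edgeSet ℝ A) (hB : z ∈ P.edgeSet ℝ B) : ∃ ε : ℝ, 0 < ε ∧
      ∀ x, dist x z < ε → ∀ j, x ∈ P.edgeSet ℝ j → j = A ∨ j = B := by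
  have hcl : IsClosed (⋃ j ∈ {j | j ≠ A ∧ j ≠ B}, P.edgeSet ℝ j) :=
    (Set.toFinite _).isClosed_biUnion fun j _ => (isCompact_edgeSet P j).isClosed
  have hz : z ∈ (⋃ j ∈ {j | j ≠ A ∧ j ≠ B}, P.edgeSet ℝ j)ᶜ := by
    intro hc
    simp only [mem_iUnion, mem_ofPred_eq] at hc
    obtain ⟨j, ⟨h1, h2⟩, hj⟩ := hc
    rcases hP.eq_or_eq_of_mem hAB hA hB hj with h | h
    · exact h1 h
    · exact h2 h
  obtain ⟨ε, hε, hsub⟩ := Metric.isOpen_iff.1 hcl.isOpen_compl z hz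
  refine ⟨ε, hε, fun x hx j hj => ?_⟩
  by_contra! hne
  refine hsub hx ?_
  simp only [mem_iUnion, mem_ofPred_eq]
  exact ⟨j, hne, hj⟩

/-- Near the vertex only the two edges occur, and they miss the open square sector spanned by `a`
and `b`. The sector is therefore inside as soon as it contains an inside point, which the condition
in `interiorAngle` supplies. -/
lemma exists_corner (hP : IsSimple P) {A : Fin n}
    (h : interiorAngle P (finRotate n A) = Real.pi / 2) :
    ∃ z a b LA LB r, Corner P A (finRotate n A) z a b LA LB r := by
  obtain ⟨B, hB⟩ : ∃ B, B = finRotate n A := ⟨_, rfl⟩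
  have hAB : A ≠ B := by rw [hB]; exact (hP.ne_rotate A).symm
  rw [← hB] at h ⊢
  have hsymm : (finRotate n).symm B = A := by rw [hB, Equiv.symm_apply_apply]
  rw [interiorAngle, hsymm] at h
  obtain ⟨a, LA, hrA⟩ := exists_edgeRay hP (i := A) (z := P B) (.inr (by rw [hB]))
  obtain ⟨b, LB, hrB⟩ := exists_edgeRay hP (i := B) (z := P B) (.inl rfl)
  have hneA : P A ≠ P B := by rw [hB]; exact hP.nondegenerate A
  obtain ⟨ρ, hρ, ea⟩ := hrA.exists_eq_smul (left_mem_edgeSet P A) hneA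
  obtain ⟨σ, hσ, eb⟩ := hrB.exists_eq_smul (right_mem_edgeSet P B) (hP.nondegenerate B).symm
  split_ifs at h with hev
  -- In the other branch of `interiorAngle` the angle is at least `π`.
  swap
  · have := EuclideanGeometry.angle_le_pi (P A) (P B) (P (finRotate n B))
    linarith [Real.pi_pos]
  have horth : inner ℝ a b = 0 := by
    rw [EuclideanGeometry.angle, ← InnerProductGeometry.inner_eq_zero_iff_angle_eq_pi_div_two,
      vsub_eq_sub, vsub_eq_sub, ea, eb, inner_smul_right, real_inner_smul_left] at h
    rcases mul_eq_zero.1 h with h | h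
    · exact absurd h hσ.ne'
    · exact (mul_eq_zero.1 h).resolve_left hρ.ne'
  obtain ⟨ε, hε, hball⟩ := exists_ball_disjoint hP hAB hrA.mem hrB.mem
  refine ⟨P B, a, b, LA, LB, ε / 2, hAB, hrA, hrB, horth, by positivity, ?_⟩
  set S : Set Plane := (fun q : ℝ × ℝ => P B + q.1 • a + q.2 • b) '' (Ioo 0 (ε / 2) ×ˢ Ioo 0 (ε / 2))
    with hS
  suffices hsub : S ⊆ inside P from fun s t hs hs' ht ht' =>
    hsub ⟨(s, t), ⟨⟨hs, hs'⟩, ht, ht'⟩, rfl⟩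
  have hpre : IsPreconnected S :=
    (isPreconnected_Ioo.prod isPreconnected_Ioo).image _ (by fun_prop)
  refine subset_inside hpre ?_ ?_
  · rw [disjoint_left]
    rintro _ ⟨⟨s, t⟩, ⟨⟨hs, hs'⟩, ht, ht'⟩, rfl⟩ hb
    simp only at hs hs' ht ht' hb
    obtain ⟨j, hj⟩ := mem_iUnion.1 hb
    have hd : dist (P B + s • a + t • b) (P B) < ε := by
      rw [dist_eq_norm, add_assoc, add_sub_cancel_left]
      refine (norm_add_le _ _).trans_lt ?_
      rw [norm_smul, norm_smul, hrA.norm_eq, hrB.norm_eq, Real.norm_of_nonneg hs.le,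
        Real.norm_of_nonneg ht.le]
      linarith
    rcases hball _ hd j hj with rfl | rfl
    · have := hrA.inner_eq_zero horth hj
      rw [add_assoc, add_sub_cancel_left, inner_add_right, inner_smul_right, inner_smul_right,
        real_inner_comm, horth, real_inner_self_eq_norm_sq, hrB.norm_eq] at this
      linarith
    · have := hrB.inner_eq_zero (by rw [real_inner_comm]; exact horth) hj
      rw [add_assoc, add_sub_cancel_left, inner_add_right, inner_smul_right, inner_smul_right,
        horth, real_inner_self_eq_norm_sq, hrA.norm_eq] at this
      linarith
  · obtain ⟨δ, hδ, hsub⟩ := (mem_nhdsGT_iff_exists_Ioo_subset).1 hev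
    rw [mem_Ioi] at hδ
    set t := min (δ / 2) (min (ε / (4 * ρ)) (ε / (4 * σ))) with ht
    have ht0 : 0 < t := by rw [ht]; positivity
    have h1 : t < δ := (min_le_left _ _).trans_lt (by linarith)
    have h2 : t ≤ ε / (4 * ρ) := (min_le_right _ _).trans (min_le_left _ _)
    have h3 : t ≤ ε / (4 * σ) := (min_le_right _ _).trans (min_le_right _ _)
    rw [le_div_iff₀ (by positivity)] at h2 h3
    have h4 := hsub ⟨ht0, h1⟩
    refine ⟨_, ⟨(t / 2 * ρ, t / 2 * σ), ⟨⟨by positivity, by nlinarith⟩, by positivity, by nlinarith⟩,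
      ?_⟩, h4⟩
    simp only
    have e1 : P A = P B + ρ • a := by rw [← ea]; abel
    have e2 : P (finRotate n B) = P B + σ • b := by rw [← eb]; abel
    rw [AffineMap.lineMap_apply, midpoint_eq_smul_add, e1, e2, vsub_eq_sub, vadd_eq_add,
      invOf_eq_inv]
    module

/-! ### Trajectories from a right-angled corner -/

/-- A forward trajectory without period that starts at a right-angled corner. -/
structure CornerRay (P : Polygon Plane n) (A B : Fin n) (z a b : Plane) (LA LB r : ℝ) (u : Plane)
    (E : ℕ → Fin n) (f : ℕ → Plane × Plane) : Prop where
  corner : Corner P A B z a b LA LB r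
  norm_eq : ‖u‖ = 1
  inner_pos_a : 0 < (inner ℝ a u : ℝ)
  inner_pos_b : 0 < (inner ℝ b u : ℝ)
  aperiodic : IsAperiodic E
  zero : f 0 = (z, u)
  fwd : ∀ m, Fwd P E m f

section
variable {A B : Fin n} {z a b u : Plane} {LA LB r : ℝ} {E : ℕ → Fin n} {f : ℕ → Plane × Plane}

lemma CornerRay.symm (h : CornerRay P A B z a b LA LB r u E f) :
    CornerRay P B A z b a LB LA r u E f :=
  ⟨h.corner.symm, h.norm_eq, h.inner_pos_b, h.inner_pos_a, h.aperiodic, h.zero, h.fwd⟩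

lemma countable_not_isAperiodic : {E : ℕ → Fin n | ¬ IsAperiodic E}.Countable := by
  have hsub : {E : ℕ → Fin n | ¬ IsAperiodic E} ⊆ ⋃ p : ℕ, range fun g : Fin (p + 1) → Fin n =>
      fun k : ℕ => g ⟨k % (p + 1), Nat.mod_lt _ p.succ_pos⟩ := by
    intro E hE
    rw [mem_ofPred_eq, IsAperiodic] at hE
    push Not at hE
    obtain ⟨p, hp, hper⟩ := hE
    obtain ⟨p, rfl⟩ := Nat.exists_eq_succ_of_ne_zero hp.ne'
    refine mem_iUnion.2 ⟨p, fun i => E i, ?_⟩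
    ext1 k
    exact hper.map_mod_nat k
  exact (Set.countable_iUnion fun p => Set.countable_range _).mono hsub

/-- Each unfolded vertex lies on at most one ray from `z`. Rays with the same code are parallel by
`limit_dir_eq`, so each of the countably many periodic codes also excludes at most one direction. -/
lemma Corner.exists_cornerRay (hP : IsSimple P) (h : Corner P A B z a b LA LB r) :
    ∃ u E f, CornerRay P A B z a b LA LB r u E f := by
  set U : ℝ → Plane := fun θ => Real.cos θ • a + Real.sin θ • b with hU
  have hia : ∀ θ, inner ℝ a (U θ) = Real.cos θ := fun θ => by
    simp only [hU]
    rw [inner_add_right, inner_smul_right, inner_smul_right, h.orth, real_inner_self_eq_norm_sq,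
      h.rayA.norm_eq]; ring
  have hib : ∀ θ, inner ℝ b (U θ) = Real.sin θ := fun θ => by
    simp only [hU]
    rw [inner_add_right, inner_smul_right, inner_smul_right, real_inner_comm, h.orth,
      real_inner_self_eq_norm_sq, h.rayB.norm_eq]; ring
  have hn : ∀ θ, ‖U θ‖ = 1 := fun θ => by
    have h1 : ‖U θ‖ ^ 2 = 1 := by
      rw [← real_inner_self_eq_norm_sq]
      nth_rw 1 [hU]
      simp only
      rw [inner_add_left, real_inner_smul_left, real_inner_smul_left, hia, hib]
      nlinarith [Real.sin_sq_add_cos_sq θ]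
    exact (pow_eq_one_iff_of_nonneg (norm_nonneg _) two_ne_zero).1 h1
  have hinj : ∀ θ ∈ Ioo 0 (Real.pi / 2), ∀ θ' ∈ Ioo 0 (Real.pi / 2), U θ = U θ' → θ = θ' := by
    intro θ hθ θ' hθ' he
    have : Real.cos θ = Real.cos θ' := by rw [← hia, he, hia]
    exact Real.injOn_cos ⟨hθ.1.le, by linarith [hθ.2, Real.pi_pos]⟩
      ⟨hθ'.1.le, by linarith [hθ'.2, Real.pi_pos]⟩ this
  have hent : ∀ θ ∈ Ioo 0 (Real.pi / 2), Enters P (z, U θ) := by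
    intro θ hθ
    filter_upwards [Ioo_mem_nhdsGT h.r_pos] with t ht
    have hc := Real.cos_pos_of_mem_Ioo ⟨by linarith [hθ.1, Real.pi_pos], hθ.2⟩
    have hs := Real.sin_pos_of_pos_of_lt_pi hθ.1 (by linarith [hθ.2, Real.pi_pos])
    have := h.sector (t * Real.cos θ) (t * Real.sin θ) (mul_pos ht.1 hc)
      (by nlinarith [Real.cos_le_one θ, ht.1, ht.2]) (mul_pos ht.1 hs)
      (by nlinarith [Real.sin_le_one θ, ht.1, ht.2])
    simp only [hU]
    rwa [smul_add, smul_smul, smul_smul, ← add_assoc]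
  set V1 : Set ℝ := {θ | θ ∈ Ioo 0 (Real.pi / 2) ∧ ∃ T : ℝ, 0 < T ∧
    z + T • U θ ∈ unfoldedVertices P} with hV1
  have hc1 : V1.Countable := by
    have hsub : V1 ⊆ ⋃ y ∈ unfoldedVertices P, {θ | θ ∈ Ioo 0 (Real.pi / 2) ∧ ∃ T : ℝ, 0 < T ∧
        z + T • U θ = y} := by
      rintro θ ⟨h1, T, hT, h2⟩
      simp only [mem_iUnion]
      exact ⟨_, h2, h1, T, hT, rfl⟩
    refine Set.Countable.mono hsub ((countable_unfoldedVertices P).biUnion fun y _ => ?_)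
    refine Set.Subsingleton.countable ?_
    rintro θ ⟨h1, T, hT, h2⟩ θ' ⟨h1', T', hT', h2'⟩
    have e1 : T • U θ = T' • U θ' := add_left_cancel (h2.trans h2'.symm)
    have e2 : T = T' := by
      have := congrArg norm e1
      rwa [norm_smul, norm_smul, hn, hn, mul_one, mul_one, Real.norm_of_nonneg hT.le,
        Real.norm_of_nonneg hT'.le] at this
    subst e2
    exact hinj θ h1 θ' h1' (smul_right_injective _ hT.ne' e1)
  have hex : ∀ θ ∈ Ioo 0 (Real.pi / 2) \ V1, ∃ E f, f 0 = (z, U θ) ∧ ∀ m, Fwd P E m f := by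
    rintro θ ⟨h1, h2⟩
    refine (nonsingular_of_forall_notMem (hent θ h1) (hn θ) fun T hT hmem => ?_).exists_fwd hP
    exact h2 ⟨h1, T, hT, hmem⟩
  have : Nonempty (ℕ → Fin n) := ⟨fun _ => A⟩
  choose! Ec fc h0 hfwd using hex
  set V2 : Set ℝ := (Ioo 0 (Real.pi / 2) \ V1) ∩ Ec ⁻¹' {E | ¬ IsAperiodic E} with hV2
  have hc2 : V2.Countable := by
    have hinjE : InjOn Ec V2 := by
      rintro θ ⟨hθ, -⟩ θ' ⟨hθ', -⟩ he
      refine hinj θ hθ.1 θ' hθ'.1 (limit_dir_eq hP (E := Ec θ) (m := fun i => i) tendsto_id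
        (v := fun _ => U θ) (v' := fun _ => U θ')
        (q := fun _ k => unf P (Ec θ) (k + 1) (fc θ (k + 1)).1)
        (q' := fun _ k => unf P (Ec θ) (k + 1) (fc θ' (k + 1)).1) ?_ ?_ (fun _ => hn θ)
        (fun _ => hn θ') tendsto_const_nhds tendsto_const_nhds)
      · intro i
        have := (hfwd θ hθ (i + 1)).pass
        rwa [h0 θ hθ] at this
      · intro i
        have := (hfwd θ' hθ' (i + 1)).pass
        rwa [h0 θ' hθ', ← he] at this
    refine Set.MapsTo.countable_of_injOn (t := {E : ℕ → Fin n | ¬ IsAperiodic E})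
      (fun θ hθ => hθ.2) hinjE countable_not_isAperiodic
  obtain ⟨θ, hθ, hnot⟩ := exists_mem_Ioo_notMem (hc1.union hc2) (half_pos Real.pi_pos)
  have hθ1 : θ ∈ Ioo 0 (Real.pi / 2) \ V1 := ⟨hθ, fun h => hnot (.inl h)⟩
  refine ⟨U θ, Ec θ, fc θ, h, hn θ, ?_, ?_, ?_, h0 θ hθ1, hfwd θ hθ1⟩
  · rw [hia]
    exact Real.cos_pos_of_mem_Ioo ⟨by linarith [hθ.1, Real.pi_pos], hθ.2⟩
  · rw [hib]
    exact Real.sin_pos_of_pos_of_lt_pi hθ.1 (by linarith [hθ.2, Real.pi_pos])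
  · by_contra hE
    exact hnot (.inr ⟨hθ1, hE⟩)

end

section
variable {A B : Fin n} {z a b u : Plane} {LA LB r : ℝ} {E : ℕ → Fin n} {f : ℕ → Plane × Plane}

/-! ### Trajectories that start near a right-angled corner -/

lemma Corner.inner_refl (h : Corner P A B z a b LA LB r) (w : Plane) :
    inner ℝ a (refl P A w) = inner ℝ a w ∧ inner ℝ b (refl P A w) = -inner ℝ b w := by
  rw [h.rayA.refl_eq, inner_sub_right, inner_sub_right, inner_smul_right, inner_smul_right,
    real_inner_self_eq_norm_sq, h.rayA.norm_eq, h.symm.orth]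
  constructor <;> ring

lemma Corner.ext (h : Corner P A B z a b LA LB r) {w w' : Plane}
    (ha : inner ℝ a w = (inner ℝ a w' : ℝ)) (hb : inner ℝ b w = (inner ℝ b w' : ℝ)) : w = w' := by
  rw [eq_add_of_orthonormal h.rayA.norm_eq h.rayB.norm_eq h.orth w,
    eq_add_of_orthonormal h.rayA.norm_eq h.rayB.norm_eq h.orth w', ha, hb]

/-- The retro-reflection: each of the two reflections negates one coordinate of the orthonormal
frame `a`, `b`. -/
lemma Corner.refl_refl_neg (h : Corner P A B z a b LA LB r) (w : Plane) :
    refl P B (-refl P A w) = w := by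
  have h1 := h.inner_refl w
  have h2 := h.symm.inner_refl (-refl P A w)
  refine h.ext ?_ ?_
  · rw [h2.2, inner_neg_right, h1.1, neg_neg]
  · rw [h2.1, inner_neg_right, h1.2, neg_neg]

/-- From an edge of the corner one leaves in a direction that points into the corner sector
without meeting the two edges again. -/
lemma CornerRay.eventually_avoid (hP : IsSimple P) (h : CornerRay P A B z a b LA LB r u E f)
    {ι : Type*} {l : Filter ι} {g : ι → Plane × Plane} (hg : Tendsto g l (𝓝 (z, u)))
    (hgA : ∀ᶠ i in l, (g i).1 ∈ openEdge P A) (j : Fin n) (hj : z ∈ P.edgeSet ℝ j) :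
    ∀ᶠ i in l, ∀ t : ℝ, 0 < t → (g i).1 + t • (g i).2 ∉ P.edgeSet ℝ j := by
  have hC := h.corner
  have hg2 : Tendsto (fun i => (g i).2) l (𝓝 u) := (continuous_snd.tendsto (z, u)).comp hg
  have ha : ∀ᶠ i in l, 0 < inner ℝ a (g i).2 :=
    (tendsto_const_nhds.inner hg2).eventually (lt_mem_nhds h.inner_pos_a)
  have hb : ∀ᶠ i in l, 0 < inner ℝ b (g i).2 :=
    (tendsto_const_nhds.inner hg2).eventually (lt_mem_nhds h.inner_pos_b)
  filter_upwards [ha, hb, hgA] with i h1 h2 h3 t ht hmem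
  obtain ⟨s, hs, -, e⟩ := (hC.rayA.mem_open _).1 h3
  rw [e] at hmem
  rcases hP.eq_or_eq_of_mem hC.ne hC.rayA.mem hC.rayB.mem hj with rfl | rfl
  · have := hC.rayA.inner_eq_zero hC.orth hmem
    rw [add_assoc, add_sub_cancel_left, inner_add_right, inner_smul_right, inner_smul_right,
      real_inner_comm, hC.orth] at this
    nlinarith
  · have := hC.rayB.inner_eq_zero hC.symm.orth hmem
    rw [add_assoc, add_sub_cancel_left, inner_add_right, inner_smul_right, inner_smul_right,
      real_inner_self_eq_norm_sq, hC.rayA.norm_eq] at this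
    nlinarith

lemma CornerRay.eventually_fwd (hP : IsSimple P) (h : CornerRay P A B z a b LA LB r u E f)
    {ι : Type*} {l : Filter ι} {g : ι → Plane × Plane} (hg : Tendsto g l (𝓝 (z, u)))
    (hgA : ∀ᶠ i in l, (g i).1 ∈ openEdge P A) (m : ℕ) :
    ∀ᶠ i in l, Fwd P E m (orbit P E (g i)) := by
  refine (h.fwd m).eventually hP (by rw [h.zero]; exact hg) fun j hj => ?_
  rw [h.zero] at hj
  exact h.eventually_avoid hP hg hgA j hj

/-- A trajectory that arrives at `A` near the corner, in the direction opposite to `u`, bounces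
next at `B`. -/
lemma CornerRay.eventually_bounce (hP : IsSimple P) (h : CornerRay P A B z a b LA LB r u E f)
    {ι : Type*} {l : Filter ι} {g : ι → Plane × Plane} (hg : Tendsto g l (𝓝 (z, u)))
    (hgA : ∀ᶠ i in l, (g i).1 ∈ openEdge P A) :
    Tendsto (fun i => next P B (rev P A (g i))) l (𝓝 (z, u)) ∧
    ∀ᶠ i in l, Bounce P B (rev P A (g i)) (next P B (rev P A (g i))) := by
  have hC := h.corner
  set d := P (finRotate n B) - P B with hd
  have hd0 : d ≠ 0 := sub_ne_zero.2 (hP.nondegenerate B).symm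
  obtain ⟨κ, hκ⟩ : ∃ κ : ℝ, d = κ • b := by
    obtain ⟨s, -, -, e1⟩ := (hC.rayB.mem_edge _).1 (right_mem_edgeSet P B)
    obtain ⟨s', -, -, e2⟩ := (hC.rayB.mem_edge _).1 (left_mem_edgeSet P B)
    exact ⟨s - s', by rw [hd, e1, e2]; module⟩
  have hκ0 : κ ≠ 0 := by
    rintro rfl
    rw [zero_smul] at hκ
    exact hd0 hκ
  have hba : cross b a ≠ 0 := by
    intro h0
    have := cross_sq_add_inner_sq b a
    rw [h0, hC.symm.orth, hC.rayA.norm_eq, hC.rayB.norm_eq] at this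
    norm_num at this
  have hcr : ∀ w, cross d w = κ * (inner ℝ a w * cross b a) := by
    intro w
    conv_lhs => rw [hκ, eq_add_of_orthonormal hC.rayA.norm_eq hC.rayB.norm_eq hC.orth w]
    rw [cross_smul_left, cross_add_right, cross_smul_right, cross_smul_right, cross_self]
    ring
  have hrev : Tendsto (fun i => rev P A (g i)) l (𝓝 (rev P A (z, u))) := by
    have : Continuous (rev P A) := by unfold rev; fun_prop
    exact (this.tendsto _).comp hg
  have hia : inner ℝ a (-refl P A u) = -(inner ℝ a u : ℝ) := by
    rw [inner_neg_right, (hC.inner_refl u).1]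
  have hcd : cross d (rev P A (z, u)).2 ≠ 0 := by
    change cross d (-refl P A u) ≠ 0
    rw [hcr, hia]
    exact mul_ne_zero hκ0 (mul_ne_zero (neg_ne_zero.2 h.inner_pos_a.ne') hba)
  -- The vertex already lies on `B`, so in the limit the flight to `B` takes time `0` and the limit
  -- state is `(z, u)` again; nearby states follow by continuity.
  have hnz : next P B (rev P A (z, u)) = (z, u) := by
    have := next_eq (i := B) (x := z) (T := 0) hcd (by simpa using hC.rayB.mem)
    change next P B (z, -refl P A u) = _
    rw [zero_smul, add_zero] at this
    exact this.trans (by rw [← hC.refl_refl_neg u]; simp [rev, hC.refl_refl_neg])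
  have hnext : Tendsto (fun i => next P B (rev P A (g i))) l (𝓝 (z, u)) := by
    rw [← hnz]
    exact (continuousAt_next hcd).tendsto.comp hrev
  refine ⟨hnext, ?_⟩
  have hg1 : Tendsto (fun i => (g i).1) l (𝓝 z) := (continuous_fst.tendsto (z, u)).comp hg
  have hg2 : Tendsto (fun i => (g i).2) l (𝓝 u) := (continuous_snd.tendsto (z, u)).comp hg
  have hn1 : Tendsto (fun i => (next P B (rev P A (g i))).1) l (𝓝 z) :=
    (continuous_fst.tendsto (z, u)).comp hnext
  have e1 : ∀ᶠ i in l, 0 < inner ℝ a (g i).2 :=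
    (tendsto_const_nhds.inner hg2).eventually (lt_mem_nhds h.inner_pos_a)
  have e2 : ∀ᶠ i in l, 0 < inner ℝ b (g i).2 :=
    (tendsto_const_nhds.inner hg2).eventually (lt_mem_nhds h.inner_pos_b)
  have hpos : 0 < min r LB := lt_min hC.r_pos hC.rayB.pos
  have e3 : ∀ᶠ i in l, inner ℝ a ((g i).1 - z) < r := by
    have : Tendsto (fun i => inner ℝ a ((g i).1 - z)) l (𝓝 (inner ℝ a (z - z))) :=
      tendsto_const_nhds.inner (hg1.sub_const z)
    rw [sub_self, inner_zero_right] at this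
    exact this.eventually (gt_mem_nhds hC.r_pos)
  have e4 : ∀ᶠ i in l, inner ℝ b ((next P B (rev P A (g i))).1 - z) < min r LB := by
    have : Tendsto (fun i => inner ℝ b ((next P B (rev P A (g i))).1 - z)) l
        (𝓝 (inner ℝ b (z - z))) := tendsto_const_nhds.inner (hn1.sub_const z)
    rw [sub_self, inner_zero_right] at this
    exact this.eventually (gt_mem_nhds hpos)
  filter_upwards [e1, e2, e3, e4, hgA] with i h1 h2 h3 h4 h5
  obtain ⟨p, hp, -, hpe⟩ := (hC.rayA.mem_open _).1 h5
  have hw : inner ℝ a (-refl P A (g i).2) = -(inner ℝ a (g i).2 : ℝ) := by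
    rw [inner_neg_right, (hC.inner_refl _).1]
  have hwb : inner ℝ b (-refl P A (g i).2) = (inner ℝ b (g i).2 : ℝ) := by
    rw [inner_neg_right, (hC.inner_refl _).2, neg_neg]
  -- At time `T` the coordinate along `a` has dropped from `p` to `0`, and the coordinate along `b`
  -- has become `q`.
  obtain ⟨T, hT⟩ : ∃ T, T = p / inner ℝ a (g i).2 := ⟨_, rfl⟩
  have hT0 : 0 < T := by rw [hT]; positivity
  obtain ⟨q, hq⟩ : ∃ q, q = T * inner ℝ b (g i).2 := ⟨_, rfl⟩
  have hq0 : 0 < q := by rw [hq]; positivity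
  have hpos1 : (g i).1 + T • (-refl P A (g i).2) = z + q • b := by
    rw [hpe]
    refine add_left_cancel (a := -z) ?_
    refine hC.ext ?_ ?_
    · rw [show -z + (z + p • a + T • -refl P A (g i).2) = p • a + T • -refl P A (g i).2 by abel,
        neg_add_cancel_left, inner_add_right, inner_smul_right, inner_smul_right, inner_smul_right,
        hw, hC.orth, real_inner_self_eq_norm_sq, hC.rayA.norm_eq, hT]
      field_simp; ring
    · rw [show -z + (z + p • a + T • -refl P A (g i).2) = p • a + T • -refl P A (g i).2 by abel,
        neg_add_cancel_left, inner_add_right, inner_smul_right, inner_smul_right, inner_smul_right,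
        hwb, hC.symm.orth, real_inner_self_eq_norm_sq, hC.rayB.norm_eq, hq]
      ring
  have hcd' : cross d (-refl P A (g i).2) ≠ 0 := by
    rw [hcr, hw]
    exact mul_ne_zero hκ0 (mul_ne_zero (neg_ne_zero.2 h1.ne') hba)
  have hL : cross d ((g i).1 + T • (-refl P A (g i).2) - P B) = 0 := by
    obtain ⟨s', -, -, e2⟩ := (hC.rayB.mem_edge _).1 (left_mem_edgeSet P B)
    rw [hpos1, hcr, e2, add_sub_add_left_eq_sub, ← sub_smul, inner_smul_right, hC.orth]
    ring
  have hne : next P B (rev P A (g i)) = (z + q • b, refl P B (-refl P A (g i).2)) := by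
    have : cross d (P B - (g i).1) / cross d (-refl P A (g i).2) = T := by
      rw [div_eq_iff hcd']
      rw [cross_sub_right, cross_add_right, cross_smul_right] at hL
      rw [cross_sub_right]; linarith
    rw [← hpos1]
    simp only [next, rev, ← hd, this]
  rw [hne] at h4 ⊢
  simp only [add_sub_cancel_left, inner_smul_right, real_inner_self_eq_norm_sq, hC.rayB.norm_eq]
    at h4
  rw [hpe, add_sub_cancel_left, inner_smul_right, real_inner_self_eq_norm_sq, hC.rayA.norm_eq] at h3
  have hqr := h4.trans_le (min_le_left _ _)
  have hqL := h4.trans_le (min_le_right _ _)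
  refine ⟨⟨T, hT0, hpos1.symm⟩, ?_, (hC.rayB.mem_open _).2 ⟨q, hq0, by linarith, rfl⟩, rfl⟩
  change openSegment ℝ (g i).1 (z + q • b) ⊆ _
  rw [hpe, openSegment_eq_image']
  rintro _ ⟨s, ⟨hs0, hs1⟩, rfl⟩
  have := hC.sector ((1 - s) * p) (s * q) (mul_pos (by linarith) hp) (by nlinarith)
    (by positivity) (by nlinarith)
  convert this using 1
  module

lemma Fwd.prepend {H : Fin n} {m : ℕ} {s : ℕ → Plane × Plane} {s₀ : Plane × Plane}
    (h0 : Bounce P H s₀ (s 0)) (h : Fwd P E m s) :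
    Fwd P (prepend H E) (m + 1) (fun k => Nat.casesOn k s₀ s) := by
  intro k hk
  rcases k with _ | k
  · exact h0
  · exact h k (by omega)

/-- Such a trajectory follows the code of the ray after that bounce. -/
lemma CornerRay.eventually_fwd_rev (hP : IsSimple P) (h : CornerRay P A B z a b LA LB r u E f)
    {ι : Type*} {l : Filter ι} {g : ι → Plane × Plane} (hg : Tendsto g l (𝓝 (z, u)))
    (hgA : ∀ᶠ i in l, (g i).1 ∈ openEdge P A) (m : ℕ) :
    ∀ᶠ i in l, ∃ st, st 0 = rev P A (g i) ∧ Fwd P (prepend B E) (m + 1) st := by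
  obtain ⟨h1, h2⟩ := h.eventually_bounce hP hg hgA
  have h3 := h.symm.eventually_fwd hP h1 (h2.mono fun i hi => hi.2.2.1) m
  filter_upwards [h2, h3] with i h4 h5
  exact ⟨_, rfl, h5.prepend h4⟩

/-- A trajectory that follows the code of the ray for a long time starts near the corner. -/
lemma CornerRay.exists_near (hP : IsSimple P) (h : CornerRay P A B z a b LA LB r u E f)
    {U : Set (Plane × Plane)} (hU : U ∈ 𝓝 (z, u)) : ∃ N, ∀ H st, (st 0).1 ∈ openEdge P H →
      ‖(st 0).2‖ = 1 → Fwd P E N st → st 0 ∈ U := by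
  -- Counterexamples that follow `E` for longer and longer have a limit, which by `limit_line_eq` is
  -- on the line of the corner ray. It remains to see that the limit starting point is the corner.
  by_contra! hcon
  choose H st hH hn hF hnot using fun i : ℕ => hcon (i + 2)
  have hC := h.corner
  have hcK : IsCompact (((⋃ j ∈ {j | j ≠ E 0}, P.edgeSet ℝ j) ×ˢ Metric.sphere (0 : Plane) 1) ×ˢ
      P.edgeSet ℝ (E 0)) := by
    refine (IsCompact.prod ?_ (isCompact_sphere _ _)).prod (isCompact_edgeSet P _)
    exact (Set.toFinite _).isCompact_biUnion fun j _ => isCompact_edgeSet P j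
  have hb : ∀ i, Bounce P (E 0) (st i 0) (st i 1) := fun i => hF i 0 (by omega)
  have hne : ∀ i, H i ≠ E 0 := fun i =>
    Vis.edge_ne (p := (st i 0).1) (q := (st i 1).1) ⟨hH i, (hb i).2.2.1, (hb i).2.1⟩
  obtain ⟨⟨⟨x, w⟩, y⟩, ⟨⟨hx, hw⟩, hy⟩, φ, hφ, hlim⟩ := hcK.tendsto_subseq
    (x := fun i => (st i 0, (st i 1).1)) (fun i => ⟨⟨by
      simp only [mem_iUnion]
      exact ⟨H i, hne i, openEdge_subset _ _ (hH i)⟩, by simpa using hn i⟩,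
      openEdge_subset _ _ (hb i).2.2.1⟩)
  simp only at hx hw hy
  have hls : Tendsto (fun i => st (φ i) 0) atTop (𝓝 (x, w)) :=
    (continuous_fst.tendsto ((x, w), y)).comp hlim
  have hly : Tendsto (fun i => (st (φ i) 1).1) atTop (𝓝 y) :=
    (continuous_snd.tendsto ((x, w), y)).comp hlim
  have hlx : Tendsto (fun i => (st (φ i) 0).1) atTop (𝓝 x) :=
    (continuous_fst.tendsto (x, w)).comp hls
  have hlw : Tendsto (fun i => (st (φ i) 0).2) atTop (𝓝 w) :=
    (continuous_snd.tendsto (x, w)).comp hls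
  obtain ⟨hwu, hcr⟩ := limit_line_eq hP h.aperiodic (m := fun i => φ i + 1)
    (tendsto_atTop_mono (fun i => Nat.le_succ _) hφ.tendsto_atTop) (v := fun i => (st (φ i) 0).2)
    (q := fun i k => unf P E (k + 1) (st (φ i) (k + 1)).1) (v' := fun i => u)
    (q' := fun i k => unf P E (k + 1) (f (k + 1)).1) (x := y) (x' := (f 1).1)
    (fun i => (hF (φ i)).pass) (fun i => by
      have := (h.fwd (φ i + 1 + 1)).pass
      rwa [h.zero] at this) (fun i => hn _) (fun i => h.norm_eq) hlw tendsto_const_nhds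
    (by
      refine hly.congr fun i => ?_
      exact (hF (φ i)).pass_zero.symm)
    (by
      refine tendsto_const_nhds.congr fun i => ?_
      exact (h.fwd (1 + 1)).pass_zero.symm)
  obtain rfl := hwu
  have hf := h.fwd 1 0 Nat.one_pos
  have hdu := hf.cross_ne_zero hP
  rw [h.zero] at hf hdu
  obtain ⟨⟨T, hT, hfT⟩, hfsub, hfE, -⟩ := hf
  simp only [zero_add] at hfT hfE hfsub hdu
  have hyf : y = (f 1).1 := by
    have h1 : cross w (y - (f 1).1) = 0 := by rw [cross_sub_right, hcr, sub_self]
    have h2 := eq_smul_of_cross_eq_zero h.norm_eq h1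
    have h3 := cross_edge (openEdge_subset _ _ hfE) (left_mem_edgeSet P (E 0)) hy
    have h4 := cross_edge (openEdge_subset _ _ hfE) (right_mem_edgeSet P (E 0)) hy
    have h5 : cross (P (finRotate n (E 0)) - P (E 0)) (y - (f 1).1) = 0 := by
      rw [← sub_sub_sub_cancel_right _ _ (f 1).1, cross_sub_left, h3, h4, sub_zero]
    rw [h2, cross_smul_right] at h5
    rw [(mul_eq_zero.1 h5).resolve_right hdu, zero_smul] at h2
    exact sub_eq_zero.1 h2
  obtain ⟨T', hT'⟩ : ∃ T', T' = (inner ℝ w (y - x) : ℝ) := ⟨_, rfl⟩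
  obtain ⟨t, ht⟩ : ∃ t : ℕ → ℝ, t = fun i => inner ℝ (st (φ i) 0).2 ((st (φ i) 1).1 - (st (φ i) 0).1) :=
    ⟨_, rfl⟩
  have hti : ∀ i, 0 < t i ∧ (st (φ i) 1).1 = (st (φ i) 0).1 + t i • (st (φ i) 0).2 := by
    intro i
    obtain ⟨⟨s, hs, e⟩, -⟩ := hb (φ i)
    have : t i = s := by
      rw [ht]; simp only
      rw [e, add_sub_cancel_left, inner_smul_right, real_inner_self_eq_norm_sq, hn]; ring
    rw [this]
    exact ⟨hs, e⟩
  have htl : Tendsto t atTop (𝓝 T') := by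
    rw [ht, hT']
    exact hlw.inner (hly.sub hlx)
  have hyx : y = x + T' • w := by
    refine tendsto_nhds_unique hly ?_
    simp_rw [(hti _).2]
    exact hlx.add (htl.smul hlw)
  have hT'0 : 0 ≤ T' := ge_of_tendsto' htl fun i => (hti i).1.le
  obtain ⟨τ, hτ⟩ : ∃ τ, τ = T - T' := ⟨_, rfl⟩
  have hxz : x = z + τ • w := by
    have : x + T' • w = z + T • w := by rw [← hyx, hyf, hfT]
    rw [eq_sub_of_add_eq this, hτ]; module
  have hτ0 : τ = 0 := by
    rcases lt_trichotomy τ 0 with hneg | h0 | hpos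
    -- Starting behind the corner, the trajectories cross the lines of `B` and `A` near `z` at times
    -- `ta` and `tb`, both before the first bounce. The later crossing has a nonnegative coordinate
    -- along its edge, hence is a boundary point in the middle of a flight.
    · exfalso
      have hia : Tendsto (fun i => (inner ℝ a (st (φ i) 0).2 : ℝ)) atTop (𝓝 (inner ℝ a w)) :=
        tendsto_const_nhds.inner hlw
      have hib : Tendsto (fun i => (inner ℝ b (st (φ i) 0).2 : ℝ)) atTop (𝓝 (inner ℝ b w)) :=
        tendsto_const_nhds.inner hlw
      have key : ∀ e : Plane, 0 < (inner ℝ e w : ℝ) →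
          Tendsto (fun i => -(inner ℝ e ((st (φ i) 0).1 - z) : ℝ) / inner ℝ e (st (φ i) 0).2) atTop
          (𝓝 (-τ)) := by
        intro e he
        have h1 : Tendsto (fun i => -(inner ℝ e ((st (φ i) 0).1 - z) : ℝ) / inner ℝ e (st (φ i) 0).2)
          atTop (𝓝 (-(inner ℝ e (x - z) : ℝ) / inner ℝ e w)) :=
          (tendsto_const_nhds.inner (hlx.sub_const z)).neg.div (tendsto_const_nhds.inner hlw) he.ne'
        have h2 : -(inner ℝ e (x - z) : ℝ) / inner ℝ e w = -τ := by
          rw [hxz, add_sub_cancel_left, inner_smul_right]; field_simp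
        rwa [h2] at h1
      have ka := key a h.inner_pos_a
      have kb := key b h.inner_pos_b
      obtain ⟨ta, hta⟩ : ∃ ta : ℕ → ℝ, ta = fun i =>
        -(inner ℝ a ((st (φ i) 0).1 - z) : ℝ) / inner ℝ a (st (φ i) 0).2 := ⟨_, rfl⟩
      obtain ⟨tb, htb⟩ : ∃ tb : ℕ → ℝ, tb = fun i =>
        -(inner ℝ b ((st (φ i) 0).1 - z) : ℝ) / inner ℝ b (st (φ i) 0).2 := ⟨_, rfl⟩
      rw [← hta] at ka
      rw [← htb] at kb
      have hTτ : -τ < T' := by rw [hτ]; linarith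
      have la : Tendsto (fun i => (inner ℝ b ((st (φ i) 0).1 + ta i • (st (φ i) 0).2 - z) : ℝ)) atTop
          (𝓝 (inner ℝ b (x + (-τ) • w - z))) :=
        tendsto_const_nhds.inner ((hlx.add (ka.smul hlw)).sub_const z)
      have lb : Tendsto (fun i => (inner ℝ a ((st (φ i) 0).1 + tb i • (st (φ i) 0).2 - z) : ℝ)) atTop
          (𝓝 (inner ℝ a (x + (-τ) • w - z))) :=
        tendsto_const_nhds.inner ((hlx.add (kb.smul hlw)).sub_const z)
      have hz0 : x + (-τ) • w - z = 0 := by rw [hxz]; module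
      rw [hz0, inner_zero_right] at la lb
      obtain ⟨i, ⟨⟨⟨a1, a2⟩, a3, a4⟩, a5, a6⟩, a7, a8⟩ :=
        (((((ka.eventually (lt_mem_nhds (by linarith : 0 < -τ))).and
        (kb.eventually (lt_mem_nhds (by linarith : 0 < -τ)))).and
        ((ka.eventually_lt htl hTτ).and (kb.eventually_lt htl hTτ))).and
        ((hia.eventually (lt_mem_nhds h.inner_pos_a)).and
        (hib.eventually (lt_mem_nhds h.inner_pos_b)))).and
        ((la.eventually (gt_mem_nhds hC.rayB.pos)).and
        (lb.eventually (gt_mem_nhds hC.rayA.pos)))).exists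
      have hsub : ∀ s : ℝ, 0 < s → s < t i → (st (φ i) 0).1 + s • (st (φ i) 0).2 ∈ inside P := by
        intro s hs hst
        have := (hb (φ i)).2.1
        rw [(hti i).2] at this
        exact openSegment_add_smul hs hst this
      obtain ⟨p, hp⟩ : ∃ p, p = (st (φ i) 0).1 := ⟨_, rfl⟩
      obtain ⟨v, hv⟩ : ∃ v, v = (st (φ i) 0).2 := ⟨_, rfl⟩
      have hta' : ta i * inner ℝ a v = -inner ℝ a (p - z) := by
        rw [hta, hp, hv]; exact div_mul_cancel₀ _ a5.ne'
      have htb' : tb i * inner ℝ b v = -inner ℝ b (p - z) := by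
        rw [htb, hp, hv]; exact div_mul_cancel₀ _ a6.ne'
      rw [← hp, ← hv] at hsub
      rw [← hv] at a5 a6
      rw [← hp, ← hv] at a7 a8
      rcases le_total (tb i) (ta i) with hle | hle
      · refine notMem_inside_of_mem_edgeSet ((hC.rayB.mem_edge _).2 ?_) (hsub _ a1 a3)
        refine ⟨inner ℝ b (p + ta i • v - z), ?_, a7.le, ?_⟩
        · rw [add_sub_right_comm, inner_add_right, inner_smul_right]
          nlinarith
        · refine (sub_eq_iff_eq_add').1 (hC.ext ?_ ?_)
          · rw [inner_smul_right, hC.orth, add_sub_right_comm, inner_add_right, inner_smul_right,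
              hta']; ring
          · rw [inner_smul_right, real_inner_self_eq_norm_sq, hC.rayB.norm_eq]; ring
      · refine notMem_inside_of_mem_edgeSet ((hC.rayA.mem_edge _).2 ?_) (hsub _ a2 a4)
        refine ⟨inner ℝ a (p + tb i • v - z), ?_, a8.le, ?_⟩
        · rw [add_sub_right_comm, inner_add_right, inner_smul_right]
          nlinarith
        · refine (sub_eq_iff_eq_add').1 (hC.ext ?_ ?_)
          · rw [inner_smul_right, real_inner_self_eq_norm_sq, hC.rayA.norm_eq]; ring
          · rw [inner_smul_right, hC.symm.orth, add_sub_right_comm, inner_add_right,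
              inner_smul_right, htb']; ring
    · exact h0
    -- Starting ahead of the corner, the limit point is either inside the table, on the first flight
    -- of the ray, or on `E 0`. But it lies on some edge other than `E 0`.
    · exfalso
      simp only [mem_iUnion] at hx
      obtain ⟨j, hj, hxj⟩ := hx
      rcases hT'0.eq_or_lt with h0 | hlt
      · rw [← h0, zero_smul, add_zero] at hyx
        rw [← hyx, hyf] at hxj
        exact hj (hP.eq_of_mem hfE hxj).symm
      · rw [hfT] at hfsub
        refine notMem_inside_of_mem_edgeSet hxj ?_
        rw [hxz]
        exact openSegment_add_smul hpos (by rw [hτ]; linarith) hfsub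
  rw [hτ0, zero_smul, add_zero] at hxz
  rw [hxz] at hls
  obtain ⟨i, hi⟩ := (hls.eventually hU).exists
  exact hnot _ hi

end

/-! ### Retro-reflection at a right-angled corner -/

section
variable {A B : Fin n} {z a b u : Plane} {LA LB r : ℝ} {E : ℕ → Fin n} {f : ℕ → Plane × Plane}

lemma CornerRay.exists_fwd_rev (hP : IsSimple P) (h : CornerRay P A B z a b LA LB r u E f)
    (m : ℕ) : ∃ N, ∀ st, (st 0).1 ∈ openEdge P A → ‖(st 0).2‖ = 1 → Fwd P E N st →
      ∃ st', st' 0 = rev P A (st 0) ∧ Fwd P (prepend B E) (m + 1) st' := by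
  have h1 := h.eventually_fwd_rev hP (g := id) (l := 𝓝 (z, u) ⊓ 𝓟 {s | s.1 ∈ openEdge P A})
    (tendsto_id.mono_left inf_le_left) (eventually_inf_principal.2 (Eventually.of_forall
      fun s hs => hs)) m
  obtain ⟨N, hN⟩ := h.exists_near hP (eventually_inf_principal.1 h1)
  exact ⟨N, fun st h0 hn hF => hN A st h0 hn hF h0⟩

lemma CornerRay.exists_edge_eq (hP : IsSimple P) (h : CornerRay P A B z a b LA LB r u E f) :
    ∃ N, ∀ H st, (st 0).1 ∈ openEdge P H → ‖(st 0).2‖ = 1 → Fwd P E N st → H = A ∨ H = B := by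
  obtain ⟨ε, hε, hball⟩ := exists_ball_disjoint hP h.corner.ne h.corner.rayA.mem h.corner.rayB.mem
  have hU : {s : Plane × Plane | dist s.1 z < ε} ∈ 𝓝 (z, u) :=
    (continuous_fst.tendsto (z, u)).eventually (Metric.ball_mem_nhds z hε)
  obtain ⟨N, hN⟩ := h.exists_near hP hU
  exact ⟨N, fun H st h0 hn hF => hball _ (hN H st h0 hn hF) H (openEdge_subset _ _ h0)⟩

/-- For `u = x • a + y • b` the points `z + t • x • a` and `z + t • y • b` are joined by a flight of
time `t`, from whose two ends the trajectory leaves in direction `u`. For small `t` both ends follow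
`E` for `m` bounces, and all but countably many `t` avoid vertices. -/
lemma CornerRay.retroWord_mem (hP : IsSimple P) (h : CornerRay P A B z a b LA LB r u E f) (m : ℕ) :
    retroWord A B E m ∈ bounceLanguage P := by
  have hC := h.corner
  have hx := h.inner_pos_a
  have hy := h.inner_pos_b
  obtain ⟨x, hxe⟩ : ∃ x, x = (inner ℝ a u : ℝ) := ⟨_, rfl⟩
  obtain ⟨y, hye⟩ : ∃ y, y = (inner ℝ b u : ℝ) := ⟨_, rfl⟩
  rw [← hxe] at hx
  rw [← hye] at hy
  have hu : u = x • a + y • b := by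
    rw [hxe, hye]; exact eq_add_of_orthonormal hC.rayA.norm_eq hC.rayB.norm_eq hC.orth u
  have hab : cross a b ≠ 0 := by
    intro h0
    have := cross_sq_add_inner_sq a b
    rw [h0, hC.orth, hC.rayA.norm_eq, hC.rayB.norm_eq] at this
    norm_num at this
  have hua : cross u (x • a) ≠ 0 := by
    rw [hu, cross_smul_right, cross_add_left, cross_smul_left, cross_smul_left, cross_self,
      cross_comm b a]
    have := mul_ne_zero hx.ne' (mul_ne_zero hy.ne' hab)
    intro h0; apply this; linear_combination -h0
  have hub : cross u (y • b) ≠ 0 := by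
    rw [hu, cross_smul_right, cross_add_left, cross_smul_left, cross_smul_left, cross_self]
    have := mul_ne_zero hx.ne' (mul_ne_zero hy.ne' hab)
    intro h0; apply this; linear_combination h0
  set gA : ℝ → Plane × Plane := fun t => (z + t • x • a, u) with hgA
  set gB : ℝ → Plane × Plane := fun t => (z + t • y • b, u) with hgB
  have key : ∀ (w : Plane), Tendsto (fun t : ℝ => (z + t • w, u)) (𝓝[>] 0) (𝓝 (z, u)) := by
    intro w
    have : Continuous fun t : ℝ => (z + t • w, u) := by fun_prop
    have := this.tendsto 0
    simp only [zero_smul, add_zero] at this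
    exact this.mono_left nhdsWithin_le_nhds
  have hedge : ∀ (i : Fin n) (e : Plane) (L x : ℝ), EdgeRay P i z e L → 0 < x →
      ∀ᶠ t : ℝ in 𝓝[>] 0, z + t • x • e ∈ openEdge P i := by
    intro i e L x hr hx
    filter_upwards [Ioo_mem_nhdsGT (div_pos hr.pos hx)] with t ht
    refine (hr.mem_open _).2 ⟨t * x, mul_pos ht.1 hx, (lt_div_iff₀ hx).1 ht.2, by rw [mul_smul]⟩
  have hA := hedge A a LA x hC.rayA hx
  have hB := hedge B b LB y hC.rayB hy
  have e1 := h.eventually_fwd hP (g := gA) (key _) hA (m + 1)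
  have e2 := h.symm.eventually_fwd hP (g := gB) (key _) hB (m + 1)
  have e3 := (h.eventually_bounce hP (g := gA) (key _) hA).2
  obtain ⟨δ, hδ, hall⟩ := (mem_nhdsGT_iff_exists_Ioo_subset).1 ((e1.and e2).and (e3.and (hA.and hB)))
  obtain ⟨t, ht, hgen⟩ := exists_mem_Ioo_notMem
    ((countable_parallel (countable_unfoldedVertices P) z hua).union
      (countable_parallel (countable_unfoldedVertices P) z hub)) (mem_Ioi.1 hδ)
  obtain ⟨⟨f1, f2⟩, f3, f4, f5⟩ := hall ht
  have hnext : next P B (rev P A (gA t)) = gB t := by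
    have hb1 := hC.refl_refl_neg u
    have hcd := Bounce.cross_ne_zero hP f3
    have hpos : (gA t).1 + t • (-refl P A u) = (gB t).1 := by
      refine add_left_cancel (a := -z) (hC.ext ?_ ?_)
      · simp only [hgA, hgB]
        rw [show -z + (z + t • x • a + t • -refl P A u) = t • x • a + t • -refl P A u by abel,
          neg_add_cancel_left, inner_add_right, inner_smul_right, inner_smul_right,
          inner_smul_right, inner_smul_right, inner_smul_right, hC.orth, inner_neg_right,
          (hC.inner_refl u).1, ← hxe, real_inner_self_eq_norm_sq, hC.rayA.norm_eq]
        ring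
      · simp only [hgA, hgB]
        rw [show -z + (z + t • x • a + t • -refl P A u) = t • x • a + t • -refl P A u by abel,
          neg_add_cancel_left, inner_add_right, inner_smul_right, inner_smul_right,
          inner_smul_right, inner_smul_right, inner_smul_right, hC.symm.orth, inner_neg_right,
          (hC.inner_refl u).2, ← hye, real_inner_self_eq_norm_sq, hC.rayB.norm_eq]
        ring
    have := next_eq (i := B) (x := (gA t).1) (w := -refl P A u) (T := t) hcd (by
      rw [hpos]; exact openEdge_subset _ _ f5)
    rw [hpos, hb1] at this
    exact this
  rw [hnext] at f3
  have hgenA : Nonsingular P (gA t) := by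
    refine nonsingular_of_forall_notMem (f1 0 (Nat.succ_pos m)).enters_left h.norm_eq
      fun T hT hmem => hgen (.inl ⟨T, hmem⟩)
  have hgenB : Nonsingular P (gB t) := by
    refine nonsingular_of_forall_notMem (f2 0 (Nat.succ_pos m)).enters_left h.norm_eq
      fun T hT hmem => hgen (.inr ⟨T, hmem⟩)
  obtain ⟨EA, sA, hsA, hFA⟩ := hgenA.exists_fwd hP
  obtain ⟨EB, sB, hsB, hFB⟩ := hgenB.exists_fwd hP
  have hEA := ((hFA (m + 1)).eq_of_eq hP f1 hsA).2
  have hEB := ((hFB (m + 1)).eq_of_eq hP f2 hsB).2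
  have hrb := f3.reverse (j := A) f4
  rw [rev_rev] at hrb
  have hmem := glueC_mem (b := B) (E := EB) (E' := prepend A EA) (f := sB)
    (g := fun k => Nat.casesOn k (rev P B (gB t)) sA) hFB
    (fun m => (Fwd.prepend (by rw [hsA]; exact hrb) (hFA m)).mono (Nat.le_succ m))
    (by rw [hsB]; exact f5) (congrArg (rev P B) hsB.symm) (by rw [hsB]; exact h.norm_eq)
  obtain ⟨s, hs⟩ := hmem
  refine retroWord_mem_iff.2 ⟨_, s, hs, ?_, rfl, fun k hk => ⟨?_, ?_⟩⟩
  · exact glueC_neg 0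
  · rw [glueC_pos]; exact hEB k (by omega)
  · rw [show (-2 - k : ℤ) = -1 - (k + 1 : ℕ) by push_cast; ring, glueC_neg]
    exact hEA k (by omega)

/-- A trajectory that approximates `s` leaves `A` with a long piece of `E`, hence near the corner.
Reversed, it bounces at `B` and is sent back along `E`, so the past of `s` is forced. -/
lemma CornerRay.code_neg (hP : IsSimple P) (h : CornerRay P A B z a b LA LB r u E f)
    {s : ℤ → Fin n} (hs : s ∈ closure (bounceSpectrum P)) (hsE : ∀ k : ℕ, s (k + 1) = E k)
    (h0 : s 0 = A) (k : ℕ) : s (-1 - k) = prepend B E k := by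
  obtain ⟨N, hN⟩ := h.exists_fwd_rev hP k
  obtain ⟨e, ⟨st, hst⟩, he⟩ := mem_closure_int.1 hs (N + k + 2)
  have hst : BiChain P e st := hst
  have he0 : e 0 = A := by rw [he 0 (by simp; omega), h0]
  have h1 := (hst.fwd N).congr (e' := E) fun k hk => by
    rw [he _ (by rw [abs_of_nonneg (by omega)]; push_cast; omega), hsE]
  have hm : (st 0).1 ∈ openEdge P A := he0 ▸ hst.mem_openEdge 0
  obtain ⟨st', h2, h3⟩ := hN (fun k : ℕ => st k) hm (hst 0).1 h1
  have h4 := hst.reverse.fwd (k + 1)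
  have h5 := (h4.eq_of_eq hP h3 (by rw [h2]; simp [he0])).2
  rw [← h5 k (Nat.lt_succ_self k), ← he _ (by rw [abs_of_neg (by omega)]; push_cast; omega)]
  congr 1; ring

/-- The half sequence reads `F, A, B, E 0, …`. A trajectory realising a long part of it leaves `B`
near the corner; reversed from there it hits `A` and then `E 0`. The letter before `A` is thus `E
0`, which is `s 1`. -/
lemma CornerRay.false_of_grazing (hP : IsSimple P) (h : CornerRay P A B z a b LA LB r u E f)
    {s : ℤ → Fin n} (hs : s ∈ closure (bounceSpectrum P)) (hsE : ∀ k : ℕ, s (k + 1) = E k)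
    (h0 : s 0 = A) {F : Fin n} (hF1 : s 1 ≠ F)
    (hF : prepend F (fun k : ℕ => s (-(k : ℤ))) ∈ closure (forwardBounceSpectrum P)) : False := by
  obtain ⟨N, hN⟩ := h.symm.exists_fwd_rev hP 1
  have hback := h.code_neg hP hs hsE h0
  obtain ⟨e, ⟨t, -, ht⟩, he⟩ := mem_closure_nat.1 hF (N + 4)
  have eF : e 0 = F := he 0 (by omega)
  have eA : e 1 = A := by rw [he 1 (by omega), ← h0]; rfl
  have eB : e 2 = B := by
    rw [he 2 (by omega)]
    exact hback 0
  have eE : ∀ k < N, e (k + 3) = E k := by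
    intro k hk
    rw [he (k + 3) (by omega)]
    change s (-((k + 2 : ℕ) : ℤ)) = E k
    rw [show -((k + 2 : ℕ) : ℤ) = -1 - ((k + 1 : ℕ) : ℤ) by push_cast; ring, hback]
    rfl
  have hfw : Fwd P E N fun k => t (k + 3) := by
    intro k hk
    have h1 := (ht (k + 3)).2
    rw [eE k hk] at h1
    rwa [add_right_comm] at h1
  have b0 : Bounce P F (t 0) (t 1) := eF ▸ (ht 0).2
  have b1 : Bounce P A (t 1) (t 2) := eA ▸ (ht 1).2
  have b2 : Bounce P B (t 2) (t 3) := eB ▸ (ht 2).2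
  obtain ⟨st', h1, h2⟩ := hN (fun k => t (k + 3)) b2.2.2.1 (ht 3).1 hfw
  have c1 : Bounce P A (st' 0) (st' 1) := h2 0 (by omega)
  have c2 : Bounce P (E 0) (st' 1) (st' 2) := h2 1 (by omega)
  rw [h1] at c1
  have d1 := b2.reverse (j := A) b1.2.2.1
  have d2 := b1.reverse (j := F) b0.2.2.1
  rw [(c1.unique hP d1).2] at c2
  refine hF1 ?_
  rw [← (c2.unique hP d2).1]
  exact hsE 0

/-- Any approximating trajectory starts near the corner, so `s 0` is `A` or `B`. By symmetry of the
corner, the half sequence with `F` is contradictory in both cases. -/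
lemma CornerRay.not_isGrazing (hP : IsSimple P) (h : CornerRay P A B z a b LA LB r u E f) :
    ¬ IsGrazing P E := by
  rintro ⟨s, hs, hsE, F, G, hdisj, hF, -⟩
  have hF1 : s 1 ≠ F := by
    rintro rfl
    have : s 1 ∈ ({s 0, s 1} : Set (Fin n)) ∩ {s 1, G} := by simp
    rw [hdisj] at this
    exact this
  obtain ⟨N, hN⟩ := h.exists_edge_eq hP
  obtain ⟨e, ⟨st, hst⟩, he⟩ := mem_closure_int.1 hs (N + 1)
  have hst : BiChain P e st := hst
  have h1 := (hst.fwd N).congr (e' := E) fun k hk => by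
    rw [he _ (by rw [abs_of_nonneg (by omega)]; push_cast; omega), hsE]
  have he0 : e 0 = s 0 := he 0 (by simp; omega)
  rcases hN (e 0) (fun k : ℕ => st k) (hst.mem_openEdge 0) (hst 0).1 h1 with h2 | h2
  · exact h.false_of_grazing hP hs hsE (he0 ▸ h2) hF1 hF
  · exact h.symm.false_of_grazing hP hs hsE (he0 ▸ h2) hF1 hF

lemma Corner.exists_code (hP : IsSimple P) (h : Corner P A B z a b LA LB r) :
    ∃ E : ℕ → Fin n, IsAperiodic E ∧ ¬ IsGrazing P E ∧
      ∀ m : ℕ, retroWord A B E m ∈ bounceLanguage P := by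
  obtain ⟨u, E, f, hE⟩ := h.exists_cornerRay hP
  exact ⟨E, hE.aperiodic, hE.not_isGrazing hP, hE.retroWord_mem hP⟩

end

lemma exists_code_of_meetAtAngle (hP : IsSimple P) {A B : Fin n}
    (h : MeetAtAngle P A B (Real.pi / 2)) : ∃ E : ℕ → Fin n, IsAperiodic E ∧ ¬ IsGrazing P E ∧
      ∀ m : ℕ, retroWord A B E m ∈ bounceLanguage P := by
  rcases h with ⟨rfl, h⟩ | ⟨rfl, h⟩
  · obtain ⟨z, a, b, LA, LB, r, hC⟩ := exists_corner hP h
    exact hC.exists_code hP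
  · obtain ⟨z, a, b, LA, LB, r, hC⟩ := exists_corner hP h
    exact hC.symm.exists_code hP

/-! ### Limits of retro-reflected trajectories -/

/-- A bi-infinite trajectory through the word `E (m - 1) ⋯ E 0 A B E 0 ⋯ E (m - 1)`. -/
structure RetroChain (P : Polygon Plane n) (A B : Fin n) (E : ℕ → Fin n) (m : ℕ) (e : ℤ → Fin n)
    (s : ℤ → Plane × Plane) : Prop where
  chain : BiChain P e s
  code_A : e (-1) = A
  code_B : e 0 = B
  code_pos : ∀ k < m, e (k + 1) = E k
  code_neg : ∀ k < m, e (-2 - k) = E k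

section
variable {A B : Fin n} {E : ℕ → Fin n} {m : ℕ} {e : ℤ → Fin n} {s : ℤ → Plane × Plane}

lemma RetroChain.symm (h : RetroChain P A B E m e s) :
    RetroChain P B A E m (fun k => e (-(k + 1))) fun k => rev P (e (-(k + 1))) (s (-(k + 1))) where
  chain := h.chain.reverse.shift 1
  code_A := h.code_B
  code_B := h.code_A
  code_pos k hk := by
    rw [← h.code_neg k hk]; congr 1; ring
  code_neg k hk := by
    rw [← h.code_pos k hk]; congr 1; ring

lemma RetroChain.mem_A (h : RetroChain P A B E m e s) : (s (-1)).1 ∈ openEdge P A :=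
  h.code_A ▸ h.chain.mem_openEdge (-1)

lemma RetroChain.mem_B (h : RetroChain P A B E m e s) : (s 0).1 ∈ openEdge P B :=
  h.code_B ▸ h.chain.mem_openEdge 0

lemma RetroChain.bounce (h : RetroChain P A B E m e s) : Bounce P B (s (-1)) (s 0) :=
  by have := (h.chain (-1)).2; rw [neg_add_cancel, h.code_B] at this; exact this

lemma RetroChain.vis (h : RetroChain P A B E m e s) : Vis P A B (s (-1)).1 (s 0).1 :=
  ⟨h.mem_A, h.mem_B, h.bounce.2.1⟩

lemma RetroChain.fwd (h : RetroChain P A B E m e s) : Fwd P E m fun k : ℕ => s k :=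
  (h.chain.fwd m).congr h.code_pos

lemma RetroChain.ne_code (h : RetroChain P A B E m e s) (hm : 0 < m) : B ≠ E 0 := by
  have hb := h.fwd 0 hm
  exact Vis.edge_ne (p := (s 0).1) (q := (s 1).1) ⟨h.mem_B, hb.2.2.1, hb.2.1⟩

end

/-- A convergent sequence of retro-reflected trajectories. -/
structure RetroLimit (P : Polygon Plane n) (A B : Fin n) (E : ℕ → Fin n) (m : ℕ → ℕ)
    (e : ℕ → ℤ → Fin n) (s : ℕ → ℤ → Plane × Plane) (x y u w : Plane) : Prop where
  tendsto_m : Tendsto m atTop atTop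
  chain : ∀ i, RetroChain P A B E (m i) (e i) (s i)
  tendsto_A : Tendsto (fun i => s i (-1)) atTop (𝓝 (x, w))
  tendsto_B : Tendsto (fun i => s i 0) atTop (𝓝 (y, u))
  norm_eq : ‖u‖ = 1
  refl_B : refl P B w = u
  refl_A : refl P A w = -u
  cross_eq : cross u x = cross u y

section
variable {A B : Fin n} {E : ℕ → Fin n} {m : ℕ → ℕ} {e : ℕ → ℤ → Fin n}
  {s : ℕ → ℤ → Plane × Plane} {x y u w : Plane}

lemma continuous_rev (i : Fin n) : Continuous (rev P i) := by unfold rev; fun_prop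

/-- Time reversal exchanges `A` and `B` and negates `w`, but keeps `u`, in which both ends of the
limit leave. -/
lemma RetroLimit.symm (h : RetroLimit P A B E m e s x y u w) :
    RetroLimit P B A E m (fun i k => e i (-(k + 1)))
      (fun i k => rev P (e i (-(k + 1))) (s i (-(k + 1)))) y x u (-w) where
  tendsto_m := h.tendsto_m
  chain i := (h.chain i).symm
  tendsto_A := by
    have h1 := ((continuous_rev (P := P) B).tendsto (y, u)).comp h.tendsto_B
    have h2 : rev P B (y, u) = (y, -w) := by rw [rev, ← h.refl_B, refl_refl]
    rw [h2] at h1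
    refine h1.congr fun i => ?_
    have := (h.chain i).code_B
    simp [this]
  tendsto_B := by
    have h1 := ((continuous_rev (P := P) A).tendsto (x, w)).comp h.tendsto_A
    have h2 : rev P A (x, w) = (x, u) := by rw [rev, h.refl_A, neg_neg]
    rw [h2] at h1
    refine h1.congr fun i => ?_
    have := (h.chain i).code_A
    simp [this]
  norm_eq := h.norm_eq
  refl_B := by rw [map_neg, h.refl_A, neg_neg]
  refl_A := by rw [map_neg, h.refl_B]
  cross_eq := h.cross_eq.symm

lemma tendsto_norm_one {v : ℕ → Plane} {u : Plane} (h : Tendsto v atTop (𝓝 u))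
    (hv : ∀ i, ‖v i‖ = 1) : ‖u‖ = 1 := by
  refine tendsto_nhds_unique h.norm ?_
  simp_rw [hv]; exact tendsto_const_nhds

/-- Forward from `B` and backward from `A` the same aperiodic code is followed, so `limit_line_eq`
identifies the two limit rays. Equality of directions gives `refl_A`, equality of lines gives
`cross_eq`. -/
lemma exists_retroLimit (hP : IsSimple P) (hE : IsAperiodic E)
    (h : ∀ m, retroWord A B E m ∈ bounceLanguage P) :
    ∃ m e s x y u w, RetroLimit P A B E m e s x y u w := by
  simp only [retroWord_mem_iff] at h
  choose e s hs hA hB hpn using h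
  have hR : ∀ i, RetroChain P A B E i (e i) (s i) := fun i =>
    ⟨hs i, hA i, hB i, fun k hk => (hpn i k hk).1, fun k hk => (hpn i k hk).2⟩
  have hcK : IsCompact (((P.boundary ℝ ×ˢ Metric.sphere (0 : Plane) 1) ×ˢ
      (P.boundary ℝ ×ˢ Metric.sphere (0 : Plane) 1)) ×ˢ (P.boundary ℝ ×ˢ P.boundary ℝ)) :=
    (((isCompact_boundary P).prod (isCompact_sphere _ _)).prod
      ((isCompact_boundary P).prod (isCompact_sphere _ _))).prod
      ((isCompact_boundary P).prod (isCompact_boundary P))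
  have hbd : ∀ i k, (s i k).1 ∈ P.boundary ℝ := fun i k =>
    edgeSet_subset_boundary P _ (openEdge_subset _ _ ((hs i).mem_openEdge k))
  have hsp : ∀ i k, (s i k).2 ∈ Metric.sphere (0 : Plane) 1 := fun i k => by
    simpa using (hs i k).1
  -- The points `y'` and `x'` are limits of the bounces at `E 0` after `B` and before `A`: rigidity
  -- speaks of the first gate of `E`.
  obtain ⟨⟨⟨⟨x, w⟩, ⟨y, u⟩⟩, ⟨y', x'⟩⟩, -, φ, hφ, hlim⟩ := hcK.tendsto_subseq
    (x := fun i => ((s (i + 1) (-1), s (i + 1) 0), ((s (i + 1) 1).1, (s (i + 1) (-2)).1)))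
    (fun i => ⟨⟨⟨hbd _ _, hsp _ _⟩, hbd _ _, hsp _ _⟩, hbd _ _, hbd _ _⟩)
  have l1 := (continuous_fst.tendsto _).comp hlim
  have l2 := (continuous_snd.tendsto _).comp hlim
  have lA : Tendsto (fun i => s (φ i + 1) (-1)) atTop (𝓝 (x, w)) := (continuous_fst.tendsto _).comp l1
  have lB : Tendsto (fun i => s (φ i + 1) 0) atTop (𝓝 (y, u)) := (continuous_snd.tendsto _).comp l1
  have ly' : Tendsto (fun i => (s (φ i + 1) 1).1) atTop (𝓝 y') := (continuous_fst.tendsto _).comp l2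
  have lx' : Tendsto (fun i => (s (φ i + 1) (-2)).1) atTop (𝓝 x') := (continuous_snd.tendsto _).comp l2
  have lw : Tendsto (fun i => (s (φ i + 1) (-1)).2) atTop (𝓝 w) := (continuous_snd.tendsto _).comp lA
  have lx : Tendsto (fun i => (s (φ i + 1) (-1)).1) atTop (𝓝 x) := (continuous_fst.tendsto _).comp lA
  have lu : Tendsto (fun i => (s (φ i + 1) 0).2) atTop (𝓝 u) := (continuous_snd.tendsto _).comp lB
  have ly : Tendsto (fun i => (s (φ i + 1) 0).1) atTop (𝓝 y) := (continuous_fst.tendsto _).comp lB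
  have hm : Tendsto φ atTop atTop := hφ.tendsto_atTop
  have hB' : refl P B w = u := by
    refine tendsto_nhds_unique (((refl P B).continuous.tendsto w).comp lw) (lu.congr fun i => ?_)
    exact (hR (φ i + 1)).bounce.2.2.2
  have hn := tendsto_norm_one lu fun i => (hs _ 0).1
  have lv' : Tendsto (fun i => -refl P A (s (φ i + 1) (-1)).2) atTop (𝓝 (-refl P A w)) :=
    (((refl P A).continuous.tendsto w).comp lw).neg
  have hfA : ∀ i, Fwd P E (φ i + 1) fun k : ℕ =>
      rev P (e (φ i + 1) (-(k + 1))) (s (φ i + 1) (-(k + 1))) := fun i => (hR (φ i + 1)).symm.fwd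
  have hfB : ∀ i, Fwd P E (φ i + 1) fun k : ℕ => s (φ i + 1) k := fun i => (hR (φ i + 1)).fwd
  obtain ⟨hu, hc⟩ := limit_line_eq hP hE (m := φ) hm (fun i => (hfB i).pass)
    (fun i => (hfA i).pass) (fun i => (hs _ _).1) (fun i => by
      have := ((hR (φ i + 1)).symm.chain 0).1
      exact this) (u := u) (u' := -refl P A w) (x := y') (x' := x') lu
    (lv'.congr fun i => by simp [rev, hA])
    (ly'.congr fun i => (hfB i).pass_zero.symm)
    (lx'.congr fun i => (hfA i).pass_zero.symm)
  have cy : cross u y' = cross u y := by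
    refine tendsto_nhds_unique (tendsto_cross lu ly') ((tendsto_cross lu ly).congr fun i => ?_)
    obtain ⟨⟨t, -, e1⟩, -⟩ := hfB i 0 (Nat.succ_pos _)
    have e1 : (s (φ i + 1) 1).1 = (s (φ i + 1) 0).1 + t • (s (φ i + 1) 0).2 := e1
    rw [e1, cross_add_smul_self]
  have cx : cross u x' = cross u x := by
    rw [hu]
    refine tendsto_nhds_unique (tendsto_cross lv' lx') ((tendsto_cross lv' lx).congr fun i => ?_)
    obtain ⟨⟨t, -, e1⟩, -⟩ := hfA i 0 (Nat.succ_pos _)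
    have e1 : (s (φ i + 1) (-2)).1 = (s (φ i + 1) (-1)).1 +
      t • -refl P (e (φ i + 1) (-1)) (s (φ i + 1) (-1)).2 := e1
    rw [hA] at e1
    rw [e1, cross_add_smul_self]
  refine ⟨fun i => φ i + 1, fun i => e (φ i + 1), fun i => s (φ i + 1), x, y, u, w,
    tendsto_atTop_mono (fun i => Nat.le_succ _) hm, fun i => hR _, lA, lB, hn, hB', ?_, ?_⟩
  · rw [hu, neg_neg]
  · rw [← cx, ← hc, cy]

/-- The two reflection formulas add up to `w = ⟪a, w⟫ a + ⟪b, w⟫ b`. Inner products with `a` and `b`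
show that either `a` and `b` are orthogonal or both coefficients vanish, and `w` is not zero. -/
lemma RetroLimit.orth (h : RetroLimit P A B E m e s x y u w) {z z' a b : Plane} {LA LB : ℝ}
    (hA : EdgeRay P A z a LA) (hB : EdgeRay P B z' b LB) : inner ℝ a b = 0 := by
  have h1 := h.refl_A
  have h2 := h.refl_B
  rw [hA.refl_eq] at h1
  rw [hB.refl_eq] at h2
  have h3 : w = (inner ℝ a w : ℝ) • a + (inner ℝ b w : ℝ) • b := by
    have : (2 : ℝ) • w = (2 : ℝ) • ((inner ℝ a w : ℝ) • a + (inner ℝ b w : ℝ) • b) := by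
      rw [← sub_eq_zero]
      have h4 := congrArg₂ (· + ·) h1 h2
      simp only [neg_add_cancel] at h4
      rw [← neg_eq_zero, ← h4]; module
    exact smul_right_injective _ (two_ne_zero' ℝ) this
  by_contra hκ
  have h5 := congrArg (fun v => (inner ℝ a v : ℝ)) h3
  have h6 := congrArg (fun v => (inner ℝ b v : ℝ)) h3
  simp only [inner_add_right, inner_smul_right, real_inner_self_eq_norm_sq, hA.norm_eq,
    hB.norm_eq, real_inner_comm a b] at h5 h6
  have h7 : (inner ℝ b w : ℝ) * inner ℝ a b = 0 := by linarith
  have h8 : (inner ℝ a w : ℝ) * inner ℝ a b = 0 := by linarith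
  rw [(mul_eq_zero.1 h7).resolve_right hκ, (mul_eq_zero.1 h8).resolve_right hκ] at h3
  have h9 := h.norm_eq
  rw [← h.refl_B, LinearIsometryEquiv.norm_map, h3] at h9
  simp at h9

end

/-! ### Recognising a right-angled corner -/

/-- Two orthogonal edges with a common endpoint `z`, such that the table contains a segment
between them, form a right angle of the table. -/
lemma meetAtAngle_of_vis (hP : IsSimple P) {A : Fin n} {p q : Plane}
    (h : Vis P A (finRotate n A) p q)
    (horth : ∀ a b LA LB, EdgeRay P A (P (finRotate n A)) a LA →
      EdgeRay P (finRotate n A) (P (finRotate n A)) b LB → inner ℝ a b = 0) :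
    interiorAngle P (finRotate n A) = Real.pi / 2 := by
  obtain ⟨B, hB⟩ : ∃ B, B = finRotate n A := ⟨_, rfl⟩
  rw [← hB] at h horth ⊢
  have hAB := h.edge_ne
  have hsymm : (finRotate n).symm B = A := by rw [hB, Equiv.symm_apply_apply]
  obtain ⟨a, LA, hrA⟩ := exists_edgeRay hP (i := A) (z := P B) (.inr (by rw [hB]))
  obtain ⟨b, LB, hrB⟩ := exists_edgeRay hP (i := B) (z := P B) (.inl rfl)
  have hab := horth a b LA LB hrA hrB
  have hneA : P A ≠ P B := by rw [hB]; exact hP.nondegenerate A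
  obtain ⟨ρ, hρ, ea⟩ := hrA.exists_eq_smul (left_mem_edgeSet P A) hneA
  obtain ⟨σ, hσ, eb⟩ := hrB.exists_eq_smul (right_mem_edgeSet P B) (hP.nondegenerate B).symm
  obtain ⟨α, hα, hαL, hp⟩ := (hrA.mem_open _).1 h.left
  obtain ⟨β, hβ, hβL, hq⟩ := (hrB.mem_open _).1 h.right
  have hba : inner ℝ b a = 0 := by rw [real_inner_comm]; exact hab
  have iA : ∀ s t : ℝ, inner ℝ a (P B + s • a + t • b - P B) = s := fun s t => by
    rw [add_assoc, add_sub_cancel_left, inner_add_right, inner_smul_right, inner_smul_right,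
      real_inner_self_eq_norm_sq, hrA.norm_eq, hab]; ring
  have iB : ∀ s t : ℝ, inner ℝ b (P B + s • a + t • b - P B) = t := fun s t => by
    rw [add_assoc, add_sub_cancel_left, inner_add_right, inner_smul_right, inner_smul_right,
      real_inner_self_eq_norm_sq, hrB.norm_eq, hba]; ring
  have hrep : ∀ x : Plane, x = P B + (inner ℝ a (x - P B) : ℝ) • a + (inner ℝ b (x - P B) : ℝ) • b :=
    fun x => by
      rw [add_assoc, ← eq_add_of_orthonormal hrA.norm_eq hrB.norm_eq hab, add_sub_cancel]
  -- the open triangle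
  set T : Set Plane := {x | 0 < (inner ℝ a (x - P B) : ℝ) ∧ 0 < (inner ℝ b (x - P B) : ℝ) ∧
    β * inner ℝ a (x - P B) + α * inner ℝ b (x - P B) < α * β} with hT
  have cA : Continuous fun x => (inner ℝ a (x - P B) : ℝ) := by fun_prop
  have cB : Continuous fun x => (inner ℝ b (x - P B) : ℝ) := by fun_prop
  have cS : Continuous fun x => β * inner ℝ a (x - P B) + α * inner ℝ b (x - P B) := by fun_prop
  have hTo : IsOpen T := (isOpen_lt continuous_const cA).inter
    ((isOpen_lt continuous_const cB).inter (isOpen_lt cS continuous_const))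
  have hTcl : closure T ⊆ {x | 0 ≤ (inner ℝ a (x - P B) : ℝ) ∧ 0 ≤ (inner ℝ b (x - P B) : ℝ) ∧
      β * inner ℝ a (x - P B) + α * inner ℝ b (x - P B) ≤ α * β} :=
    closure_minimal (fun x hx => ⟨hx.1.le, hx.2.1.le, hx.2.2.le⟩)
      ((isClosed_le continuous_const cA).inter
        ((isClosed_le continuous_const cB).inter (isClosed_le cS continuous_const)))
  have hdA : Disjoint (P.edgeSet ℝ A) T := by
    rw [disjoint_left]
    intro x hx hxT
    exact hxT.2.1.ne' (hrA.inner_eq_zero hab hx)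
  have hdB : Disjoint (P.edgeSet ℝ B) T := by
    rw [disjoint_left]
    intro x hx hxT
    exact hxT.1.ne' (hrB.inner_eq_zero hba hx)
  -- The frontier of the triangle consists of the vertex, pieces of the open edges `A` and `B`, and
  -- the visible segment from `p` to `q`; no third edge meets any of these.
  have hTb : Disjoint T (P.boundary ℝ) := by
    refine disjoint_boundary_of_frontier hTo (fun j => ?_) ⟨A, hdA⟩
    by_cases hjA : j = A
    · exact .inl (hjA ▸ hdA)
    by_cases hjB : j = B
    · exact .inl (hjB ▸ hdB)
    right
    rw [disjoint_left]
    rintro x hxj ⟨hxc, hxT⟩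
    obtain ⟨x1, x2, x3⟩ := hTcl hxc
    have hx := hrep x
    have hz : x ≠ P B := by
      rintro rfl
      rcases hP.eq_or_eq_of_mem hAB hrA.mem hrB.mem hxj with h | h
      · exact hjA h
      · exact hjB h
    rcases x2.eq_or_lt with h0 | hpos2
    · rw [← h0] at hx x3
      have h1 : 0 < (inner ℝ a (x - P B) : ℝ) := x1.lt_of_ne fun h' => hz (by rw [hx, ← h']; simp)
      refine hP.notMem_edgeSet (Ne.symm hjA) ((hrA.mem_open x).2 ⟨_, h1, ?_, ?_⟩) hxj
      · nlinarith
      · rw [zero_smul, add_zero] at hx; exact hx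
    rcases x1.eq_or_lt with h0 | hpos1
    · rw [← h0] at hx x3
      refine hP.notMem_edgeSet (Ne.symm hjB) ((hrB.mem_open x).2 ⟨_, hpos2, ?_, ?_⟩) hxj
      · nlinarith
      · rw [zero_smul, add_zero] at hx; exact hx
    have h2 : β * inner ℝ a (x - P B) + α * inner ℝ b (x - P B) = α * β := by
      by_contra hne
      exact hxT ⟨hpos1, hpos2, x3.lt_of_ne hne⟩
    refine notMem_inside_of_mem_edgeSet hxj (h.sub ?_)
    rw [openSegment_eq_image']
    obtain ⟨ν, hν⟩ : ∃ ν, ν = inner ℝ b (x - P B) / β := ⟨_, rfl⟩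
    have e2 : (inner ℝ b (x - P B) : ℝ) = ν * β := by rw [hν]; field_simp
    rw [e2] at hpos2 h2 hx
    have hν0 : 0 < ν := pos_of_mul_pos_left hpos2 hβ.le
    have e1 : (inner ℝ a (x - P B) : ℝ) = α - α * ν := by
      refine mul_left_cancel₀ hβ.ne' ?_
      linarith
    rw [e1] at hx hpos1
    refine ⟨ν, ⟨hν0, by nlinarith⟩, ?_⟩
    simp only
    rw [hp, hq, hx]
    module
  have hmid : P B + (α / 2) • a + (β / 2) • b ∈ inside P := by
    refine h.sub ?_
    rw [openSegment_eq_image']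
    exact ⟨1 / 2, by norm_num, by rw [hp, hq]; module⟩
  have hTin : ∀ ρ' σ' : ℝ, 0 < ρ' → 0 < σ' → β * ρ' + α * σ' < α * β →
      P B + ρ' • a + σ' • b ∈ inside P := by
    have hconv : Convex ℝ T := by
      intro x hx y hy s t hs ht hst
      have e : s • x + t • y - P B = s • (x - P B) + t • (y - P B) := by
        have : P B = (s + t) • P B := by rw [hst, one_smul]
        conv_lhs => rw [this]
        module
      obtain ⟨x1, x2, x3⟩ := hx
      obtain ⟨y1, y2, y3⟩ := hy
      simp only [hT, mem_ofPred_eq, e, inner_add_right, inner_smul_right]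
      rcases hs.eq_or_lt with rfl | hs
      · rw [zero_add] at hst; subst hst
        refine ⟨by linarith, by linarith, by linarith⟩
      · refine ⟨by positivity, by positivity, ?_⟩
        have h1 := mul_lt_mul_of_pos_left x3 hs
        have h2 := mul_le_mul_of_nonneg_left y3.le ht
        have h3 : s * (α * β) + t * (α * β) = α * β := by rw [← add_mul, hst, one_mul]
        linarith
    have hne : (T ∩ inside P).Nonempty := by
      have hc : Tendsto (fun t : ℝ => P B + (t * (α / 2)) • a + (t * (β / 2)) • b) (𝓝[<] 1)
          (𝓝 (P B + (1 * (α / 2)) • a + (1 * (β / 2)) • b)) := by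
        have : Continuous fun t : ℝ => P B + (t * (α / 2)) • a + (t * (β / 2)) • b := by fun_prop
        exact (this.tendsto 1).mono_left nhdsWithin_le_nhds
      rw [one_mul, one_mul] at hc
      obtain ⟨t, h1, h2⟩ := ((hc.eventually ((isOpen_inside P).mem_nhds hmid)).and
        (Ioo_mem_nhdsLT (zero_lt_one' ℝ))).exists
      refine ⟨_, ?_, h1⟩
      have h3 := h2.1
      simp only [hT, mem_ofPred_eq, iA, iB]
      refine ⟨by positivity, by positivity, ?_⟩
      have : 0 < α * β := by positivity
      nlinarith [h2.2]
    intro ρ' σ' h1 h2 h3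
    refine subset_inside hconv.isPreconnected hTb hne ?_
    simp only [hT, mem_ofPred_eq, iA, iB]
    exact ⟨h1, h2, h3⟩
  rw [interiorAngle, hsymm, if_pos]
  · rw [EuclideanGeometry.angle, ← InnerProductGeometry.inner_eq_zero_iff_angle_eq_pi_div_two,
      vsub_eq_sub, vsub_eq_sub, ea, eb, inner_smul_right, real_inner_smul_left, hab]
    ring
  · have h0 : 0 < α * β / (β * ρ + α * σ) := by positivity
    filter_upwards [Ioo_mem_nhdsGT h0] with t ht
    have ht2 := (lt_div_iff₀ (by positivity)).1 ht.2
    have ht1 := ht.1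
    have := hTin (t / 2 * ρ) (t / 2 * σ) (by positivity) (by positivity) (by
      have : 0 < α * β := by positivity
      nlinarith)
    convert this using 1
    have e1 : P A = P B + ρ • a := by rw [← ea]; abel
    have e2 : P (finRotate n B) = P B + σ • b := by rw [← eb]; abel
    rw [AffineMap.lineMap_apply, midpoint_eq_smul_add, e1, e2, vsub_eq_sub, vadd_eq_add,
      invOf_eq_inv]
    module

section
variable {A B : Fin n} {E : ℕ → Fin n} {m : ℕ → ℕ} {e : ℕ → ℤ → Fin n}
  {s : ℕ → ℤ → Plane × Plane} {x y u w : Plane}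

lemma RetroLimit.meetAtAngle (hP : IsSimple P) (h : RetroLimit P A B E m e s x y u w)
    (hAB : ¬ Disjoint (P.edgeSet ℝ A) (P.edgeSet ℝ B)) : MeetAtAngle P A B (Real.pi / 2) := by
  have hv := (h.chain 0).vis
  obtain ⟨z, hzA, hzB⟩ := not_disjoint_iff.1 hAB
  rcases hP.eq_vertex hv.edge_ne hzA hzB with ⟨rfl, -⟩ | ⟨rfl, -⟩
  · exact .inl ⟨rfl, meetAtAngle_of_vis hP hv fun a b LA LB hA hB => h.orth hA hB⟩
  · exact .inr ⟨rfl, meetAtAngle_of_vis hP hv.symm fun a b LA LB hA hB => h.symm.orth hA hB⟩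

/-! ### Disjoint edges -/

lemma cross_eq_of_unit {w : Plane} (hw : ‖w‖ = 1) (v d : Plane) :
    cross v d = (inner ℝ w v : ℝ) * cross w d - cross w v * inner ℝ w d := by
  have h1 := norm_sq_eq w
  rw [hw] at h1
  simp only [cross, inner_eq]
  linear_combination (v 0 * d 1 - v 1 * d 0) * h1

lemma eq_zero_of_cross_of_inner {w d : Plane} (hw : ‖w‖ = 1) (h : cross w d = 0)
    (h' : inner ℝ w d = 0) : d = 0 := by
  rw [eq_smul_of_cross_eq_zero hw h, h', zero_smul]

lemma exists_pass_of_lineStep_lt (hP : IsSimple P) {c : ℕ → Fin n} {v : Plane} {τ : ℝ} {m : ℕ}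
    (h : ∀ k < m + 1, LineStep P c v k τ) :
    ∃ q : ℕ → Plane, Pass P c (m + 1) v q ∧ ∀ k ≤ m + 1, cross v (q k) = τ := by
  induction m with
  | zero =>
    obtain ⟨p, q, ⟨t, ht, e⟩, hvis, hτ⟩ := h 0 Nat.one_pos
    refine ⟨fun k => Nat.casesOn k p fun _ => q, fun k hk => ?_, fun k hk => ?_⟩
    · obtain rfl : k = 0 := by omega
      exact ⟨⟨t, ht, e⟩, hvis⟩
    · rcases k with _ | k
      · exact hτ
      · change cross v q = τ
        rw [e, cross_add_smul_self, hτ]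
  | succ m ih =>
    obtain ⟨q, hq, hqτ⟩ := ih fun k hk => h k (by omega)
    obtain ⟨p, p', hp, hvis, hτ⟩ := h (m + 1) (Nat.lt_succ_self _)
    have hqp : q (m + 1) = p := by
      refine hvis.left_eq_of_cross_eq hP hp ?_ ?_
      · have := (hq m (Nat.lt_succ_self m)).2
        rw [this.symm_right_eq]; exact openEdge_subset _ _ this.right
      · rw [hqτ _ le_rfl, hτ]
    refine ⟨fun k => if k ≤ m + 1 then q k else p', fun k hk => ?_, fun k hk => ?_⟩
    · rcases Nat.lt_succ_iff_lt_or_eq.1 hk with hk | rfl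
      · simp only [if_pos hk.le, if_pos (Nat.succ_le_of_lt hk)]
        exact hq k hk
      · simp only [if_pos le_rfl, if_neg (Nat.not_succ_le_self _), hqp]
        exact ⟨hp, hvis⟩
    · by_cases hkm : k ≤ m + 1
      · simp only [if_pos hkm, hqτ k hkm]
      · simp only [if_neg hkm]
        obtain ⟨t, -, e⟩ := hp
        rw [e, cross_add_smul_self, hτ]

/-- With `B` as gate `0`, the unfolded direction is the velocity from `A` to `B`, so the line
continues the flight from `A`. -/
lemma RetroChain.pass {e : ℤ → Fin n} {s : ℤ → Plane × Plane} {m : ℕ}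
    (h : RetroChain P A B E m e s) :
    Pass P (prepend B E) m (s (-1)).2 fun k : ℕ => unf P (prepend B E) (k + 1) (s k).1 := by
  have h1 : IsChain P (prepend B E) m fun k : ℕ => s k := h.fwd
  have h2 := h1.pass h.mem_B
  have h3 : refl P B (s 0).2 = (s (-1)).2 := by
    rw [h.bounce.2.2.2, reflectIn_eq, refl_refl]
  change Pass P (prepend B E) m (refl P B (s 0).2) _ at h2
  rwa [h3] at h2

lemma RetroChain.pass_zero {e : ℤ → Fin n} {s : ℤ → Plane × Plane} {m : ℕ}
    (h : RetroChain P A B E m e s) : unf P (prepend B E) (0 + 1) (s (0 : ℕ)).1 = (s 0).1 :=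
  unf_succ_edge (c := prepend B E) (k := 0) (openEdge_subset _ _ h.mem_B)

/-- Disjointness gives `x ≠ y`. The vector `y - x` is parallel to `w` as a limit of flights and
parallel to `u` by `cross_eq`. -/
lemma RetroLimit.dir_eq (h : RetroLimit P A B E m e s x y u w)
    (hAB : Disjoint (P.edgeSet ℝ A) (P.edgeSet ℝ B)) : w = u ∨ w = -u := by
  have hw : ‖w‖ = 1 := by rw [← LinearIsometryEquiv.norm_map (refl P B), h.refl_B, h.norm_eq]
  have lx : Tendsto (fun i => (s i (-1)).1) atTop (𝓝 x) := (continuous_fst.tendsto _).comp h.tendsto_A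
  have ly : Tendsto (fun i => (s i 0).1) atTop (𝓝 y) := (continuous_fst.tendsto _).comp h.tendsto_B
  have lw : Tendsto (fun i => (s i (-1)).2) atTop (𝓝 w) := (continuous_snd.tendsto _).comp h.tendsto_A
  have hx : x ∈ P.edgeSet ℝ A := (isCompact_edgeSet P A).isClosed.mem_of_tendsto lx
    (Eventually.of_forall fun i => openEdge_subset _ _ (h.chain i).mem_A)
  have hy : y ∈ P.edgeSet ℝ B := (isCompact_edgeSet P B).isClosed.mem_of_tendsto ly
    (Eventually.of_forall fun i => openEdge_subset _ _ (h.chain i).mem_B)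
  have hne : y - x ≠ 0 := sub_ne_zero.2 fun he => disjoint_left.1 hAB hx (he ▸ hy)
  have h1 : cross w (y - x) = 0 := by
    refine tendsto_nhds_unique (tendsto_cross lw (ly.sub lx)) (tendsto_const_nhds.congr fun i => ?_)
    obtain ⟨⟨t, -, e1⟩, -⟩ := (h.chain i).bounce
    rw [e1, add_sub_cancel_left, cross_smul_right, cross_self, mul_zero]
  have h2 := eq_smul_of_cross_eq_zero hw h1
  have h3 : cross u (y - x) = 0 := by rw [cross_sub_right, h.cross_eq, sub_self]
  rw [h2, cross_smul_right] at h3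
  have h4 : cross u w = 0 := by
    refine (mul_eq_zero.1 h3).resolve_left fun h0 => hne ?_
    rw [h2, h0, zero_smul]
  have h5 := eq_smul_of_cross_eq_zero h.norm_eq h4
  have h6 := cross_sq_add_inner_sq u w
  rw [h4, hw, h.norm_eq] at h6
  have h7 : (inner ℝ u w : ℝ) ^ 2 = 1 := by linarith
  rcases mul_self_eq_one_iff.1 ((sq _).symm.trans h7) with h8 | h8
  · left; rw [h5, h8, one_smul]
  · right; rw [h5, h8, neg_one_smul]

/-- If the limit trajectory runs along the edge `A` and hits `B` perpendicularly, then parallel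
trajectories that leave `B` near the limit follow the code for a long time. -/
lemma RetroLimit.exists_parallel (hP : IsSimple P) (h : RetroLimit P A B E m e s x y u w)
    (hwu : w = -u) (K : ℕ) : ∃ d : Plane, cross u d ≠ 0 ∧ ∀ r ∈ Ioo (0 : ℝ) 1,
      y + r • d ∈ openEdge P B ∧ ∃ st, st 0 = (y + r • d, u) ∧ Fwd P E (K + 1) st := by
  have hw : ‖w‖ = 1 := by rw [hwu, norm_neg, h.norm_eq]
  have lx : Tendsto (fun i => (s i (-1)).1) atTop (𝓝 x) := (continuous_fst.tendsto _).comp h.tendsto_A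
  have ly : Tendsto (fun i => (s i 0).1) atTop (𝓝 y) := (continuous_fst.tendsto _).comp h.tendsto_B
  have lw : Tendsto (fun i => (s i (-1)).2) atTop (𝓝 w) := (continuous_snd.tendsto _).comp h.tendsto_A
  have hx : x ∈ P.edgeSet ℝ A := (isCompact_edgeSet P A).isClosed.mem_of_tendsto lx
    (Eventually.of_forall fun i => openEdge_subset _ _ (h.chain i).mem_A)
  have hy : y ∈ P.edgeSet ℝ B := (isCompact_edgeSet P B).isClosed.mem_of_tendsto ly
    (Eventually.of_forall fun i => openEdge_subset _ _ (h.chain i).mem_B)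
  have hw0 : w ≠ 0 := by
    intro h0; rw [h0, norm_zero] at hw; exact zero_ne_one hw
  -- the edge `A` is parallel to `w`
  obtain ⟨κ, hκ⟩ : ∃ κ : ℝ, P (finRotate n A) - P A = κ • w := by
    have h1 : refl P A w = w := by rw [h.refl_A, hwu]
    rw [refl, Submodule.reflection_eq_self_iff, Submodule.mem_span_singleton] at h1
    obtain ⟨c, hc⟩ := h1
    have hc0 : c ≠ 0 := by
      rintro rfl
      rw [zero_smul] at hc
      exact hw0 hc.symm
    exact ⟨c⁻¹, by rw [← hc, inv_smul_smul₀ hc0]⟩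
  have hκ0 : κ ≠ 0 := by
    rintro rfl
    rw [zero_smul, sub_eq_zero] at hκ
    exact hP.nondegenerate A hκ.symm
  have hparA : ∀ p ∈ P.edgeSet ℝ A, cross w p = cross w y := by
    have hxy : cross w x = cross w y := by
      rw [hwu, cross_neg_left, cross_neg_left, h.cross_eq]
    intro p hp
    have h1 := cross_edge hp (left_mem_edgeSet P A) (right_mem_edgeSet P A)
    have h2 := cross_edge (left_mem_edgeSet P A) (right_mem_edgeSet P A) hp
    have h3 := cross_edge (left_mem_edgeSet P A) (right_mem_edgeSet P A) hx
    rw [hκ, cross_smul_left, cross_sub_right] at h2 h3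
    have h4 := (mul_eq_zero.1 h2).resolve_left hκ0
    have h5 := (mul_eq_zero.1 h3).resolve_left hκ0
    linarith
  -- the edge `B` is perpendicular to `w`
  have hperB : ∀ p ∈ P.edgeSet ℝ B, ∀ p' ∈ P.edgeSet ℝ B, inner ℝ w (p - p') = 0 := by
    intro p hp p' hp'
    have h1 := (refl P B).inner_map_map w (p - p')
    rw [refl_edge B hp hp', h.refl_B, hwu, inner_neg_left] at h1
    rw [hwu, inner_neg_left]
    linarith
  obtain ⟨q, hq⟩ : ∃ q : ℕ → ℕ → Plane,
    q = fun i k => unf P (prepend B E) (k + 1) (s i k).1 := ⟨_, rfl⟩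
  have hpass : ∀ i, Pass P (prepend B E) (m i) (s i (-1)).2 (q i) := fun i => by
    rw [hq]; exact (h.chain i).pass
  have hq0 : ∀ i, q i 0 = (s i 0).1 := fun i => by rw [hq]; exact (h.chain i).pass_zero
  have hwn : ∀ i, ‖(s i (-1)).2‖ = 1 := fun i => ((h.chain i).chain (-1)).1
  have lq0 : Tendsto (fun i => q i 0) atTop (𝓝 y) := by simp_rw [hq0]; exact ly
  have lq := tendsto_cross_pass h.tendsto_m hpass hwn lw lq0
  have hstep : ∀ i, ∃ t : ℝ, 0 < t ∧ cross w (s i 0).1 - cross w y = t * cross w (s i (-1)).2 := by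
    intro i
    obtain ⟨⟨t, ht, e1⟩, -⟩ := (h.chain i).bounce
    refine ⟨t, ht, ?_⟩
    rw [e1, cross_add_right, cross_smul_right,
      hparA _ (openEdge_subset _ _ (h.chain i).mem_A)]
    ring
  have hne : ∀ i, cross w (s i 0).1 - cross w y ≠ 0 := by
    intro i h0
    refine (h.chain i).vis.cross_ne_zero (hP.nondegenerate A) ?_
    rw [hκ, cross_smul_left, cross_sub_right, hparA _ (openEdge_subset _ _ (h.chain i).mem_A), h0,
      mul_zero]
  -- The limit line contains the edge `A`, and the flights leave that line. The side `σ` is one on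
  -- which the arrival points at `B` lie infinitely often; a late trajectory `j` on this side bounds
  -- the strip to be found.
  obtain ⟨σ, hσ, hfreq⟩ : ∃ σ : ℝ, (σ = 1 ∨ σ = -1) ∧
      ∃ᶠ i in atTop, 0 < σ * (cross w (s i 0).1 - cross w y) := by
    by_contra! hcon
    have h1 := hcon 1 (.inl rfl)
    have h2 := hcon (-1) (.inr rfl)
    obtain ⟨i, h3, h4⟩ := (h1.and h2).exists
    exact hne i (by linarith)
  have hin : ∀ᶠ i in atTop, 0 < (inner ℝ w (s i (-1)).2 : ℝ) := by
    have : Tendsto (fun i => (inner ℝ w (s i (-1)).2 : ℝ)) atTop (𝓝 (inner ℝ w w)) :=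
      tendsto_const_nhds.inner lw
    rw [real_inner_self_eq_norm_sq, hw] at this
    exact this.eventually (lt_mem_nhds (by norm_num))
  obtain ⟨j, hj1, hj2, hj3⟩ := (hfreq.and_eventually
    (hin.and (h.tendsto_m.eventually_ge_atTop (K + 1)))).exists
  have hσ0 : σ ≠ 0 := by rcases hσ with rfl | rfl <;> norm_num
  have hjw : 0 < σ * cross w (s j (-1)).2 := by
    obtain ⟨t, ht, e1⟩ := hstep j
    rw [e1, mul_left_comm] at hj1
    exact pos_of_mul_pos_right hj1 ht.le
  obtain ⟨d, hd⟩ : ∃ d, d = (s j 0).1 - y := ⟨_, rfl⟩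
  have hyj : (s j 0).1 ∈ P.edgeSet ℝ B := openEdge_subset _ _ (h.chain j).mem_B
  have hcd : cross w d = cross w (s j 0).1 - cross w y := by rw [hd, cross_sub_right]
  have hjd : 0 < σ * cross (s j (-1)).2 d := by
    rw [cross_eq_of_unit hw, hd, hperB _ hyj _ hy, ← hd, hcd, mul_zero, sub_zero, mul_left_comm]
    exact mul_pos hj2 hj1
  refine ⟨d, ?_, fun r hr => ?_⟩
  · have : cross u d = -cross w d := by rw [hwu, cross_neg_left, neg_neg]
    rw [this, hcd]
    exact neg_ne_zero.2 (hne j)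
  have hyr : y + r • d ∈ P.edgeSet ℝ B := by
    rw [edgeSet_eq] at hy hyj ⊢
    rw [hd]
    exact (convex_segment _ _).add_smul_sub_mem hy hyj ⟨hr.1.le, hr.2.le⟩
  -- From `B` on, trajectory `j` keeps moving away from the limit line on the side `σ`, while at
  -- each gate the trajectories `i` tend to that line. For large `i` the two enclose the line of
  -- direction `w` through `y + r • d`.
  have hline : ∀ k < K + 1, LineStep P (prepend B E) w k (cross w (y + r • d)) := by
    intro k hk
    have hupper : ∀ k ≤ K + 1, σ * cross w (s j 0).1 ≤ σ * cross w (q j k) := by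
      intro k hk
      obtain ⟨e1, -, e2⟩ := (hpass j).length (hwn j) (Nat.zero_le k) (hk.trans hj3)
      have h1 := mul_nonneg e2 hjw.le
      have h2 : cross w (q j k) = cross w (s j 0).1 +
          inner ℝ (s j (-1)).2 (q j k - q j 0) * cross w (s j (-1)).2 := by
        rw [← hq0, ← cross_smul_right, ← cross_add_right, ← e1]
      rw [h2]
      linarith
    have hlower : ∀ k, ∀ᶠ i in atTop, σ * cross w (q i k) < σ * cross w (y + r • d) := by
      intro k
      refine ((lq k).const_mul σ).eventually (gt_mem_nhds ?_)
      rw [cross_add_right, cross_smul_right, hcd]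
      have := mul_pos hr.1 hj1
      linarith
    have hc1 : ∀ k ≤ K + 1, ∀ᶠ i in atTop, 0 < σ * cross (s i (-1)).2 (q j k - q i k) := by
      intro k hk
      have h1 : Tendsto (fun i => σ * (cross (s i (-1)).2 (q j k) - cross (s i (-1)).2 (q i 0))) atTop
          (𝓝 (σ * (cross w (q j k) - cross w y))) :=
        ((tendsto_cross lw tendsto_const_nhds).sub (tendsto_cross lw lq0)).const_mul σ
      have h2 : 0 < σ * (cross w (q j k) - cross w y) := by
        have := hupper k hk
        linarith
      filter_upwards [h1.eventually (lt_mem_nhds h2), h.tendsto_m.eventually_ge_atTop k] with i h3 h4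
      obtain ⟨e1, -, -⟩ := (hpass i).length (hwn i) (Nat.zero_le k) h4
      rw [cross_sub_right, e1, cross_add_smul_self]
      exact h3
    have hc2 : ∀ k ≤ K + 1, ∀ᶠ i in atTop, 0 < σ * cross (s j (-1)).2 (q j k - q i k) := by
      intro k hk
      have h1 : Tendsto (fun i => σ * cross (s j (-1)).2 ((s j 0).1 - q i 0)) atTop
          (𝓝 (σ * cross (s j (-1)).2 ((s j 0).1 - y))) :=
        (tendsto_cross tendsto_const_nhds (tendsto_const_nhds.sub lq0)).const_mul σ
      rw [← hd] at h1
      have h2 : Tendsto (fun i => σ * cross (s j (-1)).2 (s i (-1)).2) atTop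
          (𝓝 (σ * cross (s j (-1)).2 w)) := (tendsto_cross tendsto_const_nhds lw).const_mul σ
      have h3 : σ * cross (s j (-1)).2 w < 0 := by rw [cross_comm]; linarith
      filter_upwards [h1.eventually (lt_mem_nhds hjd), h2.eventually (gt_mem_nhds h3),
        h.tendsto_m.eventually_ge_atTop k] with i h4 h5 h6
      obtain ⟨e1, -, e2⟩ := (hpass i).length (hwn i) (Nat.zero_le k) h6
      obtain ⟨e3, -, -⟩ := (hpass j).length (hwn j) (Nat.zero_le k) (hk.trans hj3)
      have e4 : cross (s j (-1)).2 (q j k - q i k) = cross (s j (-1)).2 ((s j 0).1 - q i 0) -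
          inner ℝ (s i (-1)).2 (q i k - q i 0) * cross (s j (-1)).2 (s i (-1)).2 := by
        rw [cross_sub_right, e3, cross_add_smul_self, hq0, e1, cross_add_right, cross_smul_right,
          cross_sub_right]
        simp only [add_sub_cancel_left, inner_smul_right, real_inner_self_eq_norm_sq, hwn]
        ring
      rw [e4]
      have := mul_nonpos_of_nonneg_of_nonpos e2 h5.le
      linarith
    obtain ⟨i, ⟨⟨⟨a1, a2⟩, a3, a4⟩, a5, a6⟩, a7⟩ := ((((((hlower k).and (hlower (k + 1))).and
      ((hc1 k (by omega)).and (hc1 (k + 1) (by omega)))).and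
      ((hc2 k (by omega)).and (hc2 (k + 1) (by omega))))).and
      (h.tendsto_m.eventually_ge_atTop (k + 1))).exists
    have hquad : QuadU P σ (prepend B E) k (q i k) (q i (k + 1)) (s i (-1)).2 (q j k) (q j (k + 1))
        (s j (-1)).2 :=
      ⟨(hpass i k a7).2, (hpass j k (by omega)).2, (hpass i k a7).1, (hpass j k (by omega)).1,
        a3, a4, a5, a6⟩
    have htop : σ * cross w (y + r • d) < σ * cross w (s j 0).1 := by
      rw [cross_add_right, cross_smul_right, hcd]
      have := mul_pos (sub_pos.2 hr.2) hj1
      linarith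
    obtain ⟨p, p', ht, hvis, hτ⟩ := hquad.between hP (v := w) a1 a2
      (htop.trans_le (hupper k (by omega))) (htop.trans_le (hupper (k + 1) (by omega)))
    exact ⟨p, p', ht, hvis, mul_left_cancel₀ hσ0 hτ⟩
  obtain ⟨p, hp, hpτ⟩ := exists_pass_of_lineStep_lt hP hline
  have hmem := hp.mem (Nat.succ_pos K) (Nat.zero_le _)
  have hch := hp.chain
  have hp0 : p 0 = (unf P (prepend B E) (0 + 1)).symm (p 0) := by
    have := unf_succ_edge (c := prepend B E) (k := 0) (openEdge_subset _ _ hmem)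
    rw [AffineIsometryEquiv.apply_symm_apply] at this
    exact this
  have hpy : p 0 = y + r • d := by
    rw [← hp0] at hmem
    refine sub_eq_zero.1 (eq_zero_of_cross_of_inner hw ?_ (hperB _ (openEdge_subset _ _ hmem) _ hyr))
    rw [cross_sub_right, hpτ 0 (Nat.zero_le _), sub_self]
  have hvel : (unfL P (prepend B E) (0 + 1)).symm w = u := by
    rw [LinearIsometryEquiv.symm_apply_eq, ← h.refl_B, unfL_succ, unfL_zero]
    exact (refl_refl B w).symm
  rw [← hp0, hpy] at hmem
  refine ⟨hmem, _, ?_, hch⟩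
  rw [← hp0, hpy, hvel]

/-- Since `B` is perpendicular to `u`, a trajectory that leaves `B` in direction `u` has also
arrived along the same line; its past code repeats its future code. A generic parallel line avoids
the vertices. -/
lemma RetroLimit.glueC_mem_closure (hP : IsSimple P) (h : RetroLimit P A B E m e s x y u w)
    (hwu : w = -u) : glueC B E E ∈ closure (bounceSpectrum P) := by
  rw [mem_closure_int]
  intro M
  obtain ⟨d, hd, hr⟩ := h.exists_parallel hP hwu M
  obtain ⟨r, hr1, hr2⟩ := exists_mem_Ioo_notMem
    (countable_parallel (countable_unfoldedVertices P) y hd) (zero_lt_one' ℝ)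
  obtain ⟨hmem, st, h0, hF⟩ := hr r hr1
  have hen : Enters P (y + r • d, u) := h0 ▸ (hF 0 (Nat.succ_pos M)).enters_left
  obtain ⟨E', st', h0', hF'⟩ := (nonsingular_of_forall_notMem hen h.norm_eq
    fun T _ hT => hr2 ⟨T, hT⟩).exists_fwd hP
  have hE := ((hF' (M + 1)).eq_of_eq hP hF (h0'.trans h0.symm)).2
  refine ⟨glueC B E' E', glueC_mem hF' hF' (by rw [h0']; exact hmem) ?_ (by rw [h0']; exact h.norm_eq),
    fun k hk => eq_glueC glueC_zero (fun k hk => ?_) (fun k hk => ?_) hk⟩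
  · rw [h0', rev]
    simp only
    rw [← h.refl_B, refl_refl, h.refl_B, hwu, neg_neg]
  · rw [glueC_pos]; exact hE k (by omega)
  · rw [glueC_neg]; exact hE k (by omega)

lemma BiChain.mem_forwardBounceSpectrum {e : ℤ → Fin n} {s : ℤ → Plane × Plane}
    (h : BiChain P e s) (a : ℤ) : (fun k : ℕ => e (k + a)) ∈ forwardBounceSpectrum P := by
  refine ⟨fun k => s (k + (a - 1)), .inr (edgeSet_subset_boundary P _
    (openEdge_subset _ _ (h.mem_openEdge _))), fun k => ⟨(h _).1, ?_⟩⟩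
  have := (h (k + (a - 1))).2
  rw [show (k : ℤ) + (a - 1) + 1 = k + a by ring] at this
  change Bounce P (e (k + a)) (s (k + (a - 1))) (s ((k + 1 : ℕ) + (a - 1)))
  rwa [show ((k + 1 : ℕ) : ℤ) + (a - 1) = k + a by push_cast; ring]

/-- The limit is grazed by the single edge `A`: the half sequence `A, B, E 0, …` comes from the
approximating trajectories read forward, and `A, E 0, …` from the same trajectories read backward.
-/
lemma RetroLimit.isGrazing (hP : IsSimple P) (h : RetroLimit P A B E m e s x y u w)
    (hwu : w = -u) : IsGrazing P E := by
  refine ⟨glueC B E E, h.glueC_mem_closure hP hwu, glueC_pos, A, A, ?_, ?_, ?_⟩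
  · obtain ⟨i, hi⟩ := (h.tendsto_m.eventually_ge_atTop 1).exists
    have h1 := (h.chain i).vis.edge_ne
    have h2 := (h.chain i).symm.ne_code hi
    ext k
    simp only [mem_inter_iff, mem_insert_iff, mem_singleton_iff, mem_empty_iff_false, iff_false,
      or_self, not_and]
    rintro hk rfl
    rcases hk with hk | hk
    · exact h1 hk
    · exact h2 hk
  · rw [mem_closure_nat]
    intro M
    obtain ⟨i, hi⟩ := (h.tendsto_m.eventually_ge_atTop M).exists
    have hc := h.chain i
    refine ⟨_, hc.chain.mem_forwardBounceSpectrum (-1), fun k hk => ?_⟩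
    rcases k with _ | _ | k
    · exact hc.code_A
    · exact hc.code_B
    · change _ = glueC B E E (-((k + 1 : ℕ) : ℤ))
      rw [show -((k + 1 : ℕ) : ℤ) = -1 - k by push_cast; ring, glueC_neg,
        ← hc.code_pos k (by omega)]
      congr 1; push_cast; ring
  · rw [mem_closure_nat]
    intro M
    obtain ⟨i, hi⟩ := (h.tendsto_m.eventually_ge_atTop M).exists
    have hc := (h.chain i).symm
    refine ⟨_, hc.chain.mem_forwardBounceSpectrum 0, fun k hk => ?_⟩
    rcases k with _ | k
    · exact hc.code_B
    · exact hc.code_pos k (by omega)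

lemma meetAtAngle_of_code (hP : IsSimple P) (hE : IsAperiodic E) (hg : ¬ IsGrazing P E)
    (h : ∀ m, retroWord A B E m ∈ bounceLanguage P) : MeetAtAngle P A B (Real.pi / 2) := by
  obtain ⟨m, e, s, x, y, u, w, hL⟩ := exists_retroLimit hP hE h
  by_cases hAB : Disjoint (P.edgeSet ℝ A) (P.edgeSet ℝ B)
  · rcases hL.dir_eq hAB with hw | hw
    · exact absurd (hL.symm.isGrazing hP (by rw [hw])) hg
    · exact absurd (hL.isGrazing hP hw) hg
  · exact hL.meetAtAngle hP hAB

end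

end Billiard

end

theorem mainTheorem10 {n : ℕ} (P : Polygon Billiard.Plane n) (hP : Billiard.IsSimple P)
    (A B : Fin n) :
    Billiard.MeetAtAngle P A B (Real.pi / 2) ↔
      ∃ E : ℕ → Fin n, Billiard.IsAperiodic E ∧ ¬ Billiard.IsGrazing P E ∧
        ∀ m : ℕ, Billiard.retroWord A B E m ∈ Billiard.bounceLanguage P :=
  ⟨Billiard.exists_code_of_meetAtAngle hP, fun ⟨_, hE, hg, h⟩ =>
    Billiard.meetAtAngle_of_code hP hE hg h⟩
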